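/- Let $S$ be a complex surface and let $\nabla$ be a logarithmic affine structure on $S$ with polar divisor $D$. This means that $D\subset S$ is a complex curve (possibly singular, taken reduced), that $\nabla$ is a meromorphic affine connection (a connection on the tangent bundle $T_S$), holomorphic on $S\setminus D$, having a pole at every point of $D$, with identically vanishing torsion and curvature, and that $\nabla$ is logarithmic: in any local coordinates, writing $\nabla=d+\theta$ with $\theta$ the $2\times 2$ matrix of meromorphic $1$-forms, and taking a reduced local equation $f$ of $D$, both $f\theta$ and $f\,d\theta$ are holomorphic. Let $V$ be the local system on $S\setminus D$, of rank two, of the $1$-forms that are horizontal for the dual connection; they are closed. Let $D_0$ be an irreducible component of $D$, and suppose that the local monodromy of $V$ around $D_0$ (its continuation along a small loop around $D_0$ at a smooth point of $D$; its conjugacy class is independent of the choices) is semisimple. Then there is a closed discrete subset $Z\subset D_0$ such that at every point $p\in D_0\setminus Z$ there are local holomorphic coordinates $(x,y)$ centred at $p$, with $D=\{y=0\}$ in their domain, in which $V$ is generated outside $y=0$ by the (possibly multivalued) pencil $\omega_t=\omega_0+t\,\omega_\infty$, that is $V=\mathbb{C}\langle\omega_0,\omega_\infty\rangle$, where either $$\omega_t=dx+t\,y^{\nu}\,dy\quad\text{for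 some }\nu\in\mathbb{C}^*,$$ or $$\omega_t=dx+t\left(\frac{dy}{y^{n}}+\frac{dy}{y}\right)\quad\text{for some integer }n>1.$$ -/

import Mathlib

open Set Topology
open scoped Manifold ContDiff

noncomputable section

namespace AffineStructure

/-- The affine plane `ℂ²`, with coordinates `x = z.1` and `y = z.2`. -/
abbrev Plane : Type := ℂ × ℂ

section Surface

variable {S : Type*} [TopologicalSpace S] [ChartedSpace Plane S]

/-- Holomorphic local coordinates `(x, y)` on an open subset `e.source` of the complex surface. -/
def IsCoordinates (e : OpenPartialHomeomorph S Plane) : Prop :=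
  e ∈ IsManifold.maximalAtlas 𝓘(ℂ, Plane) ω S

/-- The image of `D` in the coordinates `e`. -/
def imageIn (D : Set S) (e : OpenPartialHomeomorph S Plane) : Set Plane :=
  e.target ∩ e.symm ⁻¹' D

/-- `f` is a reduced holomorphic equation on `U` of the set `A`: it vanishes exactly on `A`, and its
differential does not vanish on a dense subset of `A`. -/
structure IsReducedEquationOn (f : Plane → ℂ) (A U : Set Plane) : Prop where
  analytic : AnalyticOnNhd ℂ f U
  zero_iff : ∀ z ∈ U, f z = 0 ↔ z ∈ A
  reduced : A ∩ U ⊆ closure {z | z ∈ U ∧ f z = 0 ∧ fderiv ℂ f z ≠ 0}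

/-- Local coordinates centred at `p` in which `D` is the line `y = 0`. -/
structure IsAdapted (D : Set S) (p : S) (e : OpenPartialHomeomorph S Plane) : Prop where
  isCoordinates : IsCoordinates e
  mem_source : p ∈ e.source
  centred : e p = 0
  mem_iff : ∀ q ∈ e.source, q ∈ D ↔ (e q).2 = 0

/-- The points at which `D` is a smooth complex curve. -/
def regularLocus (D : Set S) : Set S :=
  {p | ∃ e : OpenPartialHomeomorph S Plane, IsAdapted D p e}

/-- The irreducible components (branches) of a complex curve `D` are the closures of the connected
components of its regular locus. -/
def IsBranch (D D₀ : Set S) : Prop :=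
  ∃ p ∈ regularLocus D, D₀ = closure (connectedComponentIn (regularLocus D) p)

/-- The coordinate vector field which is constant equal to `v` in the coordinates `e`. -/
def coordField (e : OpenPartialHomeomorph S Plane) (v : Plane) :
    Π q : S, TangentSpace 𝓘(ℂ, Plane) q :=
  VectorField.mpullback 𝓘(ℂ, Plane) 𝓘(ℂ, Plane) e (fun _ ↦ v)

/-- The type of (not necessarily meaningful) operators `∇` sending a vector field `Y` to the field
of endomorphisms `X ↦ ∇_X Y`. -/
abbrev Connection (S : Type*) [TopologicalSpace S] [ChartedSpace Plane S] : Type _ :=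
  (Π q : S, TangentSpace 𝓘(ℂ, Plane) q) →
    (Π q : S, TangentSpace 𝓘(ℂ, Plane) q →L[ℂ] TangentSpace 𝓘(ℂ, Plane) q)

/-- The endomorphism `u ↦ ∇_u Y` of the tangent space at the point of coordinates `z`, for `Y` the
coordinate field `v`, written in the coordinates `e`. -/
def coordCov (nabla : Connection S) (e : OpenPartialHomeomorph S Plane) (v z : Plane) :
    Plane →L[ℂ] Plane :=
  (mfderiv 𝓘(ℂ, Plane) 𝓘(ℂ, Plane) e (e.symm z) : Plane →L[ℂ] Plane) ∘L
    (nabla (coordField e v) (e.symm z) : Plane →L[ℂ] Plane) ∘L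
      (mfderiv 𝓘(ℂ, Plane) 𝓘(ℂ, Plane) e (e.symm z) : Plane →L[ℂ] Plane).inverse

/-- The matrix of `1`-forms `θ` of the connection in the frame `(∂x, ∂y)`, so that `∇ = d + θ`:
`theta nabla e z u v = v.1 • ∇_u ∂x + v.2 • ∇_u ∂y`. Its entries are the Christoffel symbols. -/
def theta (nabla : Connection S) (e : OpenPartialHomeomorph S Plane) (z : Plane) :
    Plane →L[ℂ] Plane →L[ℂ] Plane :=
  (ContinuousLinearMap.smulRightL ℂ Plane Plane (ContinuousLinearMap.fst ℂ ℂ ℂ)) ∘L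
      coordCov nabla e (1, 0) z +
    (ContinuousLinearMap.smulRightL ℂ Plane Plane (ContinuousLinearMap.snd ℂ ℂ ℂ)) ∘L
      coordCov nabla e (0, 1) z

/-- The exterior derivative `dθ(u, v)` of the matrix of `1`-forms `θ`. -/
def dTheta (nabla : Connection S) (e : OpenPartialHomeomorph S Plane) (z u v : Plane) :
    Plane →L[ℂ] Plane :=
  fderiv ℂ (theta nabla e) z u v - fderiv ℂ (theta nabla e) z v u

/-- In the coordinates `e`, the connection has a logarithmic pole (or no pole) along `D` near the
point of coordinates `z₀`: for a reduced local equation `f` of `D`, both `f θ` and `f dθ` extend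
holomorphically through `D`. -/
def IsLogarithmicNear (nabla : Connection S) (D : Set S) (e : OpenPartialHomeomorph S Plane)
    (z₀ : Plane) : Prop :=
  ∃ (U : Set Plane) (f : Plane → ℂ) (G : Plane → Plane →L[ℂ] Plane →L[ℂ] Plane)
    (H : Plane → Plane → Plane → Plane →L[ℂ] Plane),
    IsOpen U ∧ z₀ ∈ U ∧ U ⊆ e.target ∧ IsReducedEquationOn f (imageIn D e) U ∧
    AnalyticOnNhd ℂ G U ∧ (∀ z ∈ U \ imageIn D e, G z = f z • theta nabla e z) ∧
    ∀ u v : Plane, AnalyticOnNhd ℂ (H u v) U ∧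
      ∀ z ∈ U \ imageIn D e, H u v z = f z • dTheta nabla e z u v

/-- In the coordinates `e`, the connection extends holomorphically near the point of coordinates
`z₀`. -/
def ExtendsNear (nabla : Connection S) (D : Set S) (e : OpenPartialHomeomorph S Plane)
    (z₀ : Plane) : Prop :=
  ∃ (U : Set Plane) (G : Plane → Plane →L[ℂ] Plane →L[ℂ] Plane),
    IsOpen U ∧ z₀ ∈ U ∧ U ⊆ e.target ∧ AnalyticOnNhd ℂ G U ∧
      ∀ z ∈ U \ imageIn D e, G z = theta nabla e z

/-- A logarithmic affine structure with polar divisor `D`: an affine connection on the complement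
of `D`, with vanishing torsion and curvature, with logarithmic poles along `D`, and with a genuine
pole at each point of `D`. (That the connection is holomorphic outside `D` is part of
`logarithmic`.) -/
structure IsLogarithmic [IsManifold 𝓘(ℂ, Plane) ω S] (nabla : Connection S) (D : Set S) : Prop where
  isCovariantDerivativeOn : IsCovariantDerivativeOn Plane nabla Dᶜ
  torsion_eq_zero : ∀ p ∉ D, ∀ X Y : Π q : S, TangentSpace 𝓘(ℂ, Plane) q,
    MDifferentiableAt 𝓘(ℂ, Plane) 𝓘(ℂ, Plane).tangent (T% X) p →
    MDifferentiableAt 𝓘(ℂ, Plane) 𝓘(ℂ, Plane).tangent (T% Y) p →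
    nabla Y p (X p) - nabla X p (Y p) - VectorField.mlieBracket 𝓘(ℂ, Plane) X Y p = 0
  curvature_eq_zero : ∀ p ∉ D, ∀ X Y Z : Π q : S, TangentSpace 𝓘(ℂ, Plane) q,
    ContMDiffAt 𝓘(ℂ, Plane) 𝓘(ℂ, Plane).tangent ω (T% X) p →
    ContMDiffAt 𝓘(ℂ, Plane) 𝓘(ℂ, Plane).tangent ω (T% Y) p →
    ContMDiffAt 𝓘(ℂ, Plane) 𝓘(ℂ, Plane).tangent ω (T% Z) p →
    nabla (fun q ↦ nabla Z q (Y q)) p (X p) - nabla (fun q ↦ nabla Z q (X q)) p (Y p)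
      - nabla Z p (VectorField.mlieBracket 𝓘(ℂ, Plane) X Y p) = 0
  logarithmic : ∀ (p : S) (e : OpenPartialHomeomorph S Plane), IsCoordinates e → p ∈ e.source →
    IsLogarithmicNear nabla D e (e p)
  polar : ∀ p ∈ D, ∀ e : OpenPartialHomeomorph S Plane, IsCoordinates e → p ∈ e.source →
    ¬ ExtendsNear nabla D e (e p)

/-- `η` is a horizontal `1`-form on the open set `W` of the coordinate domain: for the dual
connection, `(∇_u η)(v) = d(η(v))(u) - η(∇_u v) = 0` for constant `v`. -/
def IsHorizontalOn (nabla : Connection S) (e : OpenPartialHomeomorph S Plane) (W : Set Plane)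
    (η : Plane → Plane →L[ℂ] ℂ) : Prop :=
  ∀ z ∈ W, DifferentiableAt ℂ η z ∧ ∀ u : Plane, fderiv ℂ η z u = (η z) ∘L (theta nabla e z u)

/-- `M` is the linear monodromy of the affine structure, acting on horizontal `1`-forms by parallel
transport along the loop `s ↦ (0, r exp (2 π i s))`, `0 ≤ s ≤ 1`, of the coordinates `e`. -/
def IsMonodromy (nabla : Connection S) (e : OpenPartialHomeomorph S Plane) (r : ℝ)
    (M : Module.End ℂ (Plane →L[ℂ] ℂ)) : Prop :=
  ∀ η₀ : Plane →L[ℂ] ℂ, ∃ η : ℝ → Plane →L[ℂ] ℂ, η 0 = η₀ ∧ η 1 = M η₀ ∧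
    ∀ s : ℝ, HasDerivAt η
      ((η s) ∘L (theta nabla e (0, r * Complex.exp (2 * Real.pi * Complex.I * s))
        (0, 2 * Real.pi * Complex.I * (r * Complex.exp (2 * Real.pi * Complex.I * s))))) s

/-- The local monodromy around the branch `D₀` of `D` is semisimple: so is the monodromy along
a small positive loop around `D₀`, in a disc that is transverse to `D₀` at a smooth point `p` of `D`.
(The conjugacy class of this monodromy depends neither on `p` nor on the disc.) -/
def HasSemisimpleMonodromy (nabla : Connection S) (D D₀ : Set S) : Prop :=
  ∃ p ∈ D₀, ∃ (e : OpenPartialHomeomorph S Plane) (r : ℝ) (M : Module.End ℂ (Plane →L[ℂ] ℂ)),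
    IsAdapted D p e ∧ 0 < r ∧ (∀ y : ℂ, ‖y‖ ≤ r → ((0, y) : Plane) ∈ e.target) ∧
      IsMonodromy nabla e r M ∧ M.IsSemisimple

/-- The `1`-form `dx` on `ℂ²`. -/
def dx : Plane →L[ℂ] ℂ := ContinuousLinearMap.fst ℂ ℂ ℂ

/-- The `1`-form `dy` on `ℂ²`. -/
def dy : Plane →L[ℂ] ℂ := ContinuousLinearMap.snd ℂ ℂ ℂ

/-- On `W`, the affine structure is the one of the pencil `ω_t = dx + t h dy`: the horizontal
`1`-forms are exactly the linear combinations of `dx` and `h dy` with constant coefficients. -/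
def IsGivenByPencilOn (nabla : Connection S) (e : OpenPartialHomeomorph S Plane) (W : Set Plane)
    (h : Plane → ℂ) : Prop :=
  ∀ η : Plane → Plane →L[ℂ] ℂ, IsHorizontalOn nabla e W η ↔
    ∃ a b : ℂ, ∀ z ∈ W, η z = a • dx + b • (h z • dy)

/-- In the coordinates `e`, the affine structure is given by `ω_t = dx + t y ^ ν dy`. The pencil is
multivalued: the condition is imposed on every connected open set outside `y = 0`
that carries a branch `l` of `log y`, with `y ^ ν = exp (ν l)`. -/
def IsPowerModel (nabla : Connection S) (e : OpenPartialHomeomorph S Plane) (ν : ℂ) : Prop :=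
  ∀ (W : Set Plane) (l : Plane → ℂ), IsOpen W → IsPreconnected W → W ⊆ e.target →
    ContinuousOn l W → (∀ z ∈ W, z.2 ≠ 0 ∧ Complex.exp (l z) = z.2) →
    IsGivenByPencilOn nabla e W (fun z ↦ Complex.exp (ν * l z))

/-- In the coordinates `e`, the affine structure is given by
`ω_t = dx + t (dy / y ^ n + dy / y)`. -/
def IsResidueModel (nabla : Connection S) (e : OpenPartialHomeomorph S Plane) (n : ℕ) : Prop :=
  ∀ W : Set Plane, IsOpen W → IsPreconnected W → W ⊆ e.target → (∀ z ∈ W, z.2 ≠ 0) →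
    IsGivenByPencilOn nabla e W (fun z ↦ 1 / z.2 ^ n + 1 / z.2)

end Surface

end AffineStructure

end

/-! Near a smooth point of `D`, take coordinates with `D = {y = 0}`. Holomorphy of `f θ` and `f dθ`
forces `θ = B dx + A dy / y` with `A` and `B` holomorphic (`exists_regular_parts`), so on a
transverse disc the horizontal forms solve a Fuchsian equation `y u' = u A`. In the variable `w =
log y`, an eigenvector of the monodromy is an exponential times a periodic function; it grows at
most like a power of `1 / y`, hence equals `y ^ β h(y)` with `h` holomorphic and `h 0 ≠ 0`
(`exists_isLogSolution`). A semisimple monodromy has a basis of eigenvectors, and their leading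
coefficients can be made independent: dependent ones are eigenvectors of the residue for the same
exponent, and a subtraction raises the exponent of one solution
(`exists_independent_isLogSolution`).

There is no pole in the direction of `x`, so such a frame is continued along `D` by a regular
equation in `x`, and flatness carries the equation in `y` from one slice to the others. The property
obtained, a holomorphic frame with all `y ^ α i η i` horizontal (`IsDiagonalAt`), is independent of
the coordinates and locally constant on the regular locus. The regular part of a branch being
connected, one transverse disc decides for all of it.

Vanishing torsion makes `y ^ α η` closed, whence `α η(∂x) = 0` on `y = 0`. Independence forbids two
nonzero exponents; two zero exponents would make the connection holomorphic, against the presence of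
a pole. So exactly one exponent is zero, and its form is `dX`. The other form satisfies `y ^ α η =
d(y ^ (α + 1) W) + ρ y ^ (α + m) dy`, where `ρ = 0` unless the last term is a multiple of `dy / y`
(`exists_log_potential`). A suitable `Y = y exp s` turns it into a constant multiple of `h(Y) dY`,
with `h(Y) = Y ^ α` or, when `α = -n` with `n > 1` and `ρ ≠ 0`, `h(Y) = Y ^ (-n) + Y ^ (-1)`
(`exists_isModelCoordinate`). In the coordinates `(X, Y)` the only Christoffel symbol is the
logarithmic derivative of `h`, which is the connection of the pencil `dX + t h(Y) dY`.

The exceptional set is the set of singular points of `D` on the branch. They are isolated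
(`eventually_isSmoothZeroAt`): the power sums of the roots of `f (x, ·)` are holomorphic in `x`, and
a determinant built from them has, for small `x ≠ 0`, the same zeros as `f`, all of them simple. -/

noncomputable section

namespace AffineStructure

/-! ### Holomorphic functions of two variables: Osgood's lemma and division by `y` -/

section SeveralVariables

open Metric Complex Filter MeasureTheory
open scoped Real NNReal

variable {E : Type*} [NormedAddCommGroup E] [NormedSpace ℂ E] [CompleteSpace E]
  {G : Type*} [NormedAddCommGroup G] [NormedSpace ℂ G] [CompleteSpace G]

/-- A continuous map to a Banach space is holomorphic as soon as its images under a separating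
family of continuous linear maps are. -/
theorem differentiableOn_of_separating {ι : Type*} (L : ι → E →L[ℂ] G)
    (hL : ∀ v, (∀ i, L i v = 0) → v = 0) {U : Set ℂ} (hU : IsOpen U) {F : ℂ → E}
    (hc : ContinuousOn F U) (hd : ∀ i, DifferentiableOn ℂ (fun w ↦ L i (F w)) U) :
    DifferentiableOn ℂ F U := by
  intro z hz
  obtain ⟨r, hr, hrU⟩ := Metric.nhds_basis_closedBall.mem_iff.1 (hU.mem_nhds hz)
  lift r to ℝ≥0 using hr.le
  have hcs : ContinuousOn F (sphere z r) := hc.mono (sphere_subset_closedBall.trans hrU)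
  have hint : CircleIntegrable F z r := hcs.circleIntegrable r.2
  have hps := hasFPowerSeriesOn_cauchy_integral hint (by exact_mod_cast hr)
  -- The Cauchy integral of a merely continuous function is holomorphic; Cauchy's formula for each
  -- `L i ∘ F` shows that it reproduces `F`.
  have heq : ∀ w ∈ ball z r, F w = (2 * π * I : ℂ)⁻¹ • ∮ ζ in C(z, r), (ζ - w)⁻¹ • F ζ := by
    intro w hw
    have hk : CircleIntegrable (fun ζ ↦ (ζ - w)⁻¹ • F ζ) z r := by
      refine ContinuousOn.circleIntegrable r.2 (ContinuousOn.smul ?_ hcs)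
      refine ContinuousOn.inv₀ (by fun_prop) fun ζ hζ h ↦ ?_
      rw [sub_eq_zero] at h
      subst h
      simp only [mem_sphere, mem_ball] at hζ hw
      exact hw.ne hζ
    rw [← sub_eq_zero]
    apply hL
    intro i
    have h1 : (L i) (∮ ζ in C(z, r), (ζ - w)⁻¹ • F ζ)
        = ∮ ζ in C(z, r), (ζ - w)⁻¹ • L i (F ζ) := by
      simp only [circleIntegral]
      rw [← ContinuousLinearMap.intervalIntegral_comp_comm]
      · simp
      · exact hk.out
    have h2 : DiffContOnCl ℂ (fun w ↦ L i (F w)) (ball z r) :=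
      ((hd i).mono hrU).diffContOnCl_ball subset_rfl
    rw [map_sub, map_smul, h1, h2.circleIntegral_sub_inv_smul hw, smul_smul,
      inv_mul_cancel₀ (by simp [Real.pi_ne_zero]), one_smul, sub_self]
  have hev : (fun w ↦ (2 * π * I : ℂ)⁻¹ • ∮ ζ in C(z, r), (ζ - w)⁻¹ • F ζ) =ᶠ[𝓝 z] F := by
    filter_upwards [Metric.ball_mem_nhds z hr] with w hw
    exact (heq w hw).symm
  exact (hps.analyticAt.congr hev).differentiableAt.differentiableWithinAt

/-- A family of functions on a compact space depending holomorphically on a parameter is a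
holomorphic map to the Banach space of continuous functions. -/
theorem exists_differentiableOn_continuousMap {K : Type*} [TopologicalSpace K] [CompactSpace K]
    {X : Set ℂ} (hX : IsOpen X) (F : ℂ → K → E)
    (hc : ContinuousOn (Function.uncurry F) (X ×ˢ univ))
    (hd : ∀ k, DifferentiableOn ℂ (fun x ↦ F x k) X) :
    ∃ Φ : ℂ → C(K, E), DifferentiableOn ℂ Φ X ∧ ∀ x ∈ X, ∀ k, Φ x k = F x k := by
  classical
  let f : C(X × K, E) := ⟨fun z ↦ F z.1 z.2, by
    refine hc.comp_continuous (f := fun z : X × K ↦ ((z.1 : ℂ), z.2)) (by fun_prop) ?_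
    rintro ⟨⟨x, hx⟩, k⟩
    exact ⟨hx, mem_univ _⟩⟩
  let Φ : ℂ → C(K, E) := fun x ↦ if h : x ∈ X then f.curry ⟨x, h⟩ else 0
  have hΦ : ∀ x ∈ X, ∀ k, Φ x k = F x k := by
    intro x hx k
    simp only [Φ, hx, dif_pos]
    rfl
  refine ⟨Φ, ?_, hΦ⟩
  -- Evaluations at the points of `K` separate continuous functions.
  refine differentiableOn_of_separating
    (fun k : K ↦ (ContinuousMap.evalCLM ℂ k : C(K, E) →L[ℂ] E)) ?_ hX ?_ ?_
  · intro v hv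
    ext k
    exact hv k
  · rw [continuousOn_iff_continuous_domRestrict]
    have : X.domRestrict Φ = f.curry := by
      funext x
      simp [Φ]
    rw [this]
    exact f.curry.continuous
  · intro k
    refine (hd k).congr fun x hx ↦ ?_
    simpa using hΦ x hx k

/-- Integration of the product of two continuous functions over `[0, 2π]`. -/
def integralPairing (E : Type*) [NormedAddCommGroup E] [NormedSpace ℂ E] :
    C(Icc (0 : ℝ) (2 * π), ℂ) →L[ℂ] C(Icc (0 : ℝ) (2 * π), E) →L[ℂ] E :=
  LinearMap.mkContinuous₂
    (LinearMap.mk₂ ℂ (fun k g ↦ ∫ t in (0 : ℝ)..(2 * π),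
        IccExtend Real.two_pi_pos.le k t • IccExtend Real.two_pi_pos.le g t)
      (by
        intro k k' g
        rw [← intervalIntegral.integral_add]
        · simp [IccExtend, add_smul]
        · exact (k.continuous.Icc_extend'.smul g.continuous.Icc_extend').intervalIntegrable _ _
        · exact (k'.continuous.Icc_extend'.smul g.continuous.Icc_extend').intervalIntegrable _ _)
      (by
        intro c k g
        rw [← intervalIntegral.integral_smul]
        simp [IccExtend, mul_smul])
      (by
        intro k g g'
        rw [← intervalIntegral.integral_add]
        · simp [IccExtend, smul_add]
        · exact (k.continuous.Icc_extend'.smul g.continuous.Icc_extend').intervalIntegrable _ _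
        · exact (k.continuous.Icc_extend'.smul g'.continuous.Icc_extend').intervalIntegrable _ _)
      (by
        intro c k g
        rw [← intervalIntegral.integral_smul]
        simp only [IccExtend, ContinuousMap.coe_smul, Function.comp_apply, Pi.smul_apply]
        exact intervalIntegral.integral_congr fun t _ ↦ smul_comm _ _ _))
    (2 * π) (by
      intro k g
      refine (intervalIntegral.norm_integral_le_of_norm_le_const (C := ‖k‖ * ‖g‖) ?_).trans ?_
      · intro t _
        rw [norm_smul]
        gcongr
        · exact ContinuousMap.norm_coe_le_norm k _
        · exact ContinuousMap.norm_coe_le_norm g _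
      · rw [sub_zero, abs_of_pos Real.two_pi_pos]
        linarith)

theorem integralPairing_apply {E : Type*} [NormedAddCommGroup E] [NormedSpace ℂ E]
    (k : C(Icc (0 : ℝ) (2 * π), ℂ)) (g : C(Icc (0 : ℝ) (2 * π), E)) :
    integralPairing E k g = ∫ t in (0 : ℝ)..(2 * π),
      IccExtend Real.two_pi_pos.le k t • IccExtend Real.two_pi_pos.le g t := rfl

/-- The Cauchy integral of a function depending holomorphically on a parameter is jointly
analytic. -/
theorem analyticOnNhd_circleIntegral {X : Set ℂ} (hX : IsOpen X) {c : ℂ} {R : ℝ} (hR : 0 < R)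
    (F : ℂ → ℂ → E) (hc : ContinuousOn (Function.uncurry F) (X ×ˢ sphere c R))
    (hd : ∀ ζ ∈ sphere c R, DifferentiableOn ℂ (fun x ↦ F x ζ) X) :
    AnalyticOnNhd ℂ (fun z : ℂ × ℂ ↦ ∮ ζ in C(c, R), (ζ - z.2)⁻¹ • F z.1 ζ)
      (X ×ˢ ball c R) := by
  obtain ⟨Φ, hΦ, hΦe⟩ := exists_differentiableOn_continuousMap (K := Icc (0 : ℝ) (2 * π)) hX
    (fun x t ↦ F x (circleMap c R t))
    (by
      refine hc.comp (f := fun z : ℂ × Icc (0 : ℝ) (2 * π) ↦ (z.1, circleMap c R z.2))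
        (by fun_prop) ?_
      rintro ⟨x, t⟩ ⟨hx, -⟩
      exact ⟨hx, circleMap_mem_sphere c hR.le _⟩)
    (fun t ↦ hd _ (circleMap_mem_sphere c hR.le _))
  have hne : ∀ y ∈ ball c R, ∀ t : ℝ, circleMap c R t - y ≠ 0 := by
    intro y hy t h
    rw [sub_eq_zero] at h
    have := circleMap_mem_sphere c hR.le t
    rw [h] at this
    simp only [mem_sphere, mem_ball] at this hy
    exact hy.ne this
  -- The Cauchy kernel as a holomorphic map of `y` into the continuous functions on `[0, 2π]`. The
  -- integral is then a continuous bilinear pairing of `Ψ y` with `Φ x`, so it is jointly analytic.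
  obtain ⟨Ψ, hΨ, hΨe⟩ := exists_differentiableOn_continuousMap (K := Icc (0 : ℝ) (2 * π))
    (isOpen_ball (x := c) (ε := R))
    (fun y t ↦ deriv (circleMap c R) t * (circleMap c R t - y)⁻¹)
    (by
      simp only [deriv_circleMap]
      refine ContinuousOn.mul (by fun_prop) (ContinuousOn.inv₀ (by fun_prop) ?_)
      rintro ⟨y, t⟩ ⟨hy, -⟩
      exact hne y hy t)
    (by
      intro t
      refine DifferentiableOn.mul (by fun_prop) (DifferentiableOn.inv (by fun_prop) ?_)
      intro y hy
      exact hne y hy t)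
  rintro ⟨x, y⟩ ⟨hx, hy⟩
  have hΦa : AnalyticAt ℂ Φ x := hΦ.analyticAt (hX.mem_nhds hx)
  have hΨa : AnalyticAt ℂ Ψ y := hΨ.analyticAt (isOpen_ball.mem_nhds hy)
  have h1 : AnalyticAt ℂ (fun z : ℂ × ℂ ↦ Φ z.1) (x, y) :=
    hΦa.comp_of_eq analyticAt_fst rfl
  have h2 : AnalyticAt ℂ (fun z : ℂ × ℂ ↦ Ψ z.2) (x, y) :=
    hΨa.comp_of_eq analyticAt_snd rfl
  have h3 : AnalyticAt ℂ (fun z : ℂ × ℂ ↦ integralPairing E (Ψ z.2) (Φ z.1)) (x, y) :=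
    ((integralPairing E).analyticAt_bilinear _).comp₂ h2 h1
  refine h3.congr ?_
  filter_upwards [(hX.prod isOpen_ball).mem_nhds (⟨hx, hy⟩ : (x, y) ∈ X ×ˢ ball c R)]
  rintro ⟨x', y'⟩ ⟨hx', hy'⟩
  rw [integralPairing_apply, circleIntegral]
  refine intervalIntegral.integral_congr fun t ht ↦ ?_
  rw [uIcc_of_le Real.two_pi_pos.le] at ht
  simp only
  rw [IccExtend_of_mem _ _ ht, IccExtend_of_mem _ _ ht, hΦe x' hx', hΨe y' hy', mul_smul]

/-- **Osgood's lemma** in two variables. -/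
theorem analyticOnNhd_of_separately {U : Set (ℂ × ℂ)} (hU : IsOpen U) {f : ℂ × ℂ → E}
    (hc : ContinuousOn f U) (h1 : ∀ z ∈ U, DifferentiableAt ℂ (fun x ↦ f (x, z.2)) z.1)
    (h2 : ∀ z ∈ U, DifferentiableAt ℂ (fun y ↦ f (z.1, y)) z.2) : AnalyticOnNhd ℂ f U := by
  rintro ⟨x, y⟩ hz
  obtain ⟨r, hr, hrU⟩ := Metric.nhds_basis_closedBall.mem_iff.1 (hU.mem_nhds hz)
  rw [← closedBall_prod_same] at hrU
  have hsub : ball x r ×ˢ sphere y r ⊆ U :=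
    (Set.prod_mono ball_subset_closedBall sphere_subset_closedBall).trans hrU
  have h3 := analyticOnNhd_circleIntegral (isOpen_ball (x := x) (ε := r)) hr
    (fun x y ↦ f (x, y)) (c := y) (hc.mono hsub)
    (fun ζ hζ x' hx' ↦ (h1 (x', ζ) (hsub ⟨hx', hζ⟩)).differentiableWithinAt)
    (x, y) ⟨mem_ball_self hr, mem_ball_self hr⟩
  have h4 : AnalyticAt ℂ (fun z : ℂ × ℂ ↦ (2 * π * I : ℂ)⁻¹ •
      ∮ ζ in C(y, r), (ζ - z.2)⁻¹ • f (z.1, ζ)) (x, y) := by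
    exact analyticAt_const.smul h3
  refine h4.congr ?_
  filter_upwards [(isOpen_ball.prod isOpen_ball).mem_nhds
    (⟨mem_ball_self hr, mem_ball_self hr⟩ : (x, y) ∈ ball x r ×ˢ ball y r)]
  rintro ⟨x', y'⟩ ⟨hx', hy'⟩
  have h5 : DiffContOnCl ℂ (fun w ↦ f (x', w)) (ball y r) := by
    refine DifferentiableOn.diffContOnCl_ball (U := closedBall y r) (fun w hw ↦ ?_) subset_rfl
    exact (h2 (x', w) (hrU ⟨ball_subset_closedBall hx', hw⟩)).differentiableWithinAt
  simp only
  rw [h5.circleIntegral_sub_inv_smul hy', smul_smul,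
      inv_mul_cancel₀ (by simp [Real.pi_ne_zero]), one_smul]

/-- An analytic function vanishing on `y = 0` is divisible by `y`. -/
theorem exists_analyticAt_snd_smul {f : ℂ × ℂ → E} {x₀ : ℂ} (hf : AnalyticAt ℂ f (x₀, 0))
    (h0 : ∀ᶠ x in 𝓝 x₀, f (x, 0) = 0) :
    ∃ g : ℂ × ℂ → E, AnalyticAt ℂ g (x₀, 0) ∧ ∀ᶠ z in 𝓝 ((x₀, 0) : ℂ × ℂ), f z = z.2 • g z := by
  have h0' : ∀ᶠ z in 𝓝 ((x₀, 0) : ℂ × ℂ), f (z.1, 0) = 0 :=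
    (continuous_fst.tendsto ((x₀, 0) : ℂ × ℂ)).eventually h0
  obtain ⟨r, hr, hrU⟩ := Metric.nhds_basis_closedBall.mem_iff.1
    (hf.eventually_analyticAt.and h0')
  rw [← closedBall_prod_same] at hrU
  have hsub : ball x₀ r ×ˢ sphere (0 : ℂ) r ⊆ closedBall x₀ r ×ˢ closedBall (0 : ℂ) r :=
    Set.prod_mono ball_subset_closedBall sphere_subset_closedBall
  have hne : ∀ ζ ∈ sphere (0 : ℂ) r, ζ ≠ 0 := by
    rintro ζ hζ rfl
    simp [hr.ne] at hζ
  have h3 := analyticOnNhd_circleIntegral (isOpen_ball (x := x₀) (ε := r)) hr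
    (fun x y ↦ y⁻¹ • f (x, y)) (c := 0)
    (by
      rintro ⟨x, ζ⟩ hz
      refine ContinuousAt.continuousWithinAt (ContinuousAt.smul ?_ ?_)
      · exact ContinuousAt.inv₀ (by fun_prop) (hne ζ hz.2)
      · exact (hrU (hsub hz)).1.continuousAt)
    (by
      intro ζ hζ x hx
      refine DifferentiableAt.differentiableWithinAt (DifferentiableAt.const_smul ?_ _)
      exact DifferentiableAt.comp (g := f) x
        ((hrU (hsub (mk_mem_prod hx hζ))).1.differentiableAt) (by fun_prop))
    (x₀, 0) ⟨mem_ball_self hr, mem_ball_self hr⟩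
  refine ⟨fun z ↦ (2 * π * I : ℂ)⁻¹ • ∮ ζ in C(0, r), (ζ - z.2)⁻¹ • ζ⁻¹ • f (z.1, ζ),
    analyticAt_const.smul h3, ?_⟩
  filter_upwards [(isOpen_ball.prod isOpen_ball).mem_nhds
    (⟨mem_ball_self hr, mem_ball_self hr⟩ : (x₀, (0 : ℂ)) ∈ ball x₀ r ×ˢ ball (0 : ℂ) r)]
  rintro ⟨x, y⟩ ⟨hx, hy⟩
  simp only at hx hy ⊢
  have hd : DifferentiableOn ℂ (fun w ↦ f (x, w)) (closedBall 0 r) := fun w hw ↦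
    (DifferentiableAt.comp (g := f) w ((hrU (show (x, w) ∈ _ from
      ⟨ball_subset_closedBall hx, hw⟩)).1.differentiableAt) (by fun_prop)).differentiableWithinAt
  have h00 : f (x, 0) = 0 :=
    (hrU (show (x, (0 : ℂ)) ∈ _ from ⟨ball_subset_closedBall hx, by simp [hr.le]⟩)).2
  -- On each slice the quotient by `y` is holomorphic and equals `ζ⁻¹ f (x, ζ)` on the circle, so
  -- the Cauchy integral defining the witness reproduces it.
  have h5 : DiffContOnCl ℂ (dslope (fun w ↦ f (x, w)) 0) (ball 0 r) :=
    DifferentiableOn.diffContOnCl_ball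
      ((differentiableOn_dslope (closedBall_mem_nhds 0 hr)).2 hd) subset_rfl
  have h6 : ∮ ζ in C(0, r), (ζ - y)⁻¹ • ζ⁻¹ • f (x, ζ) =
      ∮ ζ in C(0, r), (ζ - y)⁻¹ • dslope (fun w ↦ f (x, w)) 0 ζ := by
    refine circleIntegral.integral_congr hr.le fun ζ hζ ↦ ?_
    rw [dslope_of_ne _ (hne ζ hζ), slope_def_module, h00, sub_zero, sub_zero]
  rw [h6, h5.circleIntegral_sub_inv_smul hy, smul_smul (2 * π * I : ℂ)⁻¹,
      inv_mul_cancel₀ (by simp [Real.pi_ne_zero]), one_smul]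
  have := sub_smul_dslope (fun w ↦ f (x, w)) 0 y
  simp only [h00, sub_zero] at this
  exact this.symm

end SeveralVariables

/-! ### Linear differential equations on convex domains of `ℂ` -/

section LinearODE

open Metric Complex Filter
open scoped Real NNReal

variable {E : Type*} [NormedAddCommGroup E] [NormedSpace ℂ E]

theorem hasDerivAt_segment {u : ℂ → E} {u' : E} {w₀ w : ℂ} {t : ℝ}
    (h : HasDerivAt u u' (w₀ + t * (w - w₀))) :
    HasDerivAt (fun s : ℝ ↦ u (w₀ + s * (w - w₀))) ((w - w₀) • u') t := by
  have h1 : HasDerivAt (fun s : ℝ ↦ w₀ + (s : ℂ) * (w - w₀)) (w - w₀) t := by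
    simpa using ((Complex.ofRealCLM.hasDerivAt (x := t)).mul_const (w - w₀)).const_add w₀
  exact HasDerivAt.scomp t h h1

theorem segment_mem {Ω : Set ℂ} (hΩ : Convex ℝ Ω) {w₀ w : ℂ} (h₀ : w₀ ∈ Ω) (hw : w ∈ Ω) {t : ℝ}
    (ht : t ∈ Icc (0 : ℝ) 1) : w₀ + t * (w - w₀) ∈ Ω := by
  have := hΩ.add_smul_sub_mem h₀ hw ht
  simpa using this

/-- Growth of the solutions of a complex differential inequality. -/
theorem norm_le_of_hasDerivAt {Ω : Set ℂ} (hΩ : Convex ℝ Ω) {u u' : ℂ → E} {C : ℝ}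
    (hu : ∀ w ∈ Ω, HasDerivAt u (u' w) w) (hC : ∀ w ∈ Ω, ‖u' w‖ ≤ C * ‖u w‖) {w₀ w : ℂ}
    (h₀ : w₀ ∈ Ω) (hw : w ∈ Ω) : ‖u w‖ ≤ ‖u w₀‖ * Real.exp (C * ‖w - w₀‖) := by
  have hd : ∀ t ∈ Icc (0 : ℝ) 1, HasDerivAt (fun s : ℝ ↦ u (w₀ + s * (w - w₀)))
      ((w - w₀) • u' (w₀ + t * (w - w₀))) t := fun t ht ↦
    hasDerivAt_segment (hu _ (segment_mem hΩ h₀ hw ht))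
  have := norm_le_gronwallBound_of_norm_deriv_right_le (a := 0) (b := 1) (δ := ‖u w₀‖)
    (K := C * ‖w - w₀‖) (ε := 0)
    (fun t ht ↦ (hd t ht).continuousAt.continuousWithinAt)
    (fun t ht ↦ (hd t (Ico_subset_Icc_self ht)).hasDerivWithinAt) (by simp)
    (by
      intro t ht
      rw [norm_smul, add_zero]
      have := hC _ (segment_mem hΩ h₀ hw (Ico_subset_Icc_self ht))
      calc _ ≤ ‖w - w₀‖ * (C * ‖u (w₀ + t * (w - w₀))‖) := by gcongr
        _ = _ := by ring) 1 (by simp)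
  simpa [gronwallBound_ε0] using this

/-- Uniqueness for linear equations, from the Grönwall bound. With `C = 0` it also shows that a
function with zero derivative which vanishes at one point vanishes everywhere. -/
theorem eq_zero_of_hasDerivAt {Ω : Set ℂ} (hΩ : Convex ℝ Ω) {u u' : ℂ → E} {C : ℝ}
    (hu : ∀ w ∈ Ω, HasDerivAt u (u' w) w) (hC : ∀ w ∈ Ω, ‖u' w‖ ≤ C * ‖u w‖) {w₀ w : ℂ}
    (h₀ : w₀ ∈ Ω) (hz : u w₀ = 0) (hw : w ∈ Ω) : u w = 0 := by
  simpa [hz] using norm_le_of_hasDerivAt hΩ hu hC h₀ hw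

variable [CompleteSpace E]

theorem exists_primitive_eq_zero {Ω : Set ℂ} (hΩ : Convex ℝ Ω) (hΩo : IsOpen Ω) {f : ℂ → E}
    (hf : DifferentiableOn ℂ f Ω) (w₀ : ℂ) :
    ∃ h : ℂ → E, h w₀ = 0 ∧ ∀ w ∈ Ω, HasDerivAt h (f w) w := by
  obtain ⟨h, hh⟩ := hΩ.exists_forall_hasDerivWithinAt hf
  refine ⟨fun w ↦ h w - h w₀, sub_self _, fun w hw ↦ ?_⟩
  exact ((hh w hw).hasDerivAt (hΩo.mem_nhds hw)).sub_const _

/-- Linear differential equations on a convex domain of `ℂ` have global solutions, which stay in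
any closed subspace that is stable by the equation. -/
theorem exists_solution_linear {Ω : Set ℂ} (hΩ : Convex ℝ Ω) (hΩo : IsOpen Ω)
    {a : ℂ → E →L[ℂ] E} {C : ℝ} (hC : ∀ w ∈ Ω, ‖a w‖ ≤ C)
    (ha : ∀ g : ℂ → E, DifferentiableOn ℂ g Ω → DifferentiableOn ℂ (fun w ↦ a w (g w)) Ω)
    (N : Submodule ℂ E) (hN : IsClosed (N : Set E)) (haN : ∀ w ∈ Ω, ∀ v ∈ N, a w v ∈ N)
    {w₀ : ℂ} (h₀ : w₀ ∈ Ω) {c : E} (hc : c ∈ N) :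
    ∃ u : ℂ → E, u w₀ = c ∧ (∀ w ∈ Ω, HasDerivAt u (a w (u w)) w) ∧ ∀ w ∈ Ω, u w ∈ N := by
  classical
  have hC0 : 0 ≤ C := (norm_nonneg _).trans (hC w₀ h₀)
  -- The operator `g ↦ ∫ a g` with base point `w₀`, made total by an arbitrary value on functions
  -- that are not holomorphic.
  have step : ∀ g : ℂ → E, ∃ h : ℂ → E, DifferentiableOn ℂ g Ω →
      h w₀ = 0 ∧ ∀ w ∈ Ω, HasDerivAt h (a w (g w)) w := by
    intro g
    by_cases hg : DifferentiableOn ℂ g Ω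
    · obtain ⟨h, hh⟩ := exists_primitive_eq_zero hΩ hΩo (ha g hg) w₀
      exact ⟨h, fun _ ↦ hh⟩
    · exact ⟨0, fun h ↦ absurd h hg⟩
  choose T hT using step
  -- The terms of the Picard series, not its partial sums: each is the integral of `a` applied to
  -- the previous one, whence the bound by `(C |w - w₀|) ^ n / n!`.
  let p : ℕ → ℂ → E := fun n ↦ Nat.rec (fun _ ↦ c) (fun _ g ↦ T g) n
  have hp0 : p 0 = fun _ ↦ c := rfl
  have hps : ∀ n, p (n + 1) = T (p n) := fun n ↦ rfl
  have hpd : ∀ n, DifferentiableOn ℂ (p n) Ω := by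
    intro n
    induction n with
    | zero => rw [hp0]; exact differentiableOn_const c
    | succ n ih =>
      rw [hps]
      exact fun w hw ↦ ((hT _ ih).2 w hw).differentiableAt.differentiableWithinAt
  have hpN : ∀ n, ∀ w ∈ Ω, p n w ∈ N := by
    intro n
    induction n with
    | zero => intro w _; rw [hp0]; exact hc
    | succ n ih =>
      intro w hw
      -- Modulo the closed subspace `N` the derivative vanishes, and so does the initial value.
      have h1 : ∀ w ∈ Ω, HasDerivAt (fun w ↦ N.mkQL (p (n + 1) w)) 0 w := by
        intro w hw
        have h2 := (N.mkQL.restrictScalars ℂ).hasFDerivAt.comp_hasDerivAt w ((hT _ (hpd n)).2 w hw)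
        have h3 : N.mkQL (a w (p n w)) = 0 := by
          simpa using haN w hw _ (ih w hw)
        rw [← h3]
        exact h2
      have : IsClosed (N : Set E) := hN
      have h4 := eq_zero_of_hasDerivAt (C := 0) hΩ h1 (by simp) h₀
        (by simp [hps, (hT _ (hpd n)).1]) hw
      simpa using h4
  have hbound : ∀ n, ∀ w ∈ Ω, ‖p n w‖ ≤ ‖c‖ * ((C * ‖w - w₀‖) ^ n / n.factorial) := by
    intro n
    induction n with
    | zero => intro w _; simp [hp0]
    | succ n ih =>
      intro w hw
      set L := ‖w - w₀‖
      have hd : ∀ t ∈ Icc (0 : ℝ) 1, HasDerivAt (fun s : ℝ ↦ p (n + 1) (w₀ + s * (w - w₀)))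
          ((w - w₀) • a (w₀ + t * (w - w₀)) (p n (w₀ + t * (w - w₀)))) t := fun t ht ↦
        hasDerivAt_segment ((hT _ (hpd n)).2 _ (segment_mem hΩ h₀ hw ht))
      have hB : ∀ t : ℝ, HasDerivAt
          (fun t : ℝ ↦ ‖c‖ * ((C * (t * L)) ^ (n + 1) / (n + 1).factorial))
          (‖c‖ * (C * L * (C * (t * L)) ^ n / n.factorial)) t := by
        intro t
        have h5 : HasDerivAt (fun t : ℝ ↦ C * (t * L)) (C * L) t := by
          simpa using ((hasDerivAt_id t).mul_const L).const_mul C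
        have h6 := ((h5.pow (n + 1)).div_const ((n + 1).factorial : ℝ)).const_mul ‖c‖
        refine h6.congr_deriv ?_
        have : ((n + 1 : ℕ) : ℝ) ≠ 0 := by positivity
        have h7 : (n.factorial : ℝ) ≠ 0 := by positivity
        rw [Nat.factorial_succ]
        push_cast at this ⊢
        field_simp
      have := image_norm_le_of_norm_deriv_right_le_deriv_boundary (a := 0) (b := 1)
        (f := fun s : ℝ ↦ p (n + 1) (w₀ + s * (w - w₀)))
        (fun t ht ↦ (hd t ht).continuousAt.continuousWithinAt)
        (fun t ht ↦ (hd t (Ico_subset_Icc_self ht)).hasDerivWithinAt)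
        (by simp [hps, (hT _ (hpd n)).1]) hB
        (by
          intro t ht
          have hmem := segment_mem hΩ h₀ hw (Ico_subset_Icc_self ht)
          have h8 := ih _ hmem
          have h9 : ‖w₀ + t * (w - w₀) - w₀‖ = t * L := by
            rw [add_sub_cancel_left, norm_mul, Complex.norm_real, Real.norm_of_nonneg ht.1]
          rw [h9] at h8
          rw [norm_smul]
          calc _ ≤ L * (C * (‖c‖ * ((C * (t * L)) ^ n / n.factorial))) := by
                gcongr
                exact (ContinuousLinearMap.le_opNorm _ _).trans
                  (mul_le_mul (hC _ hmem) h8 (norm_nonneg _) hC0)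
            _ = _ := by ring)
        (x := 1) (by simp)
      simpa using this
  have hsum : ∀ R : ℝ, Summable fun n : ℕ ↦ ‖c‖ * ((C * R) ^ n / n.factorial) := fun R ↦
    (Real.summable_pow_div_factorial (C * R)).mul_left _
  have hsumw : ∀ w ∈ Ω, Summable fun n ↦ p n w := fun w hw ↦
    Summable.of_norm_bounded (hsum ‖w - w₀‖) fun n ↦ hbound n w hw
  refine ⟨fun w ↦ ∑' n, p n w, ?_, ?_, ?_⟩
  · simp only
    rw [tsum_eq_single 0, hp0]
    · intro n hn
      obtain ⟨m, rfl⟩ := Nat.exists_eq_succ_of_ne_zero hn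
      exact (hT _ (hpd m)).1
  · intro w hw
    set R := ‖w - w₀‖ + 1
    set U := Ω ∩ ball w₀ R
    have hU : IsOpen U := hΩo.inter isOpen_ball
    have hwU : w ∈ U := ⟨hw, by simp [R, dist_eq_norm]⟩
    have hle : ∀ (n : ℕ) (z : ℂ), z ∈ U → ‖p n z‖ ≤ ‖c‖ * ((C * R) ^ n / n.factorial) := by
      intro n z hz
      refine (hbound n z hz.1).trans ?_
      have : ‖z - w₀‖ ≤ R := by
        have := hz.2
        rw [mem_ball, dist_eq_norm] at this
        exact this.le
      gcongr
    have h1 := differentiableOn_tsum_of_summable_norm (hsum R)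
      (fun n ↦ (hpd n).mono (inter_subset_left : U ⊆ Ω)) hU hle
    have h2 := hasSum_deriv_of_summable_norm (hsum R)
      (fun n ↦ (hpd n).mono (inter_subset_left : U ⊆ Ω)) hU hle hwU
    have h3 : HasSum (fun n ↦ deriv (p (n + 1)) w) (a w (∑' n, p n w)) := by
      have := (hsumw w hw).hasSum.mapL (a w)
      refine this.congr_fun ?_
      intro n
      exact ((hT _ (hpd n)).2 w hw).deriv
    have h4 : HasSum (fun n ↦ deriv (p n) w) (a w (∑' n, p n w)) := by
      rw [← hasSum_nat_add_iff' 1]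
      simpa [hp0] using h3
    have h5 := (h1.differentiableAt (hU.mem_nhds hwU)).hasDerivAt
    rwa [h2.unique h4] at h5
  · intro w hw
    exact hN.mem_of_tendsto (hsumw w hw).hasSum
      (Eventually.of_forall fun s ↦ N.sum_mem fun n _ ↦ hpN n w hw)

end LinearODE

/-! ### Holomorphic dependence of solutions on a parameter -/

section ParametricODE

open Metric Complex Filter
open scoped Real NNReal

variable {V : Type*} [NormedAddCommGroup V] [NormedSpace ℂ V] [CompleteSpace V]

/-- Pointwise application of a continuous family of operators. -/
def pointwiseApply (K : Type*) [TopologicalSpace K] [CompactSpace K] (V : Type*)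
    [NormedAddCommGroup V] [NormedSpace ℂ V] : C(K, V →L[ℂ] V) →L[ℂ] C(K, V) →L[ℂ] C(K, V) :=
  LinearMap.mkContinuous₂
    (LinearMap.mk₂ ℂ (fun (b : C(K, V →L[ℂ] V)) (g : C(K, V)) ↦
        (⟨fun k ↦ b k (g k), by fun_prop⟩ : C(K, V)))
      (fun _ _ _ ↦ by ext; simp) (fun _ _ _ ↦ by ext; simp)
      (fun _ _ _ ↦ by ext; simp) (fun _ _ _ ↦ by ext; simp))
    1 (by
      intro b g
      rw [ContinuousMap.norm_le _ (by positivity)]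
      intro k
      rw [one_mul]
      exact (ContinuousLinearMap.le_opNorm _ _).trans
        (mul_le_mul (b.norm_coe_le_norm k) (g.norm_coe_le_norm k) (norm_nonneg _) (norm_nonneg b)))

theorem pointwiseApply_apply {K : Type*} [TopologicalSpace K] [CompactSpace K]
    {V : Type*} [NormedAddCommGroup V] [NormedSpace ℂ V]
    (b : C(K, V →L[ℂ] V)) (g : C(K, V)) (k : K) : pointwiseApply K V b g k = b k (g k) := rfl

/-- The continuous functions on a closed disc which are holomorphic inside. -/
def holomorphicSubmodule (y₀ : ℂ) (δ : ℝ) (V : Type*) [NormedAddCommGroup V] [NormedSpace ℂ V] :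
    Submodule ℂ C(closedBall y₀ δ, V) where
  carrier := {g | ∃ f : ℂ → V, DifferentiableOn ℂ f (ball y₀ δ) ∧
    ∀ k : closedBall y₀ δ, (k : ℂ) ∈ ball y₀ δ → g k = f k}
  add_mem' := by
    rintro g g' ⟨f, hf, hfg⟩ ⟨f', hf', hfg'⟩
    exact ⟨f + f', hf.add hf', fun k hk ↦ by simp [hfg k hk, hfg' k hk]⟩
  zero_mem' := ⟨0, differentiableOn_const 0, fun k _ ↦ rfl⟩
  smul_mem' := by
    rintro c g ⟨f, hf, hfg⟩
    exact ⟨c • f, hf.const_smul c, fun k hk ↦ by simp [hfg k hk]⟩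

/-- A uniform limit of holomorphic functions is holomorphic. Closedness is what
`exists_solution_linear` requires to keep a solution holomorphic in the parameter. -/
theorem isClosed_holomorphicSubmodule (y₀ : ℂ) (δ : ℝ) :
    IsClosed (holomorphicSubmodule y₀ δ V : Set C(closedBall y₀ δ, V)) := by
  classical
  rw [← isSeqClosed_iff_isClosed]
  intro g l hg hl
  choose f hf hfg using hg
  let F : ℂ → V := fun y ↦ if h : y ∈ closedBall y₀ δ then l ⟨y, h⟩ else 0
  refine ⟨F, ?_, fun k _ ↦ by simp only [F, k.2, dif_pos]⟩
  have hu : TendstoUniformlyOn f F atTop (ball y₀ δ) := by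
    rw [ContinuousMap.tendsto_iff_tendstoUniformly, Metric.tendstoUniformly_iff] at hl
    rw [Metric.tendstoUniformlyOn_iff]
    intro ε hε
    filter_upwards [hl ε hε] with n hn y hy
    have := hn ⟨y, ball_subset_closedBall hy⟩
    rw [hfg n _ hy] at this
    simpa only [F, ball_subset_closedBall hy, dif_pos] using this
  exact hu.tendstoLocallyUniformlyOn.differentiableOn (Eventually.of_forall hf) isOpen_ball

/-- Linear differential equations in the first variable, depending analytically on the second
variable: the solution with analytic initial data is analytic. -/
theorem exists_solution_parametric {Ω : Set ℂ} (hΩ : Convex ℝ Ω) (hΩo : IsOpen Ω) {y₀ : ℂ}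
    {δ : ℝ} {B : ℂ × ℂ → V →L[ℂ] V} (hB : AnalyticOnNhd ℂ B (Ω ×ˢ closedBall y₀ δ))
    {C : ℝ} (hC : ∀ z ∈ Ω ×ˢ closedBall y₀ δ, ‖B z‖ ≤ C) {x₀ : ℂ} (hx₀ : x₀ ∈ Ω) {c : ℂ → V}
    (hc : AnalyticOnNhd ℂ c (closedBall y₀ δ)) :
    ∃ u : ℂ × ℂ → V, AnalyticOnNhd ℂ u (Ω ×ˢ ball y₀ δ) ∧
      (∀ y ∈ ball y₀ δ, u (x₀, y) = c y) ∧
      ∀ z ∈ Ω ×ˢ ball y₀ δ, HasDerivAt (fun x ↦ u (x, z.2)) (B z (u z)) z.1 := by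
  classical
  by_cases hδ : δ < 0
  · simp [ball_eq_empty.2 hδ.le, analyticOnNhd_empty]
  push Not at hδ
  obtain ⟨Φ, hΦ, hΦe⟩ := exists_differentiableOn_continuousMap (K := closedBall y₀ δ) hΩo
    (fun x k ↦ B (x, k))
    (by
      refine hB.continuousOn.comp (f := fun z : ℂ × closedBall y₀ δ ↦ (z.1, (z.2 : ℂ)))
        (by fun_prop) ?_
      rintro ⟨x, k⟩ ⟨hx, -⟩
      exact ⟨hx, k.2⟩)
    (fun k x hx ↦ (DifferentiableAt.comp (g := B) x ((hB (x, k) ⟨hx, k.2⟩).differentiableAt)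
      (by fun_prop)).differentiableWithinAt)
  let c' : C(closedBall y₀ δ, V) := ⟨fun k ↦ c k, hc.continuousOn.domRestrict⟩
  have hnorm : ∀ w ∈ Ω, ‖pointwiseApply (closedBall y₀ δ) V (Φ w)‖ ≤ C := by
    intro w hw
    have hC0 : 0 ≤ C := (norm_nonneg _).trans (hC (w, y₀) ⟨hw, mem_closedBall_self hδ⟩)
    refine ContinuousLinearMap.opNorm_le_bound _ hC0 fun g ↦ ?_
    rw [ContinuousMap.norm_le _ (by positivity)]
    intro k
    rw [pointwiseApply_apply, hΦe w hw]
    exact (ContinuousLinearMap.le_opNorm _ _).trans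
      (mul_le_mul (hC (w, k) ⟨hw, k.2⟩) (g.norm_coe_le_norm k) (norm_nonneg _) hC0)
  -- All parameter values at once: a single equation for functions with values in `C(closedBall y₀
  -- δ, V)`. Its operators preserve the functions holomorphic inside the disc, so the solution is
  -- holomorphic in each variable separately, then jointly by Osgood's lemma.
  obtain ⟨u, hu0, hud, huN⟩ := exists_solution_linear hΩ hΩo
    (a := fun w ↦ pointwiseApply (closedBall y₀ δ) V (Φ w)) hnorm
    (fun g hg ↦ ((pointwiseApply (closedBall y₀ δ) V).differentiable.comp_differentiableOn
      hΦ).clm_apply hg)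
    (holomorphicSubmodule y₀ δ V) (isClosed_holomorphicSubmodule y₀ δ)
    (by
      rintro w hw v ⟨f, hf, hfv⟩
      refine ⟨fun y ↦ B (w, y) (f y), ?_, ?_⟩
      · refine DifferentiableOn.clm_apply (fun y hy ↦ ?_) hf
        exact (DifferentiableAt.comp (g := B) y
          ((hB (w, y) ⟨hw, ball_subset_closedBall hy⟩).differentiableAt)
          (by fun_prop)).differentiableWithinAt
      · intro k hk
        rw [pointwiseApply_apply, hΦe w hw, hfv k hk])
    hx₀ (c := c') ⟨c, fun y hy ↦
      (hc y (ball_subset_closedBall hy)).differentiableAt.differentiableWithinAt,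
      fun k _ ↦ rfl⟩
  let v : ℂ × ℂ → V := fun z ↦ if h : z.2 ∈ closedBall y₀ δ then u z.1 ⟨z.2, h⟩ else 0
  have hv : ∀ x y (h : y ∈ ball y₀ δ), v (x, y) = u x ⟨y, ball_subset_closedBall h⟩ := by
    intro x y h
    simp only [v, ball_subset_closedBall h, dif_pos]
  have hder : ∀ z ∈ Ω ×ˢ ball y₀ δ, HasDerivAt (fun x ↦ v (x, z.2)) (B z (v z)) z.1 := by
    rintro ⟨x, y⟩ ⟨hx, hy⟩
    have h1 := (ContinuousMap.evalCLM ℂ (⟨y, ball_subset_closedBall hy⟩ : closedBall y₀ δ)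
      : C(closedBall y₀ δ, V) →L[ℂ] V).hasFDerivAt.comp_hasDerivAt x (hud x hx)
    have h2 : B (x, y) (u x ⟨y, ball_subset_closedBall hy⟩) = pointwiseApply (closedBall y₀ δ) V
        (Φ x) (u x) ⟨y, ball_subset_closedBall hy⟩ := by
      rw [pointwiseApply_apply, hΦe x hx]
    simp only [hv _ y hy]
    rw [h2]
    exact h1
  refine ⟨v, ?_, ?_, hder⟩
  · refine analyticOnNhd_of_separately (hΩo.prod isOpen_ball) ?_
      (fun z hz ↦ (hder z hz).differentiableAt) ?_
    · have hcu : ContinuousOn u Ω := fun w hw ↦ (hud w hw).continuousAt.continuousWithinAt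
      rw [continuousOn_iff_continuous_domRestrict]
      have : (Ω ×ˢ ball y₀ δ).domRestrict v =
          fun z ↦ (Ω.domRestrict u ⟨z.1.1, z.2.1⟩) ⟨z.1.2, ball_subset_closedBall z.2.2⟩ := by
        funext z
        exact hv z.1.1 z.1.2 z.2.2
      rw [this]
      have := hcu.domRestrict
      fun_prop
    · rintro ⟨x, y⟩ ⟨hx, hy⟩
      obtain ⟨f, hf, hfu⟩ := huN x hx
      refine (hf.differentiableAt (isOpen_ball.mem_nhds hy)).congr_of_eventuallyEq ?_
      filter_upwards [isOpen_ball.mem_nhds hy] with y' hy'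
      rw [hv x y' hy', hfu _ hy']
  · intro y hy
    rw [hv _ y hy, hu0]
    rfl

end ParametricODE

/-! ### Analyticity and derivatives of operator-valued expressions -/

section AnalyticHelpers

variable {X F G H : Type*} [NormedAddCommGroup X] [NormedSpace ℂ X] [NormedAddCommGroup F]
  [NormedSpace ℂ F] [NormedAddCommGroup G] [NormedSpace ℂ G] [NormedAddCommGroup H]
  [NormedSpace ℂ H] {z : X}

theorem analyticAt_smul {f : X → ℂ} {g : X → F} (hf : AnalyticAt ℂ f z) (hg : AnalyticAt ℂ g z) :
    AnalyticAt ℂ (fun z ↦ f z • g z) z := hf.smul hg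

theorem analyticAt_clm_apply {A : X → F →L[ℂ] G} {g : X → F} (hA : AnalyticAt ℂ A z)
    (hg : AnalyticAt ℂ g z) : AnalyticAt ℂ (fun z ↦ A z (g z)) z :=
  ((ContinuousLinearMap.id ℂ (F →L[ℂ] G)).analyticAt_bilinear (A z, g z)).comp₂ hA hg

theorem analyticAt_clm_comp {A : X → G →L[ℂ] H} {B : X → F →L[ℂ] G} (hA : AnalyticAt ℂ A z)
    (hB : AnalyticAt ℂ B z) : AnalyticAt ℂ (fun z ↦ (A z) ∘L (B z)) z :=
  ((ContinuousLinearMap.compL ℂ F G H).analyticAt_bilinear (A z, B z)).comp₂ hA hB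

theorem hasFDerivAt_apply_apply {A : X → F →L[ℂ] G →L[ℂ] H} {A' : X →L[ℂ] F →L[ℂ] G →L[ℂ] H}
    (hA : HasFDerivAt A A' z) (v : F) (w : G) : HasFDerivAt (fun z ↦ A z v w)
      ((ContinuousLinearMap.apply ℂ H w ∘L ContinuousLinearMap.apply ℂ (G →L[ℂ] H) v) ∘L A') z := by
  have h := (hA.clm_apply (hasFDerivAt_const v z)).clm_apply (hasFDerivAt_const w z)
  refine h.congr_fderiv ?_
  ext
  simp

end AnalyticHelpers

theorem IsReducedEquationOn.eq_zero_iff {S : Type*} [TopologicalSpace S] {D : Set S}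
    {e : OpenPartialHomeomorph S Plane} {f : Plane → ℂ} {U : Set Plane} (hf : IsReducedEquationOn f (imageIn D e) U)
    (hU : U ⊆ e.target) {z : Plane} (hz : z ∈ U) : f z = 0 ↔ e.symm z ∈ D := by
  rw [hf.zero_iff z hz]
  exact ⟨fun h ↦ h.2, fun h ↦ ⟨hU hz, h⟩⟩

/-! ### Christoffel symbols: symmetry, flatness and change of coordinates -/

section Coordinates

open Filter

variable {S : Type*} [TopologicalSpace S] [ChartedSpace Plane S]

/-- The derivative of the coordinates `e`. -/
def chartDeriv (e : OpenPartialHomeomorph S Plane) (q : S) : Plane →L[ℂ] Plane :=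
  mfderiv 𝓘(ℂ, Plane) 𝓘(ℂ, Plane) e q

theorem coordField_apply (e : OpenPartialHomeomorph S Plane) (v : Plane) (q : S) :
    coordField e v q = (chartDeriv e q).inverse v := rfl

theorem theta_apply (nabla : Connection S) (e : OpenPartialHomeomorph S Plane) (z u v : Plane) :
    theta nabla e z u v = v.1 • coordCov nabla e (1, 0) z u + v.2 • coordCov nabla e (0, 1) z u := by
  simp [theta]

theorem coordCov_apply (nabla : Connection S) (e : OpenPartialHomeomorph S Plane) (z u v : Plane) :
    coordCov nabla e v z u = chartDeriv e (e.symm z)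
      (nabla (coordField e v) (e.symm z) ((chartDeriv e (e.symm z)).inverse u)) := rfl

/-- The vector field with coordinates `c`. -/
def coordCombination (e : OpenPartialHomeomorph S Plane) (c : Plane → Plane) :
    Π q : S, TangentSpace 𝓘(ℂ, Plane) q := fun q ↦ coordField e (c (e q)) q

theorem coordCombination_eq (e : OpenPartialHomeomorph S Plane) (c : Plane → Plane) :
    coordCombination e c = (fun q ↦ (c (e q)).1) • coordField e (1, 0) +
      (fun q ↦ (c (e q)).2) • coordField e (0, 1) := by
  funext q
  have : c (e q) = (c (e q)).1 • ((1, 0) : Plane) + (c (e q)).2 • ((0, 1) : Plane) := by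
    ext <;> simp
  change (chartDeriv e q).inverse (c (e q)) = (c (e q)).1 • (chartDeriv e q).inverse (1, 0) +
    (c (e q)).2 • (chartDeriv e q).inverse (0, 1)
  rw [← map_smul, ← map_smul, ← map_add, ← this]

theorem IsCoordinates.contMDiffAt {e : OpenPartialHomeomorph S Plane} (he : IsCoordinates e)
    {q : S} (hq : q ∈ e.source) : ContMDiffAt 𝓘(ℂ, Plane) 𝓘(ℂ, Plane) ω e q :=
  contMDiffAt_of_mem_maximalAtlas he hq

theorem IsCoordinates.analyticAt_transition {e e' : OpenPartialHomeomorph S Plane}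
    (he : IsCoordinates e) (he' : IsCoordinates e') {q : S} (hq : q ∈ e.source)
    (hq' : q ∈ e'.source) : AnalyticAt ℂ (e' ∘ e.symm) (e q) := by
  have h1 : ContMDiffAt 𝓘(ℂ, Plane) 𝓘(ℂ, Plane) ω (e' ∘ e.symm) (e q) := by
    refine ContMDiffAt.comp (e q) ?_ (contMDiffAt_symm_of_mem_maximalAtlas he (e.map_source hq))
    rw [e.left_inv hq]
    exact he'.contMDiffAt hq'
  exact ContDiffAt.analyticAt (contMDiffAt_iff_contDiffAt.1 h1)

theorem IsCoordinates.mdifferentiable {e : OpenPartialHomeomorph S Plane} (he : IsCoordinates e) :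
    e.MDifferentiable 𝓘(ℂ, Plane) 𝓘(ℂ, Plane) :=
  ⟨(contMDiffOn_of_mem_maximalAtlas he).mdifferentiableOn (by simp),
    (contMDiffOn_symm_of_mem_maximalAtlas he).mdifferentiableOn (by simp)⟩

theorem IsCoordinates.isInvertible {e : OpenPartialHomeomorph S Plane} (he : IsCoordinates e)
    {q : S} (hq : q ∈ e.source) : (chartDeriv e q).IsInvertible :=
  ⟨he.mdifferentiable.mfderiv hq, rfl⟩

theorem IsCoordinates.deriv_inverse {e : OpenPartialHomeomorph S Plane} (he : IsCoordinates e)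
    {q : S} (hq : q ∈ e.source) (v : Plane) : chartDeriv e q ((chartDeriv e q).inverse v) = v := by
  have := (he.isInvertible hq).self_comp_inverse
  exact DFunLike.congr_fun this v

theorem IsCoordinates.inverse_deriv {e : OpenPartialHomeomorph S Plane} (he : IsCoordinates e)
    {q : S} (hq : q ∈ e.source) (v : Plane) : (chartDeriv e q).inverse (chartDeriv e q v) = v := by
  have := (he.isInvertible hq).inverse_comp_self
  exact DFunLike.congr_fun this v

theorem IsCoordinates.chartDeriv_eq {e e' : OpenPartialHomeomorph S Plane}
    (he : IsCoordinates e) (he' : IsCoordinates e') {q : S} (hq : q ∈ e.source)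
    (hq' : q ∈ e'.source) :
    chartDeriv e' q = (fderiv ℂ (e' ∘ e.symm) (e q)) ∘L (chartDeriv e q) := by
  have h1 : HasMFDerivAt 𝓘(ℂ, Plane) 𝓘(ℂ, Plane) ((e' ∘ e.symm) ∘ e) q
      ((fderiv ℂ (e' ∘ e.symm) (e q)) ∘L (chartDeriv e q)) :=
    HasMFDerivAt.comp q
      (he.analyticAt_transition he' hq hq').differentiableAt.hasFDerivAt.hasMFDerivAt
      (he.mdifferentiable.mdifferentiableAt hq).hasMFDerivAt
  have h2 : e' =ᶠ[𝓝 q] (e' ∘ e.symm) ∘ e := by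
    filter_upwards [e.open_source.mem_nhds hq] with q' hq'
    simp [e.left_inv hq']
  exact (h1.congr_of_eventuallyEq h2).mfderiv

theorem IsCoordinates.hasMFDerivAt_comp {e : OpenPartialHomeomorph S Plane}
    (he : IsCoordinates e) {q : S} (hq : q ∈ e.source) {g : Plane → ℂ}
    (hg : DifferentiableAt ℂ g (e q)) :
    HasMFDerivAt 𝓘(ℂ, Plane) 𝓘(ℂ, ℂ) (fun q ↦ g (e q)) q
      ((fderiv ℂ g (e q)).comp (chartDeriv e q)) :=
  HasMFDerivAt.comp q hg.hasFDerivAt.hasMFDerivAt (he.mdifferentiable.mdifferentiableAt hq).hasMFDerivAt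

theorem IsCoordinates.fderiv_transition_comp {e e' : OpenPartialHomeomorph S Plane}
    (he : IsCoordinates e) (he' : IsCoordinates e') {q : S} (hq : q ∈ e.source)
    (hq' : q ∈ e'.source) (v : Plane) :
    fderiv ℂ (e ∘ e'.symm) (e' q) (fderiv ℂ (e' ∘ e.symm) (e q) v) = v := by
  have h1 := he.chartDeriv_eq he' hq hq'
  have h2 := he'.chartDeriv_eq he hq' hq
  have h3 : chartDeriv e q ((chartDeriv e q).inverse v) = v := he.deriv_inverse hq v
  rw [h2, h1] at h3
  simp only [ContinuousLinearMap.comp_apply] at h3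
  rw [← h1, ← h2, he.deriv_inverse hq] at h3
  exact h3

variable [IsManifold 𝓘(ℂ, Plane) ω S]

theorem IsCoordinates.contMDiffAt_coordField {e : OpenPartialHomeomorph S Plane}
    (he : IsCoordinates e) {q : S} (hq : q ∈ e.source) (v : Plane) :
    ContMDiffAt 𝓘(ℂ, Plane) 𝓘(ℂ, Plane).tangent ω (T% (coordField e v)) q := by
  have : IsManifold 𝓘(ℂ, Plane) 1 S := .of_le (n := ω) (by simp)
  refine ContMDiffAt.mpullback_vectorField_preimage (n := ω) ?_ (he.contMDiffAt hq)
    (he.isInvertible hq) (by simp)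
  exact (contMDiffAt_vectorSpace_iff_contDiffAt (V := fun _ ↦ v)).2 contDiffAt_const

theorem IsCoordinates.mdifferentiableAt_coordField {e : OpenPartialHomeomorph S Plane}
    (he : IsCoordinates e) {q : S} (hq : q ∈ e.source) (v : Plane) :
    MDifferentiableAt 𝓘(ℂ, Plane) 𝓘(ℂ, Plane).tangent (T% (coordField e v)) q :=
  (he.contMDiffAt_coordField hq v).mdifferentiableAt (by simp)

/-- The covariant derivative in coordinates. -/
theorem IsCoordinates.nabla_coordCombination {e : OpenPartialHomeomorph S Plane}
    (he : IsCoordinates e) {nabla : Connection S} {D : Set S}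
    (hn : IsCovariantDerivativeOn Plane nabla Dᶜ) {q : S} (hq : q ∈ e.source) (hqD : q ∉ D)
    {c : Plane → Plane} (hc : DifferentiableAt ℂ c (e q)) (u : Plane) :
    chartDeriv e q (nabla (coordCombination e c) q ((chartDeriv e q).inverse u)) =
      fderiv ℂ c (e q) u + theta nabla e (e q) u (c (e q)) := by
  have h1 := he.hasMFDerivAt_comp hq hc.fst
  have h2 := he.hasMFDerivAt_comp hq hc.snd
  have f1 := he.mdifferentiableAt_coordField hq (1, 0)
  have f2 := he.mdifferentiableAt_coordField hq (0, 1)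
  rw [coordCombination_eq, hn.add (h1.mdifferentiableAt.smul_section f1)
    (h2.mdifferentiableAt.smul_section f2) hqD, hn.leibniz f1 h1.mdifferentiableAt hqD,
    hn.leibniz f2 h2.mdifferentiableAt hqD]
  have key : ∀ (N₁ N₂ : Plane →L[ℂ] Plane) (d₁ d₂ : Plane →L[ℂ] ℂ),
      d₁ = (fderiv ℂ (fun x ↦ (c x).1) (e q)).comp (chartDeriv e q) →
      d₂ = (fderiv ℂ (fun x ↦ (c x).2) (e q)).comp (chartDeriv e q) →
      (chartDeriv e q) (((c (e q)).1 • N₁ + d₁.smulRight ((chartDeriv e q).inverse (1, 0)) +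
        ((c (e q)).2 • N₂ + d₂.smulRight ((chartDeriv e q).inverse (0, 1))))
          ((chartDeriv e q).inverse u)) = fderiv ℂ c (e q) u +
      ((c (e q)).1 • chartDeriv e q (N₁ ((chartDeriv e q).inverse u)) +
        (c (e q)).2 • chartDeriv e q (N₂ ((chartDeriv e q).inverse u))) := by
    rintro N₁ N₂ d₁ d₂ rfl rfl
    simp only [_root_.add_apply, _root_.smul_apply,
      ContinuousLinearMap.smulRight_apply, ContinuousLinearMap.comp_apply, map_add, map_smul,
      he.deriv_inverse hq, fderiv.fst hc, fderiv.snd hc]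
    ext
    · simp
      ring
    · simp
      ring
  have h3 := key (nabla (coordField e (1, 0)) q) (nabla (coordField e (0, 1)) q)
    (mfderiv 𝓘(ℂ, Plane) 𝓘(ℂ, ℂ) (fun q ↦ (c (e q)).1) q)
    (mfderiv 𝓘(ℂ, Plane) 𝓘(ℂ, ℂ) (fun q ↦ (c (e q)).2) q) h1.mfderiv h2.mfderiv
  rw [theta_apply, coordCov_apply, coordCov_apply, e.left_inv hq]
  exact h3

theorem IsCoordinates.mdifferentiableAt_coordCombination {e : OpenPartialHomeomorph S Plane}
    (he : IsCoordinates e) {q : S} (hq : q ∈ e.source) {c : Plane → Plane}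
    (hc : DifferentiableAt ℂ c (e q)) :
    MDifferentiableAt 𝓘(ℂ, Plane) 𝓘(ℂ, Plane).tangent (T% (coordCombination e c)) q := by
  rw [coordCombination_eq]
  exact mdifferentiableAt_add_section
    ((he.hasMFDerivAt_comp hq hc.fst).mdifferentiableAt.smul_section
      (he.mdifferentiableAt_coordField hq (1, 0)))
    ((he.hasMFDerivAt_comp hq hc.snd).mdifferentiableAt.smul_section
      (he.mdifferentiableAt_coordField hq (0, 1)))

theorem IsCoordinates.nabla_coordField {e : OpenPartialHomeomorph S Plane}
    (he : IsCoordinates e) {nabla : Connection S} {D : Set S}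
    (hn : IsCovariantDerivativeOn Plane nabla Dᶜ) {q : S} (hq : q ∈ e.source) (hqD : q ∉ D)
    (u v : Plane) :
    nabla (coordField e v) q (coordField e u q) = coordField e (theta nabla e (e q) u v) q := by
  have h := he.nabla_coordCombination hn hq hqD (c := fun _ ↦ v) (differentiableAt_const v) u
  have h0 : fderiv ℂ (fun _ : Plane ↦ v) (e q) u = 0 := by simp
  rw [h0, zero_add] at h
  rw [coordField_apply e (theta nabla e (e q) u v) q, ← h]
  exact (he.inverse_deriv hq _).symm

/-- Coordinate fields commute. -/
theorem IsCoordinates.mlieBracket_coordField {e : OpenPartialHomeomorph S Plane}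
    (he : IsCoordinates e) {q : S} (hq : q ∈ e.source) (u v : Plane) :
    VectorField.mlieBracket 𝓘(ℂ, Plane) (coordField e u) (coordField e v) q = 0 := by
  have : IsManifold 𝓘(ℂ, Plane) (minSmoothness ℂ 3) S := .of_le (n := ω) le_top
  have hV : ∀ v : Plane, MDifferentiableAt 𝓘(ℂ, Plane) 𝓘(ℂ, Plane).tangent
      (fun x : Plane ↦ (⟨x, v⟩ : TangentBundle 𝓘(ℂ, Plane) Plane)) (e q) := fun v ↦
    ((contMDiffAt_vectorSpace_iff_contDiffAt (n := ω) (V := fun _ ↦ v)).2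
      contDiffAt_const).mdifferentiableAt (by simp)
  have h := VectorField.mpullback_mlieBracket (n := ω) (I := 𝓘(ℂ, Plane)) (I' := 𝓘(ℂ, Plane))
    (f := e) (x₀ := q) (hV u) (hV v) (he.contMDiffAt hq) le_top
  refine Eq.trans h.symm ?_
  rw [VectorField.mpullback_apply]
  have h2 : VectorField.mlieBracket 𝓘(ℂ, Plane) (fun _ : Plane ↦ u) (fun _ : Plane ↦ v) (e q)
      = 0 := by
    have h3 := congrFun (VectorField.mlieBracketWithin_eq_lieBracketWithin (𝕜 := ℂ)
      (V := fun _ : Plane ↦ u) (W := fun _ : Plane ↦ v) (s := univ)) (e q)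
    have h4 := congrFun (VectorField.mlieBracketWithin_univ (I := 𝓘(ℂ, Plane))
      (V := fun _ : Plane ↦ u) (W := fun _ : Plane ↦ v)) (e q)
    have h5 : VectorField.lieBracketWithin ℂ (fun _ : Plane ↦ u) (fun _ : Plane ↦ v) univ (e q)
        = 0 := by simp [VectorField.lieBracketWithin]
    exact h4.symm.trans (h3.trans h5)
  erw [h2]
  exact map_zero _

/-- Coordinate fields commute, so vanishing torsion is the symmetry of the Christoffel symbols. -/
theorem IsLogarithmic.theta_symm {nabla : Connection S} {D : Set S}
    (h : IsLogarithmic nabla D) {e : OpenPartialHomeomorph S Plane} (he : IsCoordinates e)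
    {q : S} (hq : q ∈ e.source) (hqD : q ∉ D) (u v : Plane) :
    theta nabla e (e q) u v = theta nabla e (e q) v u := by
  have ht := h.torsion_eq_zero q hqD (coordField e u) (coordField e v)
    (he.mdifferentiableAt_coordField hq u) (he.mdifferentiableAt_coordField hq v)
  rw [he.mlieBracket_coordField hq, he.nabla_coordField h.isCovariantDerivativeOn hq hqD,
    he.nabla_coordField h.isCovariantDerivativeOn hq hqD] at ht
  have ht' : (chartDeriv e q).inverse (theta nabla e (e q) u v) -
      (chartDeriv e q).inverse (theta nabla e (e q) v u) - 0 = 0 := ht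
  rw [sub_zero, sub_eq_zero] at ht'
  have := congrArg (chartDeriv e q) ht'
  rwa [he.deriv_inverse hq, he.deriv_inverse hq] at this

theorem IsLogarithmic.exists_equation {nabla : Connection S} {D : Set S}
    (h : IsLogarithmic nabla D) {e : OpenPartialHomeomorph S Plane} (he : IsCoordinates e)
    {z : Plane} (hz : z ∈ e.target) : ∃ U : Set Plane, IsOpen U ∧ z ∈ U ∧ U ⊆ e.target ∧
      ∃ f : Plane → ℂ, IsReducedEquationOn f (imageIn D e) U ∧
      ∃ G : Plane → Plane →L[ℂ] Plane →L[ℂ] Plane, AnalyticOnNhd ℂ G U ∧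
      (∀ z ∈ U, e.symm z ∉ D → G z = f z • theta nabla e z) ∧
      ∃ H : Plane → Plane → Plane → Plane →L[ℂ] Plane, ∀ u v, AnalyticOnNhd ℂ (H u v) U ∧
        ∀ z ∈ U, e.symm z ∉ D → H u v z = f z • dTheta nabla e z u v := by
  obtain ⟨U, f, G, H, hU, hzU, hUe, hf, hG, hGθ, hH⟩ :=
    h.logarithmic (e.symm z) e he (e.map_target hz)
  rw [e.right_inv hz] at hzU
  exact ⟨U, hU, hzU, hUe, f, hf, G, hG, fun z hz hzD ↦ hGθ z ⟨hz, fun h ↦ hzD h.2⟩, H,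
    fun u v ↦ ⟨(hH u v).1, fun z hz hzD ↦ (hH u v).2 z ⟨hz, fun h ↦ hzD h.2⟩⟩⟩

/-- At a point outside `D` a local equation is nonzero, hence nonzero nearby. -/
theorem IsLogarithmic.isClosed {nabla : Connection S} {D : Set S}
    (h : IsLogarithmic nabla D) : IsClosed D := by
  rw [← isOpen_compl_iff, isOpen_iff_mem_nhds]
  intro p hp
  set e := chartAt Plane p
  have he : IsCoordinates e := IsManifold.chart_mem_maximalAtlas p
  have hpe : p ∈ e.source := mem_chart_source Plane p
  obtain ⟨U, hU, hpU, hUe, f, hf, -⟩ := h.exists_equation he (e.map_source hpe)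
  have h0 : f (e p) ≠ 0 := by
    rw [Ne, hf.eq_zero_iff hUe hpU, e.left_inv hpe]
    exact hp
  have h1 : ∀ᶠ z in 𝓝 (e p), z ∈ U ∧ f z ≠ 0 :=
    (hU.eventually_mem hpU).and ((hf.analytic _ hpU).continuousAt.eventually_ne h0)
  filter_upwards [(e.continuousAt hpe).eventually h1, e.open_source.mem_nhds hpe] with q hq hqe
  intro hqD
  apply hq.2
  rw [hf.eq_zero_iff hUe hq.1, e.left_inv hqe]
  exact hqD

theorem IsLogarithmic.eventually_notMem {nabla : Connection S} {D : Set S}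
    (h : IsLogarithmic nabla D) {e : OpenPartialHomeomorph S Plane}
    {z : Plane} (hz : z ∈ e.target) (hzD : e.symm z ∉ D) :
    ∀ᶠ w in 𝓝 z, w ∈ e.target ∧ e.symm w ∉ D :=
  (e.open_target.eventually_mem hz).and
    ((e.continuousAt_symm hz).eventually (h.isClosed.isOpen_compl.eventually_mem hzD))

theorem IsLogarithmic.analyticAt_theta {nabla : Connection S} {D : Set S}
    (h : IsLogarithmic nabla D) {e : OpenPartialHomeomorph S Plane} (he : IsCoordinates e)
    {z : Plane} (hz : z ∈ e.target) (hzD : e.symm z ∉ D) : AnalyticAt ℂ (theta nabla e) z := by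
  obtain ⟨U, hU, hzU, hUe, f, hf, G, hG, hGθ, -⟩ := h.exists_equation he hz
  have hf0 : ∀ w ∈ U, e.symm w ∉ D → f w ≠ 0 := fun w hw hwD ↦ by
    rwa [Ne, hf.eq_zero_iff hUe hw]
  have h1 : AnalyticAt ℂ (fun w ↦ (f w)⁻¹ • G w) z :=
    analyticAt_smul ((hf.analytic z hzU).inv (hf0 z hzU hzD)) (hG z hzU)
  refine h1.congr ?_
  filter_upwards [h.eventually_notMem hz hzD, hU.mem_nhds hzU] with w hw hwU
  rw [hGθ w hwU hw.2, inv_smul_smul₀ (hf0 w hwU hw.2)]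

/-- Vanishing of the curvature in coordinates. -/
theorem IsLogarithmic.theta_flat {nabla : Connection S} {D : Set S}
    (h : IsLogarithmic nabla D) {e : OpenPartialHomeomorph S Plane} (he : IsCoordinates e)
    {z : Plane} (hz : z ∈ e.target) (hzD : e.symm z ∉ D) (u v : Plane) :
    fderiv ℂ (theta nabla e) z u v - fderiv ℂ (theta nabla e) z v u +
      (theta nabla e z u) ∘L (theta nabla e z v) - (theta nabla e z v) ∘L (theta nabla e z u)
      = 0 := by
  refine ContinuousLinearMap.ext fun w ↦ ?_
  set q := e.symm z
  have hq : q ∈ e.source := e.map_target hz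
  have hqz : e q = z := e.right_inv hz
  have hn := h.isCovariantDerivativeOn
  have hd : DifferentiableAt ℂ (theta nabla e) z := (h.analyticAt_theta he hz hzD).differentiableAt
  have hder : ∀ v w : Plane, HasFDerivAt (fun z ↦ theta nabla e z v w)
      ((ContinuousLinearMap.apply ℂ Plane w ∘L ContinuousLinearMap.apply ℂ _ v) ∘L
        fderiv ℂ (theta nabla e) z) z := fun v w ↦
    hasFDerivAt_apply_apply hd.hasFDerivAt v w
  have hev : ∀ᶠ q' in 𝓝 q, q' ∈ e.source ∧ q' ∉ D :=
    (e.open_source.eventually_mem hq).and (h.isClosed.isOpen_compl.eventually_mem hzD)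
  -- For constant fields, `∇_u ∇_v w = ∂_u(θ(v) w) + θ(u) θ(v) w`; antisymmetrizing in `u` and `v`
  -- gives the curvature.
  have key : ∀ u v : Plane,
      nabla (fun q' ↦ nabla (coordField e w) q' (coordField e v q')) q (coordField e u q) =
        (chartDeriv e q).inverse (fderiv ℂ (theta nabla e) z u v w +
          theta nabla e z u (theta nabla e z v w)) := by
    intro u v
    have hc : DifferentiableAt ℂ (fun z ↦ theta nabla e z v w) (e q) := by
      rw [hqz]
      exact (hder v w).differentiableAt
    have hm := he.mdifferentiableAt_coordCombination hq hc
    have hevq : ∀ᶠ q' in 𝓝 q, nabla (coordField e w) q' (coordField e v q') =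
        coordCombination e (fun z ↦ theta nabla e z v w) q' := by
      filter_upwards [hev] with q' hq'
      exact he.nabla_coordField hn hq'.1 hq'.2 v w
    have hm' : MDifferentiableAt 𝓘(ℂ, Plane) 𝓘(ℂ, Plane).tangent
        (T% (fun q' ↦ nabla (coordField e w) q' (coordField e v q'))) q := by
      refine hm.congr_of_eventuallyEq ?_
      filter_upwards [hevq] with q' hq'
      rw [hq']
    rw [hn.congr_of_eventuallyEq hm' hm (h.isClosed.isOpen_compl.mem_nhds hzD) hevq]
    have h1 := he.nabla_coordCombination hn hq hzD hc u
    rw [hqz, (hder v w).fderiv] at h1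
    have h2 := congrArg (chartDeriv e q).inverse h1
    exact (he.inverse_deriv hq _).symm.trans h2
  have hcurv := h.curvature_eq_zero q hzD (coordField e u) (coordField e v) (coordField e w)
    (he.contMDiffAt_coordField hq u) (he.contMDiffAt_coordField hq v)
    (he.contMDiffAt_coordField hq w)
  rw [key, key, he.mlieBracket_coordField hq] at hcurv
  obtain ⟨N, hcurv'⟩ : ∃ N : Plane →L[ℂ] Plane, (chartDeriv e q).inverse
      (fderiv ℂ (theta nabla e) z u v w + theta nabla e z u (theta nabla e z v w)) -
      (chartDeriv e q).inverse (fderiv ℂ (theta nabla e) z v u w +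
        theta nabla e z v (theta nabla e z u w)) - N 0 = 0 :=
    ⟨nabla (coordField e w) q, hcurv⟩
  rw [map_zero, sub_zero, ← map_sub] at hcurv'
  have h4 := congrArg (chartDeriv e q) hcurv'
  rw [he.deriv_inverse hq, map_zero] at h4
  simp only [_root_.sub_apply, _root_.add_apply, ContinuousLinearMap.comp_apply,
    _root_.zero_apply]
  rw [← h4]
  abel

/-- The change of coordinates formula for the Christoffel symbols. -/
theorem IsLogarithmic.theta_transition {nabla : Connection S} {D : Set S}
    (h : IsLogarithmic nabla D) {e e' : OpenPartialHomeomorph S Plane}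
    (he : IsCoordinates e) (he' : IsCoordinates e') {q : S} (hq : q ∈ e.source)
    (hq' : q ∈ e'.source) (hqD : q ∉ D) (u c : Plane) :
    theta nabla e' (e' q) (fderiv ℂ (e' ∘ e.symm) (e q) u) (fderiv ℂ (e' ∘ e.symm) (e q) c) =
      fderiv ℂ (e' ∘ e.symm) (e q) (theta nabla e (e q) u c) -
        fderiv ℂ (fderiv ℂ (e' ∘ e.symm)) (e q) u c := by
  have hn := h.isCovariantDerivativeOn
  set φ := e' ∘ e.symm
  set ψ := e ∘ e'.symm
  have hφ : AnalyticAt ℂ φ (e q) := he.analyticAt_transition he' hq hq'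
  have hψ : AnalyticAt ℂ ψ (e' q) := he'.analyticAt_transition he hq' hq
  have hψq : ψ (e' q) = e q := by simp [ψ, e'.left_inv hq']
  have hφq : φ (e q) = e' q := by simp [φ, e.left_inv hq]
  have hJ : DifferentiableAt ℂ (fderiv ℂ φ) (e q) := hφ.fderiv.differentiableAt
  have hJc : HasFDerivAt (fun z ↦ fderiv ℂ φ z c)
      (ContinuousLinearMap.apply ℂ Plane c ∘L fderiv ℂ (fderiv ℂ φ) (e q)) (e q) :=
    (ContinuousLinearMap.apply ℂ Plane c).hasFDerivAt.comp (e q) hJ.hasFDerivAt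
  -- The field with constant coordinates `c` in `e`, expressed in `e'`.
  let c' : Plane → Plane := fun z' ↦ fderiv ℂ φ (ψ z') c
  have hc' : HasFDerivAt c' ((ContinuousLinearMap.apply ℂ Plane c ∘L
      fderiv ℂ (fderiv ℂ φ) (e q)) ∘L fderiv ℂ ψ (e' q)) (e' q) :=
    HasFDerivAt.comp (g := fun z ↦ fderiv ℂ φ z c) (e' q) (by rw [hψq]; exact hJc)
      hψ.differentiableAt.hasFDerivAt
  have hev : ∀ᶠ q' in 𝓝 q, coordField e c q' = coordCombination e' c' q' := by
    filter_upwards [e.open_source.mem_nhds hq, e'.open_source.mem_nhds hq'] with r hr hr'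
    have h1 : coordCombination e' c' r = (chartDeriv e' r).inverse (c' (e' r)) := rfl
    have h2 : ψ (e' r) = e r := by simp [ψ, e'.left_inv hr']
    rw [h1, coordField_apply]
    simp only [c']
    rw [h2]
    have h3 := he'.inverse_deriv hr' ((chartDeriv e r).inverse c)
    rw [he.chartDeriv_eq he' hr hr'] at h3 ⊢
    simp only [ContinuousLinearMap.comp_apply, he.deriv_inverse hr] at h3
    exact h3.symm
  have hcongr := hn.congr_of_eventuallyEq (he.mdifferentiableAt_coordField hq c)
    (he'.mdifferentiableAt_coordCombination hq' hc'.differentiableAt)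
    (h.isClosed.isOpen_compl.mem_nhds hqD) hev
  have h1 := he'.nabla_coordCombination hn hq' hqD hc'.differentiableAt (fderiv ℂ φ (e q) u)
  have h2 : (chartDeriv e' q).inverse (fderiv ℂ φ (e q) u) = (chartDeriv e q).inverse u := by
    have h3 := he'.inverse_deriv hq' ((chartDeriv e q).inverse u)
    rw [he.chartDeriv_eq he' hq hq'] at h3 ⊢
    simp only [ContinuousLinearMap.comp_apply, he.deriv_inverse hq] at h3
    exact h3
  have h4 : chartDeriv e' q (nabla (coordField e c) q ((chartDeriv e q).inverse u)) =
      fderiv ℂ φ (e q) (theta nabla e (e q) u c) := by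
    have h5 := he.nabla_coordField hn hq hqD u c
    have h6 : nabla (coordField e c) q ((chartDeriv e q).inverse u) =
      (chartDeriv e q).inverse (theta nabla e (e q) u c) := h5
    rw [h6, he.chartDeriv_eq he' hq hq']
    simp only [ContinuousLinearMap.comp_apply, he.deriv_inverse hq]
    rfl
  rw [h2, ← hcongr, h4, hc'.fderiv] at h1
  simp only [ContinuousLinearMap.comp_apply, c', hψq] at h1
  rw [he.fderiv_transition_comp he' hq hq'] at h1
  rw [h1]
  simp

end Coordinates

/-! ### Absence of isolated zeros in two variables -/

section NonVanishing

open Filter Metric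

/-- For `x ≠ x₀` close to `x₀` the slice `f (x, ·)` has no zero in a fixed disc. A lower bound on
the circle, uniform in `x`, passes to the centre by the maximum principle for `1 / f (x, ·)`, and
then to the limit `x₀`. -/
theorem ne_zero_of_eventually_ne_zero {f : ℂ × ℂ → ℂ} {x₀ : ℂ} (hf : AnalyticAt ℂ f (x₀, 0))
    (h1 : ∀ᶠ z in 𝓝 ((x₀, 0) : ℂ × ℂ), z.2 ≠ 0 → f z ≠ 0)
    (h2 : ∃ᶠ x in 𝓝 x₀, f (x, 0) ≠ 0) : f (x₀, 0) ≠ 0 := by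
  obtain ⟨r, hr, hrU⟩ := Metric.nhds_basis_closedBall.mem_iff.1 (hf.eventually_analyticAt.and h1)
  rw [← closedBall_prod_same] at hrU
  have hfx : AnalyticAt ℂ (fun x ↦ f (x, 0)) x₀ :=
    AnalyticAt.comp (g := f) (f := fun x : ℂ ↦ (x, (0 : ℂ))) hf (by fun_prop)
  have h3 : ∀ᶠ x in 𝓝[≠] x₀, f (x, 0) ≠ 0 := by
    rcases hfx.eventually_eq_zero_or_eventually_ne_zero with h | h
    · exact absurd (h.mono fun _ hx ↦ not_not.2 hx) h2
    · exact h
  have hS : ({x₀} : Set ℂ) ×ˢ sphere (0 : ℂ) r ⊆ closedBall x₀ r ×ˢ closedBall 0 r :=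
    Set.prod_mono (singleton_subset_iff.2 (mem_closedBall_self hr.le)) sphere_subset_closedBall
  have hcomp : IsCompact (({x₀} : Set ℂ) ×ˢ sphere (0 : ℂ) r) :=
    isCompact_singleton.prod (isCompact_sphere _ _)
  have hpos : ∀ z ∈ ({x₀} : Set ℂ) ×ˢ sphere (0 : ℂ) r, 0 < ‖f z‖ := by
    intro z hz
    refine norm_pos_iff.2 ((hrU (hS hz)).2 ?_)
    intro h0
    have := hz.2
    simp [h0, hr.ne] at this
  obtain ⟨c, hc, hcf⟩ := hcomp.exists_forall_le' (f := fun z ↦ ‖f z‖)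
    (fun z hz ↦ (hrU (hS hz)).1.continuousAt.norm.continuousWithinAt) hpos
  have h4 : ∀ᶠ x in 𝓝 x₀, ∀ y ∈ sphere (0 : ℂ) r, c / 2 < ‖f (x, y)‖ := by
    have := (isCompact_sphere (0 : ℂ) r).eventually_forall_of_forall_eventually
      (x₀ := x₀) (P := fun x y ↦ c / 2 < ‖f (x, y)‖) (fun y hy ↦ by
        have h5 : c / 2 < ‖f (x₀, y)‖ := (half_lt_self hc).trans_le (hcf (x₀, y) ⟨rfl, hy⟩)
        exact ((hrU (hS (mk_mem_prod rfl hy))).1.continuousAt.norm.eventually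
          (lt_mem_nhds h5)))
    exact this
  have h5 : ∀ᶠ x in 𝓝[≠] x₀, c / 2 ≤ ‖f (x, 0)‖ := by
    filter_upwards [h3, h4.filter_mono nhdsWithin_le_nhds,
      (closedBall_mem_nhds x₀ hr |> mem_nhdsWithin_of_mem_nhds)] with x hx0 hxs hxr
    have hne : ∀ y ∈ closedBall (0 : ℂ) r, f (x, y) ≠ 0 := by
      intro y hy
      by_cases h0 : y = 0
      · rwa [h0]
      · exact (hrU (mk_mem_prod hxr hy)).2 h0
    have hd : DifferentiableOn ℂ (fun y ↦ (f (x, y))⁻¹) (closedBall 0 r) := by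
      refine DifferentiableOn.inv (fun y hy ↦ ?_) hne
      exact (DifferentiableAt.comp (g := f) y (hrU (mk_mem_prod hxr hy)).1.differentiableAt
        (by fun_prop)).differentiableWithinAt
    have h6 := Complex.norm_le_of_forall_mem_frontier_norm_le (U := ball (0 : ℂ) r) (C := (c / 2)⁻¹)
      isBounded_ball (hd.diffContOnCl_ball subset_rfl)
      (by
        intro y hy
        rw [frontier_ball _ hr.ne'] at hy
        rw [norm_inv]
        exact inv_anti₀ (by positivity) (hxs y hy).le)
      (subset_closure (mem_ball_self hr))
    rw [norm_inv] at h6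
    exact (inv_le_inv₀ (norm_pos_iff.2 hx0) (by positivity)).1 h6
  have h6 : c / 2 ≤ ‖f (x₀, 0)‖ :=
    ge_of_tendsto (hfx.continuousAt.norm.tendsto.mono_left nhdsWithin_le_nhds) h5
  exact norm_pos_iff.1 ((half_pos hc).trans_le h6)

end NonVanishing

theorem hasFDerivAt_smul {X F : Type*} [NormedAddCommGroup X] [NormedSpace ℂ X]
    [NormedAddCommGroup F] [NormedSpace ℂ F] {z : X} {f : X → ℂ} {f' : X →L[ℂ] ℂ} {g : X → F}
    {g' : X →L[ℂ] F} (hf : HasFDerivAt f f' z) (hg : HasFDerivAt g g' z) :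
    HasFDerivAt (fun z ↦ f z • g z) (f z • g' + f'.smulRight (g z)) z := hf.smul hg

/-! ### The shape of the pole along the smooth part of `D` -/

section Straightening

open Filter

variable {S : Type*} [TopologicalSpace S] [ChartedSpace Plane S]

/-- Local coordinates in which `D` is the line `y = 0`. -/
structure Straightens (D : Set S) (e : OpenPartialHomeomorph S Plane) : Prop where
  isCoordinates : IsCoordinates e
  mem_iff : ∀ q ∈ e.source, q ∈ D ↔ (e q).2 = 0

theorem IsAdapted.straightens {D : Set S} {p : S} {e : OpenPartialHomeomorph S Plane}
    (h : IsAdapted D p e) : Straightens D e := ⟨h.isCoordinates, h.mem_iff⟩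

theorem Straightens.symm_mem_iff {D : Set S} {e : OpenPartialHomeomorph S Plane}
    (h : Straightens D e) {z : Plane} (hz : z ∈ e.target) : e.symm z ∈ D ↔ z.2 = 0 := by
  rw [h.mem_iff _ (e.map_target hz), e.right_inv hz]

/-- In coordinates straightening `D`, the form `θ` has a simple pole in the direction of `dy` and
no pole in the direction of `dx`. -/
theorem IsLogarithmic.exists_regular_parts [IsManifold 𝓘(ℂ, Plane) ω S] {nabla : Connection S}
    {D : Set S} (h : IsLogarithmic nabla D) {e : OpenPartialHomeomorph S Plane}
    (he : Straightens D e) {x₀ : ℂ} (hz₀ : ((x₀, 0) : Plane) ∈ e.target) :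
    ∃ A B : Plane → Plane →L[ℂ] Plane, AnalyticAt ℂ A (x₀, 0) ∧ AnalyticAt ℂ B (x₀, 0) ∧
      ∀ᶠ z in 𝓝 ((x₀, 0) : Plane), z.2 ≠ 0 →
        z.2 • theta nabla e z (0, 1) = A z ∧ theta nabla e z (1, 0) = B z := by
  obtain ⟨U, hU, hzU, hUe, f, hf, G, hG, hGθ, H, hH⟩ := h.exists_equation he.isCoordinates hz₀
  have hf0 : ∀ z ∈ U, f z = 0 ↔ z.2 = 0 := fun z hz ↦ by
    rw [hf.eq_zero_iff hUe hz, he.symm_mem_iff (hUe hz)]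
  have hline : ∀ᶠ x in 𝓝 x₀, ((x, 0) : Plane) ∈ U := by
    have : ContinuousAt (fun x : ℂ ↦ ((x, 0) : Plane)) x₀ := by fun_prop
    exact this.eventually (hU.mem_nhds hzU)
  obtain ⟨g, hg, hfg⟩ := exists_analyticAt_snd_smul (hf.analytic _ hzU) (by
    filter_upwards [hline] with x hx
    exact (hf0 _ hx).2 rfl)
  have hg0 : g (x₀, 0) ≠ 0 := by
    refine ne_zero_of_eventually_ne_zero hg ?_ ?_
    · filter_upwards [hfg, hU.mem_nhds hzU] with z hz hzU h0 hgz
      rw [hgz, smul_zero, hf0 z hzU] at hz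
      exact h0 hz
    · intro hev
      have hev' : ∀ᶠ z in 𝓝 ((x₀, 0) : Plane), ¬ g (z.1, 0) ≠ 0 :=
        (continuous_fst.tendsto ((x₀, 0) : Plane)).eventually hev
      -- If `g` vanished along the line, `f = y g` would have zero differential at all nearby points
      -- of `D`, contrary to reducedness.
      have hcl : ((x₀, 0) : Plane) ∈ closure {z | z ∈ U ∧ f z = 0 ∧ fderiv ℂ f z ≠ 0} :=
        hf.reduced ⟨⟨hz₀, (he.symm_mem_iff hz₀).2 rfl⟩, hzU⟩
      obtain ⟨z, ⟨hzU', hfz, hdf⟩, hz⟩ := ((mem_closure_iff_frequently.1 hcl).and_eventually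
        (hev'.and (hfg.eventually_nhds.and hg.eventually_analyticAt))).exists
      apply hdf
      have hz2 : z.2 = 0 := (hf0 z hzU').1 hfz
      have hgz : g z = 0 := by
        have := hz.1
        rw [not_not] at this
        rw [← this, ← hz2]
      have h1 : HasFDerivAt (fun z : Plane ↦ z.2 • g z)
          (z.2 • fderiv ℂ g z + (ContinuousLinearMap.snd ℂ ℂ ℂ).smulRight (g z)) z :=
        hasFDerivAt_snd.smul hz.2.2.differentiableAt.hasFDerivAt
      rw [(h1.congr_of_eventuallyEq hz.2.1).fderiv, hz2, hgz]
      ext <;> simp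
  have hginv : AnalyticAt ℂ (fun z ↦ (g z)⁻¹) (x₀, 0) := hg.inv hg0
  -- `G₁ = y θ` off the line, obtained from `f θ` by removing the unit `g = f / y`.
  let G₁ : Plane → Plane →L[ℂ] Plane →L[ℂ] Plane := fun z ↦ (g z)⁻¹ • G z
  have hG₁ : AnalyticAt ℂ G₁ (x₀, 0) := analyticAt_smul hginv (hG _ hzU)
  have hev : ∀ᶠ z in 𝓝 ((x₀, 0) : Plane), z ∈ U ∧ g z ≠ 0 ∧ f z = z.2 • g z ∧
      AnalyticAt ℂ G₁ z :=
    (hU.eventually_mem hzU).and ((hg.continuousAt.eventually_ne hg0).and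
      (hfg.and hG₁.eventually_analyticAt))
  have hθ : ∀ᶠ z in 𝓝 ((x₀, 0) : Plane), z.2 ≠ 0 → theta nabla e z = (z.2)⁻¹ • G₁ z := by
    filter_upwards [hev] with z ⟨hzU, hgz, hfz, _⟩ hz2
    have hzD : e.symm z ∉ D := by rwa [he.symm_mem_iff (hUe hzU)]
    simp only [G₁]
    rw [hGθ z hzU hzD, hfz, smul_smul, smul_smul, smul_eq_mul]
    have : z.2⁻¹ * (g z)⁻¹ * (z.2 * g z) = 1 := by field_simp
    rw [this, one_smul]
  -- The formula for `B`: with `θ = G₁ / y`, the holomorphic function `y dθ(∂x, ∂y)` expands to `∂x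
  -- G₁(∂y) - ∂y G₁(∂x) + G₁(∂x) / y`, and the last term is `θ(∂x)`.
  refine ⟨fun z ↦ G₁ z (0, 1), fun z ↦ (g z)⁻¹ • H (1, 0) (0, 1) z - fderiv ℂ G₁ z (1, 0) (0, 1) +
    fderiv ℂ G₁ z (0, 1) (1, 0), analyticAt_clm_apply hG₁ analyticAt_const, ?_, ?_⟩
  · refine AnalyticAt.add (AnalyticAt.sub (analyticAt_smul hginv ((hH _ _).1 _ hzU)) ?_) ?_
    · exact analyticAt_clm_apply (analyticAt_clm_apply hG₁.fderiv analyticAt_const) analyticAt_const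
    · exact analyticAt_clm_apply (analyticAt_clm_apply hG₁.fderiv analyticAt_const) analyticAt_const
  · filter_upwards [hev, hθ.eventually_nhds] with z ⟨hzU, hgz, hfz, hGz⟩ hθz hz2
    have hθz' := hθz.self_of_nhds hz2
    have hzD : e.symm z ∉ D := by rwa [he.symm_mem_iff (hUe hzU)]
    constructor
    · rw [hθz']
      simp only [_root_.smul_apply]
      rw [smul_inv_smul₀ hz2]
    · have hne : ∀ᶠ w in 𝓝 z, w.2 ≠ 0 := continuous_snd.continuousAt.eventually_ne hz2
      have h1 : theta nabla e =ᶠ[𝓝 z] fun z ↦ (z.2)⁻¹ • G₁ z := by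
        filter_upwards [hθz, hne] with w hw hw0
        exact hw hw0
      have h2 : HasFDerivAt (fun z : Plane ↦ (z.2)⁻¹)
          (-(z.2 ^ 2)⁻¹ • ContinuousLinearMap.snd ℂ ℂ ℂ) z :=
        (hasDerivAt_inv hz2).comp_hasFDerivAt z hasFDerivAt_snd
      have h3 := (hasFDerivAt_smul h2 hGz.differentiableAt.hasFDerivAt).congr_of_eventuallyEq h1
      have h4 := (hH (1, 0) (0, 1)).2 z hzU hzD
      have h5 : theta nabla e z (1, 0) = z.2⁻¹ • G₁ z (1, 0) := by rw [hθz']; rfl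
      rw [h4, hfz, dTheta, h3.fderiv, h5]
      simp only [_root_.add_apply, _root_.smul_apply, ContinuousLinearMap.smulRight_apply,
        ContinuousLinearMap.coe_snd', smul_eq_mul]
      ext <;> simp <;> field_simp <;> ring

/-- The defect of horizontality of a `1`-form and of its pullback. -/
theorem IsLogarithmic.pullback_defect [IsManifold 𝓘(ℂ, Plane) ω S] {nabla : Connection S}
    {D : Set S} (h : IsLogarithmic nabla D) {e e' : OpenPartialHomeomorph S Plane}
    (he : IsCoordinates e) (he' : IsCoordinates e') {q : S} (hq : q ∈ e.source)
    (hq' : q ∈ e'.source) (hqD : q ∉ D) {η' : Plane → Plane →L[ℂ] ℂ}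
    (hη' : DifferentiableAt ℂ η' (e' q)) :
    DifferentiableAt ℂ (fun z ↦ (η' (e' (e.symm z))) ∘L (fderiv ℂ (e' ∘ e.symm) z)) (e q) ∧
    ∀ u c : Plane,
      fderiv ℂ (fun z ↦ (η' (e' (e.symm z))) ∘L (fderiv ℂ (e' ∘ e.symm) z)) (e q) u c -
        (η' (e' q)) (fderiv ℂ (e' ∘ e.symm) (e q) (theta nabla e (e q) u c)) =
      fderiv ℂ η' (e' q) (fderiv ℂ (e' ∘ e.symm) (e q) u) (fderiv ℂ (e' ∘ e.symm) (e q) c) -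
        η' (e' q) (theta nabla e' (e' q) (fderiv ℂ (e' ∘ e.symm) (e q) u)
          (fderiv ℂ (e' ∘ e.symm) (e q) c)) := by
  have hT := h.theta_transition he he' hq hq' hqD
  have hφ : AnalyticAt ℂ (e' ∘ e.symm) (e q) := he.analyticAt_transition he' hq hq'
  have hφq : (e' ∘ e.symm) (e q) = e' q := by simp [e.left_inv hq]
  set φ := e' ∘ e.symm
  have h1 : HasFDerivAt (fun z ↦ η' (φ z)) ((fderiv ℂ η' (e' q)) ∘L (fderiv ℂ φ (e q))) (e q) :=
    HasFDerivAt.comp (g := η') (e q) (by rw [hφq]; exact hη'.hasFDerivAt)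
      hφ.differentiableAt.hasFDerivAt
  have h2 := h1.clm_comp hφ.fderiv.differentiableAt.hasFDerivAt
  refine ⟨h2.differentiableAt, fun u c ↦ ?_⟩
  have h3 : (fun z ↦ (η' (e' (e.symm z))) ∘L (fderiv ℂ φ z)) =
    fun z ↦ (η' (φ z)) ∘L (fderiv ℂ φ z) := rfl
  rw [h3, h2.fderiv, hT u c]
  simp only [hφq, map_sub, _root_.add_apply, ContinuousLinearMap.comp_apply,
    ContinuousLinearMap.compL_apply, ContinuousLinearMap.flip_apply]
  ring

end Straightening

/-- Locally at a point `z₀` of the line `y = 0`, the (multivalued) form `y ^ α η` is horizontal for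
the connection `d + Θ`. -/
structure IsLogHorizontalAt (Θ : Plane → Plane →L[ℂ] Plane →L[ℂ] Plane) (α : ℂ)
    (η : Plane → Plane →L[ℂ] ℂ) (z₀ : Plane) : Prop where
  analyticAt : AnalyticAt ℂ η z₀
  fderiv_eq : ∀ᶠ z in 𝓝 z₀, z.2 ≠ 0 → ∀ u : Plane,
    fderiv ℂ η z u = (η z) ∘L (Θ z u) - (α * (u.2 / z.2)) • η z

/-- The connection `d + Θ` admits near `z₀` a frame of `1`-forms `η i` such that the
`y ^ α i η i` are horizontal. -/
def IsDiagonalAt (Θ : Plane → Plane →L[ℂ] Plane →L[ℂ] Plane) (z₀ : Plane) : Prop :=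
  ∃ (α : Fin 2 → ℂ) (η : Fin 2 → Plane → Plane →L[ℂ] ℂ),
    (∀ i, IsLogHorizontalAt Θ (α i) (η i) z₀) ∧ LinearIndependent ℂ (fun i ↦ η i z₀)

/-! ### Logarithmic horizontal forms under a change of coordinates -/

section Transition

open Filter

theorem eventually_mem_target {S : Type*} [TopologicalSpace S]
    {e e' : OpenPartialHomeomorph S Plane} {q : S} (hq : q ∈ e.source) (hq' : q ∈ e'.source) :
    ∀ᶠ z in 𝓝 (e q), z ∈ e.target ∧ e.symm z ∈ e'.source :=
  (e.open_target.eventually_mem (e.map_source hq)).and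
    ((e.continuousAt_symm (e.map_source hq)).eventually
      (by rw [e.left_inv hq]; exact e'.open_source.eventually_mem hq'))

variable {S : Type*} [TopologicalSpace S] [ChartedSpace Plane S]

/-- Two equations of a straightened curve differ by an invertible function. -/
theorem Straightens.exists_unit {D : Set S} {e e' : OpenPartialHomeomorph S Plane}
    (he : Straightens D e) (he' : Straightens D e') {q : S} (hq : q ∈ e.source)
    (hq' : q ∈ e'.source) (hqD : q ∈ D) :
    ∃ g : Plane → ℂ, AnalyticAt ℂ g (e q) ∧ g (e q) ≠ 0 ∧
      ∀ᶠ z in 𝓝 (e q), (e' (e.symm z)).2 = z.2 * g z := by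
  have hφ := he.isCoordinates.analyticAt_transition he'.isCoordinates hq hq'
  have hφ2 : AnalyticAt ℂ (fun z ↦ (e' (e.symm z)).2) (e q) :=
    AnalyticAt.comp (g := Prod.snd) (f := e' ∘ e.symm) analyticAt_snd hφ
  have hz2 : (e q).2 = 0 := (he.mem_iff q hq).1 hqD
  have hz₀ : e q = ((e q).1, 0) := Prod.ext rfl hz2
  obtain ⟨g, hg, hgφ⟩ := exists_analyticAt_snd_smul (x₀ := (e q).1) (hz₀ ▸ hφ2) (by
    have hc : ContinuousAt (fun x : ℂ ↦ ((x, 0) : Plane)) (e q).1 := by fun_prop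
    have := eventually_mem_target hq hq'
    rw [hz₀] at this
    filter_upwards [hc.eventually this] with x hx
    exact (he'.mem_iff _ hx.2).1 ((he.symm_mem_iff hx.1).2 rfl))
  rw [← hz₀] at hg hgφ
  refine ⟨g, hg, fun h0 ↦ ?_, hgφ⟩
  have h1 := hasFDerivAt_smul (hasFDerivAt_snd (𝕜 := ℂ) (p := e q))
    hg.differentiableAt.hasFDerivAt
  have h2 : HasFDerivAt (fun z ↦ (e' (e.symm z)).2)
      ((ContinuousLinearMap.snd ℂ ℂ ℂ) ∘L fderiv ℂ (e' ∘ e.symm) (e q)) (e q) :=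
    (hasFDerivAt_snd (𝕜 := ℂ)).comp (e q) hφ.differentiableAt.hasFDerivAt
  have h3 := (h1.congr_of_eventuallyEq hgφ).unique h2
  -- If `g` vanished at the point, so would the differential of the second coordinate of `e'`; this
  -- is tested on the vector which the invertible differential of the transition sends to `(0, 1)`.
  have h4 := DFunLike.congr_fun h3 (fderiv ℂ (e ∘ e'.symm) (e' q) (0, 1))
  rw [ContinuousLinearMap.comp_apply,
    he'.isCoordinates.fderiv_transition_comp he.isCoordinates hq' hq] at h4
  simp [h0, hz2] at h4

variable [IsManifold 𝓘(ℂ, Plane) ω S]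

/-- With `y' = y g`, the pullback of `y' ^ α η'` is `y ^ α` times `g ^ α` times the pullback of
`η'`. Dividing `g` by its value at the point makes the principal logarithm analytic there and the
correcting factor equal to `1`. -/
theorem IsLogHorizontalAt.pullback {nabla : Connection S} {D : Set S} (h : IsLogarithmic nabla D)
    {e e' : OpenPartialHomeomorph S Plane} (he : Straightens D e) (he' : Straightens D e') {q : S}
    (hq : q ∈ e.source) (hq' : q ∈ e'.source) (hqD : q ∈ D) {α : ℂ} {η' : Plane → Plane →L[ℂ] ℂ}
    (hη' : IsLogHorizontalAt (theta nabla e') α η' (e' q)) :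
    ∃ η : Plane → Plane →L[ℂ] ℂ, IsLogHorizontalAt (theta nabla e) α η (e q) ∧
      η (e q) = (η' (e' q)) ∘L (fderiv ℂ (e' ∘ e.symm) (e q)) := by
  obtain ⟨g, hg, hg0, hgφ⟩ := he.exists_unit he' hq hq' hqD
  have hφ := he.isCoordinates.analyticAt_transition he'.isCoordinates hq hq'
  have hφq : (e' ∘ e.symm) (e q) = e' q := by simp [e.left_inv hq]
  have hf : AnalyticAt ℂ (fun z ↦ g z / g (e q)) (e q) := hg.div analyticAt_const hg0
  have hf1 : g (e q) / g (e q) ∈ Complex.slitPlane := by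
    rw [div_self hg0]
    exact Complex.one_mem_slitPlane
  let m : Plane → ℂ := fun z ↦ Complex.exp (α * Complex.log (g z / g (e q)))
  have hm : AnalyticAt ℂ m (e q) := (analyticAt_const.mul (hf.clog hf1)).cexp
  let κ : Plane → Plane →L[ℂ] ℂ :=
    fun z ↦ (η' (e' (e.symm z))) ∘L (fderiv ℂ (e' ∘ e.symm) z)
  have hκ : AnalyticAt ℂ κ (e q) := by
    refine analyticAt_clm_comp ?_ hφ.fderiv
    exact AnalyticAt.comp (g := η') (f := e' ∘ e.symm) (by rw [hφq]; exact hη'.analyticAt) hφ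
  refine ⟨fun z ↦ m z • κ z, ⟨analyticAt_smul hm hκ, ?_⟩, ?_⟩
  · have h1 : ∀ᶠ z in 𝓝 (e q), g z / g (e q) ∈ Complex.slitPlane :=
      hf.continuousAt.eventually (Complex.isOpen_slitPlane.mem_nhds hf1)
    have h2 : ContinuousAt (e' ∘ e.symm) (e q) := hφ.continuousAt
    rw [ContinuousAt, hφq] at h2
    filter_upwards [eventually_mem_target hq hq', hgφ.eventually_nhds, h1, hg.eventually_analyticAt,
      hg.continuousAt.eventually_ne hg0, h2.eventually hη'.fderiv_eq,
      h2.eventually hη'.analyticAt.eventually_analyticAt] with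
        z ⟨hz, hz'⟩ hgφz hsl hgz hgz0 hη'z hη'a hz2 u
    have hφ2 := hgφz.self_of_nhds
    have hzq : e (e.symm z) = z := e.right_inv hz
    have hzD : e.symm z ∉ D := by rwa [he.symm_mem_iff hz]
    have hp := h.pullback_defect he.isCoordinates he'.isCoordinates (e.map_target hz) hz' hzD
      (η' := η') hη'a.differentiableAt
    rw [hzq] at hp
    obtain ⟨hd, hp⟩ := hp
    have hη'z' := hη'z (by
      rw [Function.comp_apply, hφ2]
      exact mul_ne_zero hz2 hgz0)
    have hJ2 : (fderiv ℂ (e' ∘ e.symm) z u).2 = u.2 * g z + z.2 * fderiv ℂ g z u := by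
      have hφz := he.isCoordinates.analyticAt_transition he'.isCoordinates (e.map_target hz) hz'
      rw [hzq] at hφz
      have h3 : HasFDerivAt (fun z ↦ (e' (e.symm z)).2)
          ((ContinuousLinearMap.snd ℂ ℂ ℂ) ∘L fderiv ℂ (e' ∘ e.symm) z) z :=
        (hasFDerivAt_snd (𝕜 := ℂ)).comp z hφz.differentiableAt.hasFDerivAt
      have h5 := (hasFDerivAt_smul (hasFDerivAt_snd (𝕜 := ℂ) (p := z))
        hgz.differentiableAt.hasFDerivAt).congr_of_eventuallyEq hgφz
      have h6 := DFunLike.congr_fun (h3.unique h5) u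
      simpa [mul_comm, add_comm] using h6
    have hmz : HasFDerivAt m ((m z * (α * (g z)⁻¹)) • fderiv ℂ g z) z := by
      have h3 : HasFDerivAt (fun z ↦ g z / g (e q)) ((g (e q))⁻¹ • fderiv ℂ g z) z := by
        simp only [div_eq_mul_inv]
        exact hgz.differentiableAt.hasFDerivAt.mul_const _
      have h4 := ((h3.clog hsl).const_mul α).cexp
      refine h4.congr_fderiv ?_
      ext <;> simp [m] <;> field_simp
    have hprod := hasFDerivAt_smul hmz hd.hasFDerivAt
    rw [hprod.fderiv]
    refine ContinuousLinearMap.ext fun c ↦ ?_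
    have hpc := hp u c
    have h7 := DFunLike.congr_fun (hη'z' (fderiv ℂ (e' ∘ e.symm) z u))
      (fderiv ℂ (e' ∘ e.symm) z c)
    simp only [Function.comp_apply, _root_.sub_apply, _root_.smul_apply, smul_eq_mul,
      ContinuousLinearMap.comp_apply] at h7
    rw [h7, sub_right_comm, sub_self, zero_sub, sub_eq_iff_eq_add, hJ2, hφ2] at hpc
    simp only [_root_.add_apply, _root_.sub_apply, _root_.smul_apply, smul_eq_mul,
      ContinuousLinearMap.comp_apply, ContinuousLinearMap.smulRight_apply, κ, hpc]
    field_simp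
    ring
  · simp [m, κ, div_self hg0, e.left_inv hq]

end Transition

theorem analyticAt_clm_map {X F G : Type*} [NormedAddCommGroup X] [NormedSpace ℂ X]
    [NormedAddCommGroup F] [NormedSpace ℂ F] [NormedAddCommGroup G] [NormedSpace ℂ G]
    {z : X} (T : F →L[ℂ] G) {B : X → F} (hB : AnalyticAt ℂ B z) :
    AnalyticAt ℂ (fun z ↦ T (B z)) z := (T.analyticAt _).comp hB

theorem analyticAt_precomp {X F G H : Type*} [NormedAddCommGroup X] [NormedSpace ℂ X]
    [NormedAddCommGroup F] [NormedSpace ℂ F] [NormedAddCommGroup G] [NormedSpace ℂ G]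
    [NormedAddCommGroup H] [NormedSpace ℂ H] {z : X} {B : X → F →L[ℂ] G} (hB : AnalyticAt ℂ B z) :
    AnalyticAt ℂ (fun z ↦ (ContinuousLinearMap.compL ℂ F G H).flip (B z)) z :=
  analyticAt_clm_map (F := F →L[ℂ] G) (G := (G →L[ℂ] H) →L[ℂ] (F →L[ℂ] H)) 
    (ContinuousLinearMap.compL ℂ F G H).flip hB

theorem exists_bound_of_analyticOnNhd {X F : Type*} [NormedAddCommGroup X] [NormedSpace ℂ X]
    [NormedAddCommGroup F] [NormedSpace ℂ F] {f : X → F} {K : Set X} (hK : IsCompact K)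
    (hf : AnalyticOnNhd ℂ f K) : ∃ C, ∀ z ∈ K, ‖f z‖ ≤ C :=
  hK.exists_bound_of_continuousOn hf.continuousOn

/-! ### Extension of diagonal frames from a transverse slice -/

section Extension

open Filter Metric

/-- On the polydisc of centre `(x₀, 0)` and radius `r`, the connection form is
`Θ = B dx + A dy / y` with `A` and `B` holomorphic, and it is flat. -/
structure IsLogFormOn (Θ : Plane → Plane →L[ℂ] Plane →L[ℂ] Plane)
    (A B : Plane → Plane →L[ℂ] Plane) (x₀ : ℂ) (r : ℝ) : Prop where
  pos : 0 < r
  analytic_left : AnalyticOnNhd ℂ A (closedBall x₀ r ×ˢ closedBall 0 r)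
  analytic_right : AnalyticOnNhd ℂ B (closedBall x₀ r ×ˢ closedBall 0 r)
  eq_left : ∀ z ∈ closedBall x₀ r ×ˢ closedBall 0 r, z.2 ≠ 0 → z.2 • Θ z (0, 1) = A z
  eq_right : ∀ z ∈ closedBall x₀ r ×ˢ closedBall 0 r, z.2 ≠ 0 → Θ z (1, 0) = B z
  flat : ∀ z ∈ ball x₀ r ×ˢ ball 0 r, z.2 ≠ 0 →
    fderiv ℂ A z (1, 0) - z.2 • fderiv ℂ B z (0, 1) + (B z) ∘L (A z) - (A z) ∘L (B z) = 0

theorem clm_apply_eq {F : Type*} [NormedAddCommGroup F] [NormedSpace ℂ F] (T : Plane →L[ℂ] F)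
    (u : Plane) : T u = u.1 • T (1, 0) + u.2 • T (0, 1) := by
  rw [← map_smul, ← map_smul, ← map_add]
  simp

theorem IsLogFormOn.apply_eq {Θ : Plane → Plane →L[ℂ] Plane →L[ℂ] Plane}
    {A B : Plane → Plane →L[ℂ] Plane} {x₀ : ℂ} {r : ℝ} (h : IsLogFormOn Θ A B x₀ r) {z : Plane}
    (hz : z ∈ closedBall x₀ r ×ˢ closedBall 0 r) (hz2 : z.2 ≠ 0) (u : Plane) :
    Θ z u = u.1 • B z + (u.2 / z.2) • A z := by
  rw [clm_apply_eq (Θ z) u, h.eq_right z hz hz2, ← h.eq_left z hz hz2, smul_smul,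
    div_mul_cancel₀ _ hz2]

/-- The equation `∂x η = η B` has no pole and is solved with initial data `c` on the slice `x = x₁`.
By flatness, the defect `y ∂y η - η A + α η` of the equation in `y` satisfies the same homogeneous
equation in `x`; it vanishes at `x₁`, hence everywhere. -/
theorem IsLogFormOn.exists_extension {Θ : Plane → Plane →L[ℂ] Plane →L[ℂ] Plane}
    {A B : Plane → Plane →L[ℂ] Plane} {x₀ : ℂ} {r : ℝ} (h : IsLogFormOn Θ A B x₀ r) {x₁ : ℂ}
    (hx₁ : x₁ ∈ ball x₀ r) {α : ℂ} {c : ℂ → Plane →L[ℂ] ℂ} (hc : AnalyticAt ℂ c 0)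
    (hceq : ∀ᶠ y in 𝓝 (0 : ℂ), y ≠ 0 → y • deriv c y = (c y) ∘L (A (x₁, y)) - α • c y) :
    ∃ η : Plane → Plane →L[ℂ] ℂ, η (x₁, 0) = c 0 ∧
      (∀ x ∈ ball x₀ r, HasDerivAt (fun x ↦ η (x, 0)) ((η (x, 0)) ∘L (B (x, 0))) x) ∧
      ∀ x ∈ ball x₀ r, IsLogHorizontalAt Θ α η (x, 0) := by
  obtain ⟨δ₀, hδ₀, hδ₀U⟩ := Metric.nhds_basis_closedBall.mem_iff.1
    (hc.eventually_analyticAt.and hceq)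
  let δ := min δ₀ (r / 2)
  have hδ : 0 < δ := lt_min hδ₀ (half_pos h.pos)
  have hδr : δ < r := (min_le_right _ _).trans_lt (half_lt_self h.pos)
  have hδU : ∀ y ∈ closedBall (0 : ℂ) δ, _ := fun y hy ↦
    hδ₀U (closedBall_subset_closedBall (min_le_left _ _) hy)
  have hsub : ball x₀ r ×ˢ closedBall (0 : ℂ) δ ⊆ closedBall x₀ r ×ˢ closedBall 0 r :=
    Set.prod_mono ball_subset_closedBall (closedBall_subset_closedBall hδr.le)
  have hsub' : ball x₀ r ×ˢ ball (0 : ℂ) δ ⊆ ball x₀ r ×ˢ ball 0 r :=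
    Set.prod_mono subset_rfl (ball_subset_ball hδr.le)
  have hsub'' : ball x₀ r ×ˢ ball (0 : ℂ) δ ⊆ closedBall x₀ r ×ˢ closedBall 0 r :=
    Set.prod_mono ball_subset_closedBall (ball_subset_closedBall.trans
      (closedBall_subset_closedBall hδr.le))
  have hopen : IsOpen (ball x₀ r ×ˢ ball (0 : ℂ) δ) := isOpen_ball.prod isOpen_ball
  let T : (Plane →L[ℂ] Plane) →L[ℂ] (Plane →L[ℂ] ℂ) →L[ℂ] (Plane →L[ℂ] ℂ) :=
    (ContinuousLinearMap.compL ℂ Plane Plane ℂ).flip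
  have hT : AnalyticOnNhd ℂ (fun z ↦ T (B z)) (closedBall x₀ r ×ˢ closedBall 0 r) := fun z hz ↦
    analyticAt_precomp (h.analytic_right z hz)
  obtain ⟨C, hC⟩ := exists_bound_of_analyticOnNhd ((isCompact_closedBall x₀ r).prod
    (isCompact_closedBall (0 : ℂ) r)) hT
  obtain ⟨η, hη, hη0, hηd⟩ := exists_solution_parametric (convex_ball x₀ r) isOpen_ball (y₀ := 0)
    (δ := δ) (hT.mono hsub) (fun z hz ↦ hC z (hsub hz)) hx₁ (c := c) (fun y hy ↦ (hδU y hy).1)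
  have hηd' : ∀ z ∈ ball x₀ r ×ˢ ball (0 : ℂ) δ, fderiv ℂ η z (1, 0) = (η z) ∘L (B z) := by
    intro z hz
    have h1 : HasDerivAt (fun x : ℂ ↦ ((x, z.2) : Plane)) (1, 0) z.1 :=
      (hasDerivAt_id z.1).prodMk (hasDerivAt_const _ _)
    exact (HasFDerivAt.comp_hasDerivAt (l := η) z.1 (hη z hz).differentiableAt.hasFDerivAt h1).unique
      (hηd z hz)
  have key : ∀ z ∈ ball x₀ r ×ˢ ball (0 : ℂ) δ, z.2 ≠ 0 →
      z.2 • fderiv ℂ η z (0, 1) - (η z) ∘L (A z) + α • η z = 0 := by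
    rintro ⟨x, y⟩ ⟨hx, hy⟩ hy0
    simp only at hx hy hy0 ⊢
    refine eq_zero_of_hasDerivAt (convex_ball x₀ r) (C := C)
      (u := fun x ↦ y • fderiv ℂ η (x, y) (0, 1) - (η (x, y)) ∘L (A (x, y)) + α • η (x, y))
      (u' := fun x ↦ T (B (x, y)) (y • fderiv ℂ η (x, y) (0, 1) - (η (x, y)) ∘L (A (x, y)) +
        α • η (x, y))) ?_ ?_ hx₁ ?_ hx
    · intro x hx
      have hz : ((x, y) : Plane) ∈ ball x₀ r ×ˢ ball (0 : ℂ) δ := ⟨hx, hy⟩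
      set z : Plane := (x, y)
      have h1 : HasDerivAt (fun x : ℂ ↦ ((x, y) : Plane)) (1, 0) x :=
        (hasDerivAt_id x).prodMk (hasDerivAt_const _ _)
      have hη1 := HasFDerivAt.comp_hasDerivAt (l := η) x (hη z hz).differentiableAt.hasFDerivAt h1
      have hA1 := HasFDerivAt.comp_hasDerivAt (l := A) x
        (h.analytic_left z (hsub'' hz)).differentiableAt.hasFDerivAt h1
      have hη2 := HasFDerivAt.comp_hasDerivAt (l := fderiv ℂ η) x
        (hη z hz).fderiv.differentiableAt.hasFDerivAt h1
      have hη3 := hη2.clm_apply (hasDerivAt_const x ((0, 1) : Plane))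
      have hsymm : fderiv ℂ (fderiv ℂ η) z (1, 0) (0, 1) =
          (fderiv ℂ η z (0, 1)) ∘L (B z) + (η z) ∘L (fderiv ℂ B z (0, 1)) := by
        rw [((hη z hz).contDiffAt (n := ω)).isSymmSndFDerivAt (by simp)]
        have h2 : (fun z ↦ fderiv ℂ η z (1, 0)) =ᶠ[𝓝 z] fun z ↦ (η z) ∘L (B z) := by
          filter_upwards [hopen.mem_nhds hz] with z hz using hηd' z hz
        have h3 := (hη z hz).differentiableAt.hasFDerivAt.clm_comp
          (h.analytic_right z (hsub'' hz)).differentiableAt.hasFDerivAt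
        have h4 := (hη z hz).fderiv.differentiableAt.hasFDerivAt.clm_apply
          (hasFDerivAt_const ((1, 0) : Plane) z)
        have h5 := DFunLike.congr_fun (h4.unique (h3.congr_of_eventuallyEq h2)) (0, 1)
        simpa [add_comm] using h5
      have hd := ((hη3.const_smul y).sub (hη1.clm_comp hA1)).add (hη1.const_smul α)
      refine hd.congr_deriv ?_
      have hfl := h.flat z (hsub' hz) hy0
      have hfl' : fderiv ℂ A z (1, 0) = y • fderiv ℂ B z (0, 1) - (B z) ∘L (A z) +
          (A z) ∘L (B z) := by
        rw [← sub_eq_zero, ← hfl]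
        abel
      simp only [Function.comp_apply, map_zero, add_zero]
      change y • fderiv ℂ (fderiv ℂ η) z (1, 0) (0, 1) - _ + _ = (_ : Plane →L[ℂ] ℂ) ∘L (B z)
      rw [hsymm]
      have hA1' : fderiv ℂ A (x, y) (1, 0) = _ := hfl'
      have hη1' : fderiv ℂ η (x, y) (1, 0) = _ := hηd' z hz
      rw [hA1', hη1']
      refine ContinuousLinearMap.ext fun v ↦ ?_
      simp only [_root_.add_apply, _root_.sub_apply, _root_.smul_apply, smul_eq_mul,
        ContinuousLinearMap.comp_apply, map_add, map_sub, map_smul, z]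
      ring
    · intro x hx
      exact ((T (B (x, y))).le_opNorm _).trans
        (mul_le_mul_of_nonneg_right (hC _ (hsub'' ⟨hx, hy⟩)) (norm_nonneg _))
    · have h1 : HasDerivAt (fun y : ℂ ↦ ((x₁, y) : Plane)) (0, 1) y :=
        (hasDerivAt_const _ _).prodMk (hasDerivAt_id y)
      have h2 := HasFDerivAt.comp_hasDerivAt (l := η) y
        (hη (x₁, y) ⟨hx₁, hy⟩).differentiableAt.hasFDerivAt h1
      have h3 : c =ᶠ[𝓝 y] η ∘ fun y ↦ (x₁, y) := by
        filter_upwards [isOpen_ball.mem_nhds hy] with y hy using (hη0 y hy).symm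
      have h4 := (hδU y (ball_subset_closedBall hy)).2 hy0
      rw [(h2.congr_of_eventuallyEq h3).deriv] at h4
      rw [h4, hη0 y hy]
      abel
  refine ⟨η, hη0 0 (mem_ball_self hδ), fun x hx ↦ ?_, fun x hx ↦ ⟨hη _ ⟨hx, mem_ball_self hδ⟩, ?_⟩⟩
  · exact hηd (x, 0) ⟨hx, mem_ball_self hδ⟩
  · filter_upwards [hopen.mem_nhds (show ((x, 0) : Plane) ∈ _ from ⟨hx, mem_ball_self hδ⟩)]
      with z hz hz2 u
    have h1 := key z hz hz2
    have h2 : fderiv ℂ η z (0, 1) = (z.2)⁻¹ • ((η z) ∘L (A z) - α • η z) := by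
      rw [eq_inv_smul_iff₀ hz2, ← sub_eq_zero, ← h1]
      abel
    rw [clm_apply_eq (fderiv ℂ η z) u, h.apply_eq (hsub'' hz) hz2, hηd' z hz, h2]
    refine ContinuousLinearMap.ext fun v ↦ ?_
    simp only [_root_.add_apply, _root_.sub_apply, _root_.smul_apply, smul_eq_mul,
      ContinuousLinearMap.comp_apply, map_add, map_smul]
    field_simp
    ring

/-- Diagonal form on a transverse slice propagates along the curve. -/
theorem IsLogFormOn.isDiagonalAt {Θ : Plane → Plane →L[ℂ] Plane →L[ℂ] Plane}
    {A B : Plane → Plane →L[ℂ] Plane} {x₀ : ℂ} {r : ℝ} (h : IsLogFormOn Θ A B x₀ r) {x₁ : ℂ}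
    (hx₁ : x₁ ∈ ball x₀ r) {α : Fin 2 → ℂ} {c : Fin 2 → ℂ → Plane →L[ℂ] ℂ}
    (hc : ∀ i, AnalyticAt ℂ (c i) 0)
    (hceq : ∀ i, ∀ᶠ y in 𝓝 (0 : ℂ), y ≠ 0 →
      y • deriv (c i) y = (c i y) ∘L (A (x₁, y)) - α i • c i y)
    (hli : LinearIndependent ℂ (fun i ↦ c i 0)) {x : ℂ} (hx : x ∈ ball x₀ r) :
    IsDiagonalAt Θ (x, 0) := by
  choose η hη0 hηd hη using fun i ↦ h.exists_extension hx₁ (hc i) (hceq i)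
  refine ⟨α, η, fun i ↦ hη i x hx, ?_⟩
  rw [Fintype.linearIndependent_iff] at hli ⊢
  intro g hg
  apply hli
  have hB : ContinuousOn (fun x ↦ B (x, 0)) (closedBall x₀ r) :=
    h.analytic_right.continuousOn.comp (by fun_prop)
      (fun x hx ↦ ⟨hx, mem_closedBall_self h.pos.le⟩)
  obtain ⟨C, hC⟩ := (isCompact_closedBall x₀ r).exists_bound_of_continuousOn hB
  -- The combination with coefficients `g` solves the equation in `x` along `y = 0`; vanishing at
  -- `x`, it vanishes at `x₁`.
  simp only [← hη0]
  refine eq_zero_of_hasDerivAt (convex_ball x₀ r) (C := C) (u := fun x ↦ ∑ i, g i • η i (x, 0))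
    (u' := fun x ↦ (∑ i, g i • η i (x, 0)) ∘L (B (x, 0))) ?_ ?_ hx hg hx₁
  · intro x hx
    have := HasDerivAt.fun_sum (u := Finset.univ) fun i _ ↦ (hηd i x hx).const_smul (g i)
    refine this.congr_deriv ?_
    refine ContinuousLinearMap.ext fun v ↦ ?_
    simp
  · intro x hx
    refine (ContinuousLinearMap.opNorm_comp_le _ _).trans ?_
    rw [mul_comm]
    exact mul_le_mul_of_nonneg_right (hC x (ball_subset_closedBall hx)) (norm_nonneg _)

theorem IsLogHorizontalAt.slice {Θ : Plane → Plane →L[ℂ] Plane →L[ℂ] Plane}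
    {A B : Plane → Plane →L[ℂ] Plane} {x₀ : ℂ} {r : ℝ} (h : IsLogFormOn Θ A B x₀ r) {x₁ : ℂ}
    (hx₁ : x₁ ∈ ball x₀ r) {α : ℂ} {η : Plane → Plane →L[ℂ] ℂ}
    (hη : IsLogHorizontalAt Θ α η (x₁, 0)) :
    AnalyticAt ℂ (fun y ↦ η (x₁, y)) 0 ∧ ∀ᶠ y in 𝓝 (0 : ℂ), y ≠ 0 →
      y • deriv (fun y ↦ η (x₁, y)) y = (η (x₁, y)) ∘L (A (x₁, y)) - α • η (x₁, y) := by
  refine ⟨AnalyticAt.comp (g := η) (f := fun y : ℂ ↦ ((x₁, y) : Plane)) hη.analyticAt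
    (by fun_prop), ?_⟩
  have hc : ContinuousAt (fun y : ℂ ↦ ((x₁, y) : Plane)) 0 := by fun_prop
  filter_upwards [hc.eventually hη.fderiv_eq, hc.eventually hη.analyticAt.eventually_analyticAt,
    closedBall_mem_nhds (0 : ℂ) h.pos] with y hy hya hyr hy0
  have h1 : HasDerivAt (fun y : ℂ ↦ ((x₁, y) : Plane)) (0, 1) y :=
    (hasDerivAt_const _ _).prodMk (hasDerivAt_id y)
  have h2 := HasFDerivAt.comp_hasDerivAt (l := η) y hya.differentiableAt.hasFDerivAt h1
  have h3 : deriv (fun y ↦ η (x₁, y)) y = fderiv ℂ η (x₁, y) (0, 1) := h2.deriv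
  rw [h3, hy hy0, h.apply_eq ⟨ball_subset_closedBall hx₁, hyr⟩ hy0]
  refine ContinuousLinearMap.ext fun v ↦ ?_
  simp only [_root_.add_apply, _root_.sub_apply, _root_.smul_apply, smul_eq_mul,
    ContinuousLinearMap.comp_apply, map_add, map_smul]
  field_simp
  simp

/-- Restricting a frame to the slice at `x₁` and extending it again reaches every point of the line.
The two points play symmetric roles, so one implication is enough. -/
theorem IsLogFormOn.isDiagonalAt_iff {Θ : Plane → Plane →L[ℂ] Plane →L[ℂ] Plane}
    {A B : Plane → Plane →L[ℂ] Plane} {x₀ : ℂ} {r : ℝ} (h : IsLogFormOn Θ A B x₀ r) {x₁ x : ℂ}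
    (hx₁ : x₁ ∈ ball x₀ r) (hx : x ∈ ball x₀ r) (h₁ : IsDiagonalAt Θ (x₁, 0)) :
    IsDiagonalAt Θ (x, 0) := by
  obtain ⟨α, η, hη, hli⟩ := h₁
  exact h.isDiagonalAt hx₁ (α := α) (c := fun i y ↦ η i (x₁, y)) (fun i ↦ ((hη i).slice h hx₁).1)
    (fun i ↦ ((hη i).slice h hx₁).2) hli hx

end Extension

/-! ### Propagation of the diagonal form along a branch -/

section Propagation

theorem regularLocus_subset {S : Type*} [TopologicalSpace S] [ChartedSpace Plane S]
    (D : Set S) : regularLocus D ⊆ D := by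
  rintro p ⟨e, he⟩
  rw [he.mem_iff p he.mem_source, he.centred]
  rfl

open Filter Metric

variable {S : Type*} [TopologicalSpace S] [ChartedSpace Plane S] [IsManifold 𝓘(ℂ, Plane) ω S]

/-- The relation between `A` and `B` is `y` times the curvature equation evaluated on `∂x` and `∂y`.
-/
theorem IsLogarithmic.exists_isLogFormOn {nabla : Connection S} {D : Set S}
    (h : IsLogarithmic nabla D) {e : OpenPartialHomeomorph S Plane}
    (he : Straightens D e) {x₀ : ℂ} (hz₀ : ((x₀, 0) : Plane) ∈ e.target) :
    ∃ A B r, IsLogFormOn (theta nabla e) A B x₀ r ∧ closedBall x₀ r ×ˢ closedBall 0 r ⊆ e.target := by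
  obtain ⟨A, B, hA, hB, hAB⟩ := h.exists_regular_parts he hz₀
  obtain ⟨r, hr, hrU⟩ := Metric.nhds_basis_closedBall.mem_iff.1
    ((hA.eventually_analyticAt.and hB.eventually_analyticAt).and
      (hAB.and (e.open_target.eventually_mem hz₀)))
  rw [← closedBall_prod_same] at hrU
  refine ⟨A, B, r, ⟨hr, fun z hz ↦ (hrU hz).1.1, fun z hz ↦ (hrU hz).1.2,
    fun z hz hz2 ↦ ((hrU hz).2.1 hz2).1, fun z hz hz2 ↦ ((hrU hz).2.1 hz2).2, ?_⟩,
    fun z hz ↦ (hrU hz).2.2⟩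
  intro z hz hz2
  have hzU := hrU (Set.prod_mono ball_subset_closedBall ball_subset_closedBall hz)
  have hopen : IsOpen (ball x₀ r ×ˢ ball (0 : ℂ) r) := isOpen_ball.prod isOpen_ball
  have hzD : e.symm z ∉ D := by rwa [he.symm_mem_iff hzU.2.2]
  have hfl := h.theta_flat he.isCoordinates hzU.2.2 hzD (1, 0) (0, 1)
  have hθ := (h.analyticAt_theta he.isCoordinates hzU.2.2 hzD).differentiableAt.hasFDerivAt
  have hθ1 := hθ.clm_apply (hasFDerivAt_const ((1, 0) : Plane) z)
  have hθ2 := hθ.clm_apply (hasFDerivAt_const ((0, 1) : Plane) z)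
  have hev : ∀ᶠ w in 𝓝 z, w.2 ≠ 0 ∧ w ∈ ball x₀ r ×ˢ ball (0 : ℂ) r :=
    (continuous_snd.continuousAt.eventually_ne hz2).and (hopen.mem_nhds hz)
  have hB' : HasFDerivAt B _ z := hθ1.congr_of_eventuallyEq (by
    filter_upwards [hev] with w hw
    exact ((hrU (Set.prod_mono ball_subset_closedBall ball_subset_closedBall hw.2)).2.1
      hw.1).2.symm)
  have hA' : HasFDerivAt A _ z := (hasFDerivAt_smul hasFDerivAt_snd hθ2).congr_of_eventuallyEq (by
    filter_upwards [hev] with w hw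
    exact ((hrU (Set.prod_mono ball_subset_closedBall ball_subset_closedBall hw.2)).2.1
      hw.1).1.symm)
  rw [hA'.fderiv, hB'.fderiv]
  have h1 : B z = theta nabla e z (1, 0) := (hzU.2.1 hz2).2.symm
  have h2 : A z = z.2 • theta nabla e z (0, 1) := (hzU.2.1 hz2).1.symm
  rw [h1, h2]
  refine ContinuousLinearMap.ext fun v ↦ ?_
  have h3 := congrArg (z.2 • ·) (DFunLike.congr_fun hfl v)
  simp only [_root_.zero_apply, smul_zero] at h3
  rw [_root_.zero_apply, ← h3]
  simp [smul_add, smul_sub]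

/-- Near the point `q` of `D`, the connection is diagonal in some straightening coordinates. -/
def IsDiagonalNear (nabla : Connection S) (D : Set S) (q : S) : Prop :=
  ∃ e : OpenPartialHomeomorph S Plane, Straightens D e ∧ q ∈ e.source ∧
    IsDiagonalAt (theta nabla e) (e q)

/-- Independence of the coordinates: frames pull back with the same exponents, and remain frames
because the transition has invertible differential. -/
theorem IsDiagonalNear.isDiagonalAt {nabla : Connection S} {D : Set S} (h : IsLogarithmic nabla D)
    {q : S} (hq : IsDiagonalNear nabla D q) (hqD : q ∈ D) {e : OpenPartialHomeomorph S Plane}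
    (he : Straightens D e) (hqe : q ∈ e.source) : IsDiagonalAt (theta nabla e) (e q) := by
  obtain ⟨e', he', hqe', α, η', hη', hli⟩ := hq
  choose η hη hηq using fun i ↦ (hη' i).pullback h he he' hqe hqe' hqD
  refine ⟨α, η, hη, ?_⟩
  rw [Fintype.linearIndependent_iff] at hli ⊢
  intro g hg
  apply hli
  refine ContinuousLinearMap.ext fun v ↦ ?_
  have := DFunLike.congr_fun hg (fderiv ℂ (e ∘ e'.symm) (e' q) v)
  simp only [hηq, Fin.sum_univ_two, _root_.add_apply, _root_.smul_apply,
    ContinuousLinearMap.comp_apply,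
    he'.isCoordinates.fderiv_transition_comp he.isCoordinates hqe' hqe] at this
  simpa [Fin.sum_univ_two] using this

/-- In a polydisc around `p` all points of `D` have the form `(x, 0)`, and the diagonal property
passes between any two of them. -/
theorem isDiagonalNear_eventually {nabla : Connection S} {D : Set S} (h : IsLogarithmic nabla D)
    {p : S} (hp : p ∈ regularLocus D) :
    ∀ᶠ q in 𝓝[regularLocus D] p, IsDiagonalNear nabla D p ↔ IsDiagonalNear nabla D q := by
  have hpD := regularLocus_subset D hp
  obtain ⟨e, he⟩ := hp
  have h0 : ((0, 0) : Plane) ∈ e.target := by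
    have := e.map_source he.mem_source
    rwa [he.centred] at this
  obtain ⟨A, B, r, hAB, hr⟩ := h.exists_isLogFormOn he.straightens h0
  have h1 : ∀ᶠ q in 𝓝 p, e q ∈ ball (0 : ℂ) r ×ˢ ball (0 : ℂ) r := by
    refine (e.continuousAt he.mem_source).eventually ?_
    rw [he.centred]
    exact (isOpen_ball.prod isOpen_ball).mem_nhds ⟨mem_ball_self hAB.pos, mem_ball_self hAB.pos⟩
  filter_upwards [self_mem_nhdsWithin, nhdsWithin_le_nhds h1,
    nhdsWithin_le_nhds (e.open_source.mem_nhds he.mem_source)] with q hq hqr hqe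
  have hqD := regularLocus_subset D hq
  have hq2 : e q = ((e q).1, 0) := Prod.ext rfl ((he.mem_iff q hqe).1 hqD)
  constructor
  · intro hd
    have := hd.isDiagonalAt h hpD he.straightens he.mem_source
    rw [he.centred] at this
    refine ⟨e, he.straightens, hqe, ?_⟩
    rw [hq2]
    exact hAB.isDiagonalAt_iff (mem_ball_self hAB.pos) hqr.1 this
  · intro hd
    have := hd.isDiagonalAt h hqD he.straightens hqe
    rw [hq2] at this
    refine ⟨e, he.straightens, he.mem_source, ?_⟩
    rw [he.centred]
    exact hAB.isDiagonalAt_iff hqr.1 (mem_ball_self hAB.pos) this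

/-- A set lying between a connected component of the regular locus and its closure is connected, so
a locally constant property is constant on it. -/
theorem IsBranch.isDiagonalNear {nabla : Connection S} {D D₀ : Set S} (h : IsLogarithmic nabla D)
    (hD₀ : IsBranch D D₀) {p : S} (hp : p ∈ D₀ ∩ regularLocus D) (hpd : IsDiagonalNear nabla D p)
    {q : S} (hq : q ∈ D₀ ∩ regularLocus D) : IsDiagonalNear nabla D q := by
  obtain ⟨p₀, hp₀, rfl⟩ := hD₀
  have hconn : IsPreconnected (closure (connectedComponentIn (regularLocus D) p₀) ∩
      regularLocus D) :=
    isPreconnected_connectedComponentIn.subset_closure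
      (subset_inter subset_closure (connectedComponentIn_subset _ _)) inter_subset_left
  refine (hconn.induction₂ (fun p q ↦ IsDiagonalNear nabla D p ↔ IsDiagonalNear nabla D q)
    (fun x hx ↦ ?_) (fun x y z _ _ _ h1 h2 ↦ h1.trans h2) (fun x y _ _ h1 ↦ h1.symm) hp hq).1 hpd
  exact nhdsWithin_mono _ inter_subset_right (isDiagonalNear_eventually h hx.2)

end Propagation

theorem form_zero_smul (l : Plane →L[ℂ] ℂ) : (0 : ℂ) • l = 0 := by
  ext <;> simp

theorem form_smul_zero (c : ℂ) : c • (0 : Plane →L[ℂ] ℂ) = 0 := by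
  ext <;> simp

theorem form_smul_eq_zero {c : ℂ} {l : Plane →L[ℂ] ℂ} (h : c • l = 0) (hl : l ≠ 0) : c = 0 := by
  by_contra hc
  refine hl (ContinuousLinearMap.ext fun v ↦ ?_)
  have := DFunLike.congr_fun h v
  simpa [hc] using this

/-! ### Solutions of Fuchsian equations at a simple pole -/

section LogSolutions

open Filter Metric

/-- Near `0`, the (multivalued) function `y ^ β h(y)` solves the equation `y u' = u ∘ a(y)`. -/
structure IsLogSolution (a : ℂ → Plane →L[ℂ] Plane) (β : ℂ) (h : ℂ → Plane →L[ℂ] ℂ) : Prop where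
  analyticAt : AnalyticAt ℂ h 0
  deriv_eq : ∀ᶠ y in 𝓝 (0 : ℂ), y ≠ 0 → y • deriv h y = (h y) ∘L (a y) - β • h y

/-- As `y` tends to `0` the term `y h'` disappears: the leading coefficient, when nonzero, is an
eigenvector of the residue `a 0` with the exponent as eigenvalue. -/
theorem IsLogSolution.apply_zero {a : ℂ → Plane →L[ℂ] Plane} {β : ℂ} {h : ℂ → Plane →L[ℂ] ℂ}
    (hh : IsLogSolution a β h) (ha : ContinuousAt a 0) : (h 0) ∘L (a 0) = β • h 0 := by
  have h1 : Tendsto (fun y ↦ y • deriv h y) (𝓝[≠] 0) (𝓝 ((0 : ℂ) • deriv h 0)) :=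
    (continuousAt_id.smul hh.analyticAt.deriv.continuousAt).tendsto.mono_left nhdsWithin_le_nhds
  have h2 : Tendsto (fun y ↦ (h y) ∘L (a y) - β • h y) (𝓝[≠] 0)
      (𝓝 ((h 0) ∘L (a 0) - β • h 0)) :=
    ((hh.analyticAt.continuousAt.clm_comp ha).sub
      (hh.analyticAt.continuousAt.const_smul β)).tendsto.mono_left nhdsWithin_le_nhds
  have h3 : (fun y ↦ y • deriv h y) =ᶠ[𝓝[≠] 0] fun y ↦ (h y) ∘L (a y) - β • h y :=
    eventually_nhdsWithin_iff.2 hh.deriv_eq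
  have h4 := tendsto_nhds_unique (h1.congr' h3) h2
  rw [form_zero_smul] at h4
  exact sub_eq_zero.1 h4.symm

/-- The order of vanishing of `h` at `0` is factored out and absorbed in the exponent. -/
theorem IsLogSolution.exists_ne_zero {a : ℂ → Plane →L[ℂ] Plane} {β : ℂ} {h : ℂ → Plane →L[ℂ] ℂ}
    (hh : IsLogSolution a β h) (h0 : ¬ ∀ᶠ y in 𝓝 0, h y = 0) :
    ∃ (m : ℕ) (g : ℂ → Plane →L[ℂ] ℂ), IsLogSolution a (β + m) g ∧ g 0 ≠ 0 ∧
      ∀ᶠ y in 𝓝 0, h y = y ^ m • g y := by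
  obtain ⟨m, g, hg, hg0, hgh⟩ := hh.analyticAt.exists_eventuallyEq_pow_smul_nonzero_iff.2 h0
  simp only [sub_zero] at hgh
  refine ⟨m, g, ⟨hg, ?_⟩, hg0, hgh⟩
  filter_upwards [hh.deriv_eq, hgh.eventually_nhds, hg.eventually_analyticAt] with y hy hgy hga hy0
  have h1 := ((hasDerivAt_pow m y).smul hga.differentiableAt.hasDerivAt).congr_of_eventuallyEq hgy
  have h2 := hy hy0
  rw [h1.deriv, hgy.self_of_nhds] at h2
  refine smul_right_injective _ (pow_ne_zero m hy0) ?_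
  have h3 : y * (m * y ^ (m - 1)) = m * y ^ m := by
    rcases m with _ | m
    · simp
    · simp [pow_succ]
      ring
  refine ContinuousLinearMap.ext fun v ↦ ?_
  have h4 := DFunLike.congr_fun h2 v
  simp only [_root_.add_apply, _root_.sub_apply, _root_.smul_apply, smul_eq_mul,
    ContinuousLinearMap.comp_apply] at h4 ⊢
  linear_combination h4 - (g y v) * h3

/-- A solution of a differential equation with a simple pole that is multiplied by a constant by
the monodromy has the form `y ^ β h(y)`. -/
theorem exists_isLogSolution {a : ℂ → Plane →L[ℂ] Plane} {R C : ℝ} (hR : 0 < R)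
    (hC : ∀ y ∈ ball (0 : ℂ) R, ‖a y‖ ≤ C) {u : ℂ → Plane →L[ℂ] ℂ}
    (hu : ∀ w : ℂ, w.re < Real.log R → HasDerivAt u ((u w) ∘L (a (Complex.exp w))) w) {μ : ℂ}
    (hμ : μ ≠ 0) (huμ : ∀ w : ℂ, w.re < Real.log R → u (w + 2 * Real.pi * Complex.I) = μ • u w)
    {w₀ : ℂ} (hw₀ : w₀.re < Real.log R) (hu0 : u w₀ ≠ 0) :
    ∃ (β : ℂ) (h : ℂ → Plane →L[ℂ] ℂ), IsLogSolution a β h ∧ h 0 ≠ 0 ∧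
      ∀ᶠ y in 𝓝[≠] (0 : ℂ), ∀ w : ℂ, Complex.exp w = y → u w = Complex.exp (β * w) • h y := by
  classical
  have hC0 : 0 ≤ C := (norm_nonneg _).trans (hC 0 (mem_ball_self hR))
  have hpi : (2 * Real.pi * Complex.I : ℂ) ≠ 0 := Complex.two_pi_I_ne_zero
  let Ω : Set ℂ := {w | w.re < Real.log R}
  have hΩ : Convex ℝ Ω := convex_halfSpace_re_lt _
  have hexp : ∀ w : ℂ, Complex.exp w ∈ ball (0 : ℂ) R ↔ w ∈ Ω := by
    intro w
    rw [mem_ball_zero_iff, Complex.norm_exp, ← Real.lt_log_iff_exp_lt hR]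
    rfl
  have hbound : ∀ w ∈ Ω, ‖(u w) ∘L (a (Complex.exp w))‖ ≤ C * ‖u w‖ := fun w hw ↦ by
    refine (ContinuousLinearMap.opNorm_comp_le _ _).trans ?_
    rw [mul_comm]
    exact mul_le_mul_of_nonneg_right (hC _ ((hexp w).2 hw)) (norm_nonneg _)
  -- A logarithm of the multiplier, chosen so that `exp (-α w) u w` has period `2πi` and descends to
  -- a function of `y`. The indicator below makes the periodicity hold on all of `ℂ`.
  let α : ℂ := Complex.log μ / (2 * Real.pi * Complex.I)
  have hα : Complex.exp (α * (2 * Real.pi * Complex.I)) = μ := by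
    rw [div_mul_cancel₀ _ hpi, Complex.exp_log hμ]
  let v : ℂ → Plane →L[ℂ] ℂ := Ω.indicator fun w ↦ Complex.exp (-(α * w)) • u w
  have hv : Function.Periodic v (2 * Real.pi * Complex.I) := by
    intro w
    have hmem : w + 2 * Real.pi * Complex.I ∈ Ω ↔ w ∈ Ω := by simp [Ω]
    by_cases hw : w ∈ Ω
    · simp only [v, indicator_of_mem hw, indicator_of_mem (hmem.2 hw), huμ w hw, smul_smul]
      rw [← hα, ← Complex.exp_add]
      ring_nf
    · simp only [v, indicator_of_notMem hw, indicator_of_notMem (mt hmem.1 hw)]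
  let g : ℂ → Plane →L[ℂ] ℂ := fun y ↦ v (Complex.log y)
  have hgv : ∀ w, g (Complex.exp w) = v w := by
    intro w
    obtain ⟨n, hn⟩ := Complex.exp_eq_exp_iff_exists_int.1
      (Complex.exp_log (Complex.exp_ne_zero w))
    simp only [g]
    rw [hn, hv.int_mul n]
  have hΩo : IsOpen Ω := isOpen_lt Complex.continuous_re continuous_const
  have hvd : ∀ w ∈ Ω, HasDerivAt v ((v w) ∘L (a (Complex.exp w)) - α • v w) w := by
    intro w hw
    have h1 : HasDerivAt (fun w ↦ Complex.exp (-(α * w))) (Complex.exp (-(α * w)) * (-α)) w := by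
      have := ((hasDerivAt_id w).const_mul α).neg.cexp
      simpa using this
    have h2 := h1.smul (hu w hw)
    refine (h2.congr_of_eventuallyEq ?_).congr_deriv ?_
    · filter_upwards [hΩo.mem_nhds hw] with w hw using indicator_of_mem hw _
    · simp only [v, indicator_of_mem hw]
      refine ContinuousLinearMap.ext fun v ↦ ?_
      simp
      ring
  have hlogmem : ∀ y ∈ ball (0 : ℂ) R, y ≠ 0 → Complex.log y ∈ Ω := by
    intro y hy hy0
    rw [← hexp, Complex.exp_log hy0]
    exact hy
  have hgd : ∀ y ∈ ball (0 : ℂ) R, y ≠ 0 →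
      HasDerivAt g (y⁻¹ • ((g y) ∘L (a y) - α • g y)) y := by
    intro y hy hy0
    -- A branch of the logarithm near `y`, valid also on the negative axis; by periodicity of `v`
    -- the choice of branch is irrelevant.
    have h1 : HasDerivAt (fun z ↦ Complex.log (z / y) + Complex.log y) y⁻¹ y := by
      have h2 : HasDerivAt (fun z ↦ z / y) y⁻¹ y := by
        simpa using (hasDerivAt_id y).div_const y
      have h3 := (h2.clog (by rw [div_self hy0]; exact Complex.one_mem_slitPlane)).add_const
        (Complex.log y)
      simpa [div_self hy0] using h3
    have h4 := hvd _ (hlogmem y hy hy0)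
    have h5 : Complex.log (y / y) + Complex.log y = Complex.log y := by simp [div_self hy0]
    have h6 := HasDerivAt.scomp (h := fun z ↦ Complex.log (z / y) + Complex.log y) (g₁ := v) y
      (by rw [h5]; exact h4) h1
    rw [Complex.exp_log hy0] at h6
    refine h6.congr_of_eventuallyEq ?_
    filter_upwards [continuousAt_id.eventually_ne hy0] with z hz
    simp only [Function.comp_apply]
    rw [id_eq] at hz
    rw [← hgv, Complex.exp_add, Complex.exp_log hy0, Complex.exp_log (div_ne_zero hz hy0),
      div_mul_cancel₀ _ hy0]
  obtain ⟨r, hr, hrR⟩ : ∃ r, 0 < r ∧ r < R := ⟨R / 2, half_pos hR, half_lt_self hR⟩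
  let w₁ : ℂ := (Real.log r : ℝ)
  have hw₁ : w₁ ∈ Ω := by
    simp only [w₁, Ω, mem_ofPred_eq, Complex.ofReal_re]
    exact Real.log_lt_log hr hrR
  -- Moderate growth: `‖v'‖ ≤ N ‖v‖` on the half-plane, together with `|log y - log r| ≤ log (r /
  -- |y|) + π`, bounds `g` by a constant times `|y| ^ (-N)`.
  obtain ⟨N, hN⟩ := exists_nat_ge (C + ‖α‖)
  obtain ⟨K, hK0, hK⟩ : ∃ K, 0 ≤ K ∧ ∀ y ∈ ball (0 : ℂ) r, y ≠ 0 → ‖y ^ N • g y‖ ≤ K := by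
    refine ⟨‖v w₁‖ * Real.exp (N * Real.pi) * r ^ N, by positivity, fun y hy hy0 ↦ ?_⟩
    have hyR : y ∈ ball (0 : ℂ) R := ball_subset_ball hrR.le hy
    have h1 := norm_le_of_hasDerivAt hΩ (C := N) hvd (fun w hw ↦ by
      refine (norm_sub_le _ _).trans (le_trans ?_
        (mul_le_mul_of_nonneg_right hN (norm_nonneg (v w))))
      rw [add_mul, norm_smul]
      refine add_le_add_left ?_ _
      refine (ContinuousLinearMap.opNorm_comp_le _ _).trans ?_
      rw [mul_comm]
      exact mul_le_mul_of_nonneg_right (hC _ ((hexp w).2 hw)) (norm_nonneg _)) hw₁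
      (hlogmem y hyR hy0)
    have h2 : ‖Complex.log y - w₁‖ ≤ (Real.log r - Real.log ‖y‖) + Real.pi := by
      refine (Complex.norm_le_abs_re_add_abs_im _).trans ?_
      have h3 : (Complex.log y - w₁).re = Real.log ‖y‖ - Real.log r := by
        simp [w₁, Complex.log_re]
      have h4 : (Complex.log y - w₁).im = Complex.arg y := by
        simp [w₁, Complex.log_im]
      rw [h3, h4, abs_of_nonpos]
      · linarith [Complex.abs_arg_le_pi y]
      · have := Real.log_le_log (norm_pos_iff.2 hy0) (mem_ball_zero_iff.1 hy).le
        linarith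
    have hypos : 0 < ‖y‖ := norm_pos_iff.2 hy0
    rw [norm_smul, norm_pow]
    calc ‖y‖ ^ N * ‖g y‖ ≤ ‖y‖ ^ N * (‖v w₁‖ * Real.exp
          (N * ((Real.log r - Real.log ‖y‖) + Real.pi))) := by
            refine mul_le_mul_of_nonneg_left (h1.trans ?_) (by positivity)
            refine mul_le_mul_of_nonneg_left (Real.exp_le_exp.2 ?_) (norm_nonneg _)
            exact mul_le_mul_of_nonneg_left h2 (Nat.cast_nonneg N)
      _ = ‖v w₁‖ * Real.exp (N * Real.pi) * r ^ N := by
            rw [mul_add, Real.exp_add, mul_sub, Real.exp_sub, Real.exp_nat_mul, Real.exp_nat_mul,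
              Real.exp_log hr, Real.exp_log hypos]
            field_simp
  let f : ℂ → Plane →L[ℂ] ℂ := fun y ↦ y ^ N • g y
  have hfd : ∀ y ∈ ball (0 : ℂ) R, y ≠ 0 → HasDerivAt f
      (y ^ N • (y⁻¹ • ((g y) ∘L (a y) - α • g y)) + (N * y ^ (N - 1)) • g y) y := fun y hy hy0 ↦
    (hasDerivAt_pow N y).smul (hgd y hy hy0)
  -- `y ^ N g` is bounded, so its singularity at `0` is removable.
  let G := Function.update f 0 ((𝓝[≠] 0).limUnder f)
  have hG : DifferentiableOn ℂ G (ball 0 r) := by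
    refine Complex.differentiableOn_update_limUnder_of_bddAbove (ball_mem_nhds _ hr) ?_ ?_
    · intro y hy
      exact (hfd y (ball_subset_ball hrR.le hy.1) hy.2).differentiableAt.differentiableWithinAt
    · refine ⟨K, ?_⟩
      rintro _ ⟨y, hy, rfl⟩
      exact hK y hy.1 hy.2
  have hGf : ∀ y, y ≠ 0 → G y = f y := fun y hy ↦ Function.update_of_ne hy _ _
  have hGs : IsLogSolution a (α - N) G := by
    refine ⟨hG.analyticAt (ball_mem_nhds _ hr), ?_⟩
    filter_upwards [ball_mem_nhds (0 : ℂ) hR] with y hy hy0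
    have h1 : G =ᶠ[𝓝 y] f := by
      filter_upwards [continuousAt_id.eventually_ne hy0] with z hz using hGf z hz
    rw [((hfd y hy hy0).congr_of_eventuallyEq h1).deriv, hGf y hy0]
    refine ContinuousLinearMap.ext fun v ↦ ?_
    simp only [_root_.add_apply, _root_.sub_apply, _root_.smul_apply, smul_eq_mul,
      ContinuousLinearMap.comp_apply, f]
    have h3 : y * (N * y ^ (N - 1)) = N * y ^ N := by
      rcases N with _ | m
      · simp
      · simp [pow_succ]
        ring
    field_simp
    linear_combination (g y v) * h3
  have huG : ∀ y ∈ ball (0 : ℂ) R, y ≠ 0 → ∀ w : ℂ, Complex.exp w = y →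
      u w = Complex.exp ((α - N) * w) • G y := by
    rintro y hy hy0 w rfl
    rw [hGf _ hy0]
    simp only [f, hgv, v, indicator_of_mem ((hexp w).1 hy), smul_smul]
    rw [← Complex.exp_nat_mul, ← Complex.exp_add, ← Complex.exp_add,
      show (α - N) * w + (N * w + -(α * w)) = 0 by ring, Complex.exp_zero, one_smul]
  -- Otherwise `u` would vanish at some point, hence identically by uniqueness.
  have hG0 : ¬ ∀ᶠ y in 𝓝 0, G y = 0 := by
    intro h
    obtain ⟨y, hy0, hyR, hy⟩ := ((eventually_mem_nhdsWithin :
        ∀ᶠ y in 𝓝[≠] (0 : ℂ), y ∈ ({0}ᶜ : Set ℂ)).and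
      ((Filter.Eventually.and (isOpen_ball.eventually_mem (mem_ball_self hR)) h).filter_mono
        nhdsWithin_le_nhds)).exists
    have h1 := huG y hyR hy0 (Complex.log y) (Complex.exp_log hy0)
    rw [hy, form_smul_zero] at h1
    exact hu0 (eq_zero_of_hasDerivAt hΩ hu hbound (hlogmem y hyR hy0) h1 hw₀)
  obtain ⟨m, h, hh, hh0, hGh⟩ := hGs.exists_ne_zero hG0
  refine ⟨α - N + m, h, hh, hh0, ?_⟩
  filter_upwards [self_mem_nhdsWithin, nhdsWithin_le_nhds (ball_mem_nhds (0 : ℂ) hR),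
    nhdsWithin_le_nhds hGh] with y hy0 hyR hy w hw
  rw [huG y hyR hy0 w hw, hy, smul_smul, ← hw, ← Complex.exp_nat_mul, ← Complex.exp_add]
  ring_nf

/-- If the exponents agree and the leading coefficients are dependent, another choice of the second
solution gives independent leading coefficients. -/
theorem exists_independent_isLogSolution {a : ℂ → Plane →L[ℂ] Plane} (ha : ContinuousAt a 0)
    {β₀ β₁ : ℂ} {h₀ h₁ : ℂ → Plane →L[ℂ] ℂ} (hh₀ : IsLogSolution a β₀ h₀)
    (hh₁ : IsLogSolution a β₁ h₁) (h₀0 : h₀ 0 ≠ 0) (h₁0 : h₁ 0 ≠ 0)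
    (hind : ∀ k : ℂ, β₀ = β₁ → ¬ ∀ᶠ y in 𝓝 0, h₁ y - k • h₀ y = 0) :
    ∃ (α : Fin 2 → ℂ) (h : Fin 2 → ℂ → Plane →L[ℂ] ℂ), (∀ i, IsLogSolution a (α i) (h i)) ∧
      LinearIndependent ℂ (fun i ↦ h i 0) := by
  by_cases hli : LinearIndependent ℂ ![h₀ 0, h₁ 0]
  · refine ⟨![β₀, β₁], ![h₀, h₁], fun i ↦ by fin_cases i <;> assumption, ?_⟩
    convert hli using 1
    ext i : 1
    fin_cases i <;> rfl
  rw [LinearIndependent.pair_iff' h₀0] at hli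
  push Not at hli
  obtain ⟨k, hk⟩ := hli
  have hk0 : k ≠ 0 := by
    rintro rfl
    exact h₁0 (by rw [← hk, form_zero_smul])
  have e₀ := hh₀.apply_zero ha
  have e₁ := hh₁.apply_zero ha
  -- Proportional leading coefficients are eigenvectors of `a 0` for both exponents.
  have hβ : β₀ = β₁ := by
    rw [← hk] at e₁
    have h1 : (k * (β₀ - β₁)) • h₀ 0 = 0 := by
      refine ContinuousLinearMap.ext fun v ↦ ?_
      have h2 := DFunLike.congr_fun e₀ v
      have h3 := DFunLike.congr_fun e₁ v
      simp only [_root_.smul_apply, smul_eq_mul, ContinuousLinearMap.comp_apply,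
        _root_.zero_apply] at h2 h3 ⊢
      linear_combination h3 - k * h2
    exact sub_eq_zero.1 ((mul_eq_zero.1 (form_smul_eq_zero h1 h₀0)).resolve_left hk0)
  subst hβ
  have hh₂ : IsLogSolution a β₀ (fun y ↦ h₁ y - k • h₀ y) := by
    refine ⟨hh₁.analyticAt.sub (analyticAt_smul analyticAt_const hh₀.analyticAt), ?_⟩
    filter_upwards [hh₀.deriv_eq, hh₁.deriv_eq, hh₀.analyticAt.eventually_analyticAt,
      hh₁.analyticAt.eventually_analyticAt] with y h2 h3 h4 h5 hy0
    have h6 : HasDerivAt (fun y ↦ h₁ y - k • h₀ y) (deriv h₁ y - k • deriv h₀ y) y :=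
      h5.differentiableAt.hasDerivAt.sub (h4.differentiableAt.hasDerivAt.const_smul k)
    rw [h6.deriv]
    refine ContinuousLinearMap.ext fun v ↦ ?_
    have h2 := DFunLike.congr_fun (h2 hy0) v
    have h3 := DFunLike.congr_fun (h3 hy0) v
    simp only [_root_.sub_apply, _root_.smul_apply, smul_eq_mul,
      ContinuousLinearMap.comp_apply] at h2 h3 ⊢
    linear_combination h3 - k * h2
  obtain ⟨m, g, hg, hg0, hgh⟩ := hh₂.exists_ne_zero (hind k rfl)
  -- The subtraction cancels the leading term, so the new exponent `β₀ + m` differs from `β₀`;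
  -- eigenvectors for distinct eigenvalues are independent.
  have hm : (m : ℂ) ≠ 0 := by
    intro hm
    have := hgh.self_of_nhds
    rw [Nat.cast_eq_zero.1 hm, pow_zero, one_smul, ← hk, sub_self] at this
    exact hg0 this.symm
  refine ⟨![β₀, β₀ + m], ![h₀, g], fun i ↦ by fin_cases i <;> assumption, ?_⟩
  have : (fun i : Fin 2 ↦ (![h₀, g] : Fin 2 → ℂ → Plane →L[ℂ] ℂ) i 0) = ![h₀ 0, g 0] := by
    ext i : 1
    fin_cases i <;> rfl
  rw [this, LinearIndependent.pair_iff' h₀0]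
  intro l hl
  have e₂ := hg.apply_zero ha
  have h1 : (m : ℂ) • g 0 = 0 := by
    refine ContinuousLinearMap.ext fun v ↦ ?_
    have h2 := DFunLike.congr_fun e₀ v
    have h3 := DFunLike.congr_fun e₂ v
    rw [← hl] at h3 ⊢
    simp only [_root_.smul_apply, smul_eq_mul, ContinuousLinearMap.comp_apply,
      _root_.zero_apply] at h2 h3 ⊢
    linear_combination l * h2 - h3
  exact hm (form_smul_eq_zero h1 hg0)

end LogSolutions

/-! ### Eigenvectors of a semisimple endomorphism -/

section Semisimple

/-- Over `ℂ` the generalized eigenspaces span, and semisimplicity makes them eigenspaces; a basis is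
extracted from the eigenvectors. -/
theorem exists_eigenbasis {V : Type*} [AddCommGroup V] [Module ℂ V] [FiniteDimensional ℂ V]
    (hV : Module.finrank ℂ V = 2) {M : Module.End ℂ V} (hM : M.IsSemisimple) :
    ∃ (μ : Fin 2 → ℂ) (v : Fin 2 → V), LinearIndependent ℂ v ∧ ∀ i, M (v i) = μ i • v i := by
  let t : Set V := {v | ∃ μ : ℂ, M v = μ • v}
  have ht : Submodule.span ℂ t = ⊤ := by
    rw [eq_top_iff, ← Module.End.iSup_maxGenEigenspace_eq_top M]
    refine iSup_le fun μ v hv ↦ Submodule.subset_span ⟨μ, ?_⟩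
    rw [(hM.isFinitelySemisimple).maxGenEigenspace_eq_eigenspace,
      Module.End.mem_eigenspace_iff] at hv
    exact hv
  obtain ⟨b, hbt, hbs, hb⟩ := exists_linearIndependent ℂ t
  let B : Module.Basis b ℂ V := Module.Basis.mk hb (by simp [hbs, ht])
  have : Fintype b := FiniteDimensional.fintypeBasisIndex B
  have hcard : Fintype.card b = 2 := by rw [← hV, Module.finrank_eq_card_basis B]
  let φ : Fin 2 ≃ b := (Fintype.equivFinOfCardEq hcard).symm
  choose μ hμ using fun i ↦ hbt (φ i).2
  exact ⟨μ, fun i ↦ φ i, hb.comp φ φ.injective, hμ⟩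

theorem finrank_dual_plane : Module.finrank ℂ (Plane →L[ℂ] ℂ) = 2 := by
  rw [← (LinearMap.toContinuousLinearMap (𝕜 := ℂ) (E := Plane) (F' := ℂ)).finrank_eq,
    Module.finrank_linearMap, Module.finrank_prod]
  simp

end Semisimple

/-! ### From semisimple monodromy to a diagonal frame -/

section Monodromy

open Filter Metric

variable {S : Type*} [TopologicalSpace S] [ChartedSpace Plane S] [IsManifold 𝓘(ℂ, Plane) ω S]

/-- The loop need not lie in a small polydisc. The function `y θ(∂y)` extends holomorphically at `y
= 0` by the local description and is holomorphic elsewhere because `θ` is; compactness of the closed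
disc leaves room for a slightly larger one, with a bound. -/
theorem IsLogarithmic.exists_slice {nabla : Connection S} {D : Set S}
    (h : IsLogarithmic nabla D) {e : OpenPartialHomeomorph S Plane} (he : Straightens D e)
    {r : ℝ} (hr : 0 < r) (hre : ∀ y : ℂ, ‖y‖ ≤ r → ((0, y) : Plane) ∈ e.target) :
    ∃ (a : ℂ → Plane →L[ℂ] Plane) (R C : ℝ), r < R ∧ AnalyticOnNhd ℂ a (ball 0 R) ∧
      (∀ y ∈ ball (0 : ℂ) R, ‖a y‖ ≤ C) ∧ ∀ y : ℂ, y ≠ 0 → a y = y • theta nabla e (0, y) (0, 1) := by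
  classical
  have h0 : ((0, 0) : Plane) ∈ e.target := hre 0 (by simpa using hr.le)
  obtain ⟨A, B, ρ, hAB, -⟩ := h.exists_isLogFormOn he h0
  let a : ℂ → Plane →L[ℂ] Plane :=
    fun y ↦ if y = 0 then A (0, 0) else y • theta nabla e (0, y) (0, 1)
  have ha : ∀ y : ℂ, y ≠ 0 → a y = y • theta nabla e (0, y) (0, 1) := fun y hy ↦ if_neg hy
  have han : AnalyticOnNhd ℂ a (closedBall 0 r) := by
    intro y hy
    by_cases hy0 : y = 0
    · subst hy0
      have h1 : AnalyticAt ℂ (fun y : ℂ ↦ A (0, y)) 0 :=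
        AnalyticAt.comp (g := A) (f := fun y : ℂ ↦ ((0, y) : Plane))
          (hAB.analytic_left _ ⟨mem_closedBall_self hAB.pos.le, mem_closedBall_self hAB.pos.le⟩)
          (by fun_prop)
      refine h1.congr ?_
      filter_upwards [closedBall_mem_nhds (0 : ℂ) hAB.pos] with y hy
      by_cases hy0 : y = 0
      · simp [a, hy0]
      · rw [ha y hy0]
        exact (hAB.eq_left (0, y) ⟨mem_closedBall_self hAB.pos.le, hy⟩ hy0).symm
    · have hyt := hre y (by simpa using hy)
      have hyD : e.symm (0, y) ∉ D := by rwa [he.symm_mem_iff hyt]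
      have h1 : AnalyticAt ℂ (fun y : ℂ ↦ theta nabla e (0, y)) y :=
        AnalyticAt.comp (g := theta nabla e) (f := fun y : ℂ ↦ ((0, y) : Plane))
          (h.analyticAt_theta he.isCoordinates hyt hyD) (by fun_prop)
      have h2 : AnalyticAt ℂ (fun y : ℂ ↦ y • theta nabla e (0, y) (0, 1)) y :=
        analyticAt_smul analyticAt_id (analyticAt_clm_apply h1 analyticAt_const)
      refine h2.congr ?_
      filter_upwards [continuousAt_id.eventually_ne hy0] with y hy using (ha y hy).symm
  obtain ⟨δ, hδ, hδa⟩ := (isCompact_closedBall (0 : ℂ) r).exists_cthickening_subset_open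
    (isOpen_analyticAt ℂ a) han
  rw [cthickening_closedBall hδ.le hr.le] at hδa
  have han' : AnalyticOnNhd ℂ a (closedBall 0 (δ + r)) := hδa
  obtain ⟨C, hC⟩ := exists_bound_of_analyticOnNhd (isCompact_closedBall _ _) han'
  exact ⟨a, δ + r, C, by linarith, han'.mono ball_subset_closedBall,
    fun y hy ↦ hC y (ball_subset_closedBall hy), ha⟩

theorem eq_zero_of_norm_deriv_le {E : Type*} [NormedAddCommGroup E] [NormedSpace ℝ E]
    {f f' : ℝ → E} {K : ℝ} (hf : ∀ s, HasDerivAt f (f' s) s) (hK : ∀ s, ‖f' s‖ ≤ K * ‖f s‖)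
    (h0 : f 0 = 0) : f 1 = 0 :=
  eq_zero_of_abs_deriv_le_mul_abs_self_of_eq_zero_right (a := 0) (b := 1)
    (fun s _ ↦ (hf s).continuousAt.continuousWithinAt) (fun s _ ↦ (hf s).hasDerivWithinAt) h0
    (fun s _ ↦ hK s) 1 (by simp)

/-- Parallel transport along a loop around `0`, computed with a solution in the variable
`w = log y`. -/
theorem transport_eq {a : ℂ → Plane →L[ℂ] Plane} {r R C : ℝ} (hr : 0 < r) (hrR : r < R)
    (hC : ∀ y ∈ ball (0 : ℂ) R, ‖a y‖ ≤ C) {u : ℂ → Plane →L[ℂ] ℂ}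
    (hu : ∀ w : ℂ, w.re < Real.log R → HasDerivAt u ((u w) ∘L (a (Complex.exp w))) w)
    {η : ℝ → Plane →L[ℂ] ℂ} (hη : ∀ s : ℝ, HasDerivAt η ((2 * Real.pi * Complex.I : ℂ) •
      ((η s) ∘L (a (r * Complex.exp (2 * Real.pi * Complex.I * s))))) s)
    (h0 : η 0 = u (Real.log r)) : η 1 = u (Real.log r + 2 * Real.pi * Complex.I) := by
  have hexps : ∀ s : ℝ, Complex.exp (Real.log r + 2 * Real.pi * Complex.I * s) =
      r * Complex.exp (2 * Real.pi * Complex.I * s) := by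
    intro s
    rw [Complex.exp_add, ← Complex.ofReal_exp, Real.exp_log hr]
  have hwΩ : ∀ s : ℝ, (Real.log r + 2 * Real.pi * Complex.I * s : ℂ).re < Real.log R := by
    intro s
    simpa using Real.log_lt_log hr hrR
  -- The difference between the transport and the solution read along `w = log r + 2πi s` solves a
  -- homogeneous linear equation and starts at `0`.
  have hf : ∀ s : ℝ, HasDerivAt
      (fun s : ℝ ↦ η s - u (Real.log r + 2 * Real.pi * Complex.I * s))
      ((2 * Real.pi * Complex.I : ℂ) • ((η s - u (Real.log r + 2 * Real.pi * Complex.I * s)) ∘L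
        (a (r * Complex.exp (2 * Real.pi * Complex.I * s))))) s := by
    intro s
    have h1 : HasDerivAt (fun s : ℝ ↦ (Real.log r : ℂ) + 2 * Real.pi * Complex.I * (s : ℂ))
        (2 * Real.pi * Complex.I) s := by
      simpa using (Complex.ofRealCLM.hasDerivAt.const_mul
        (2 * Real.pi * Complex.I : ℂ)).const_add (Real.log r : ℂ)
    have h2 := HasDerivAt.scomp (g₁ := u) s (hu _ (hwΩ s)) h1
    rw [hexps] at h2
    refine ((hη s).sub h2).congr_deriv ?_
    refine ContinuousLinearMap.ext fun v ↦ ?_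
    simp only [_root_.sub_apply, _root_.smul_apply, smul_eq_mul, ContinuousLinearMap.comp_apply]
    ring
  have h1 := eq_zero_of_norm_deriv_le (K := ‖(2 * Real.pi * Complex.I : ℂ)‖ * C) hf (fun s ↦ by
    rw [norm_smul, mul_assoc ‖(2 * Real.pi * Complex.I : ℂ)‖]
    refine mul_le_mul_of_nonneg_left ?_ (norm_nonneg (2 * Real.pi * Complex.I : ℂ))
    refine (ContinuousLinearMap.opNorm_comp_le _ _).trans ?_
    rw [mul_comm]
    refine mul_le_mul_of_nonneg_right (hC _ ?_) (norm_nonneg _)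
    rw [← hexps, mem_ball_zero_iff, Complex.norm_exp, ← Real.lt_log_iff_exp_lt (hr.trans hrR)]
    exact hwΩ s) (by simp [h0])
  simpa using sub_eq_zero.1 h1

/-- Eigenvectors of `M`, continued as solutions in `w = log y`, are multiplied by their eigenvalue
under `w ↦ w + 2πi`: at the base point by definition of the monodromy, then everywhere by
uniqueness. Each is therefore `y ^ β h(y)`, and the resulting frame on the slice extends to a
neighbourhood. -/
theorem IsLogarithmic.isDiagonalAt_of_isMonodromy {nabla : Connection S} {D : Set S}
    (h : IsLogarithmic nabla D) {e : OpenPartialHomeomorph S Plane} (he : Straightens D e)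
    {r : ℝ} (hr : 0 < r) (hre : ∀ y : ℂ, ‖y‖ ≤ r → ((0, y) : Plane) ∈ e.target)
    {M : Module.End ℂ (Plane →L[ℂ] ℂ)} (hM : IsMonodromy nabla e r M) (hMs : M.IsSemisimple) :
    IsDiagonalAt (theta nabla e) (0, 0) := by
  obtain ⟨a, R, C, hrR, ha, hC, haθ⟩ := h.exists_slice he hr hre
  have hR : 0 < R := hr.trans hrR
  let Ω : Set ℂ := {w | w.re < Real.log R}
  have hΩ : Convex ℝ Ω := convex_halfSpace_re_lt _
  have hΩo : IsOpen Ω := isOpen_lt Complex.continuous_re continuous_const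
  have hexp : ∀ w ∈ Ω, Complex.exp w ∈ ball (0 : ℂ) R := by
    intro w hw
    rw [mem_ball_zero_iff, Complex.norm_exp, ← Real.lt_log_iff_exp_lt hR]
    exact hw
  let w₁ : ℂ := (Real.log r : ℝ)
  have hw₁ : w₁ ∈ Ω := by
    simp only [w₁, Ω, mem_ofPred_eq]
    simpa using Real.log_lt_log hr hrR
  have hnorm : ∀ w ∈ Ω, ∀ l : Plane →L[ℂ] ℂ, ‖l ∘L (a (Complex.exp w))‖ ≤ C * ‖l‖ := by
    intro w hw l
    refine (ContinuousLinearMap.opNorm_comp_le _ _).trans ?_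
    rw [mul_comm]
    exact mul_le_mul_of_nonneg_right (hC _ (hexp w hw)) (norm_nonneg _)
  have hex : ∀ c : Plane →L[ℂ] ℂ, ∃ u : ℂ → Plane →L[ℂ] ℂ, u w₁ = c ∧
      ∀ w ∈ Ω, HasDerivAt u ((u w) ∘L (a (Complex.exp w))) w := by
    intro c
    let T : (Plane →L[ℂ] Plane) →L[ℂ] (Plane →L[ℂ] ℂ) →L[ℂ] (Plane →L[ℂ] ℂ) :=
      (ContinuousLinearMap.compL ℂ Plane Plane ℂ).flip
    have hC0 : 0 ≤ C := (norm_nonneg _).trans (hC 0 (mem_ball_self hR))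
    obtain ⟨u, hu, hud, -⟩ := exists_solution_linear hΩ hΩo (a := fun w ↦ T (a (Complex.exp w)))
      (C := C)
      (fun w hw ↦ ContinuousLinearMap.opNorm_le_bound _ hC0 (fun l ↦ hnorm w hw l))
      (fun g hg w hw ↦ by
        have h1 : HasDerivAt (fun w ↦ a (Complex.exp w)) _ w :=
          HasDerivAt.scomp (g₁ := a) w (ha _ (hexp w hw)).differentiableAt.hasDerivAt
            (Complex.hasDerivAt_exp w)
        have h2 := (hg.differentiableAt (hΩo.mem_nhds hw)).hasDerivAt
        exact (h2.clm_comp h1).differentiableAt.differentiableWithinAt) ⊤ isClosed_univ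
      (fun _ _ _ _ ↦ trivial) hw₁ (c := c) trivial
    exact ⟨u, hu, hud⟩
  have huniq : ∀ u : ℂ → Plane →L[ℂ] ℂ,
      (∀ w ∈ Ω, HasDerivAt u ((u w) ∘L (a (Complex.exp w))) w) → ∀ w ∈ Ω, u w = 0 →
      ∀ w' ∈ Ω, u w' = 0 := fun u hu w hw h0 w' hw' ↦
    eq_zero_of_hasDerivAt hΩ hu (fun w hw ↦ hnorm w hw _) hw h0 hw'
  obtain ⟨μ, v, hv, hvμ⟩ := exists_eigenbasis finrank_dual_plane hMs
  choose u hu0 hud using fun i ↦ hex (v i)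
  have hmon : ∀ i, u i (w₁ + 2 * Real.pi * Complex.I) = μ i • u i w₁ := by
    intro i
    obtain ⟨η, hη0, hη1, hηd⟩ := hM (v i)
    have hη : ∀ s : ℝ, HasDerivAt η ((2 * Real.pi * Complex.I : ℂ) •
        ((η s) ∘L (a (r * Complex.exp (2 * Real.pi * Complex.I * s))))) s := by
      intro s
      refine (hηd s).congr_deriv ?_
      have hne : (r * Complex.exp (2 * Real.pi * Complex.I * s) : ℂ) ≠ 0 :=
        mul_ne_zero (Complex.ofReal_ne_zero.2 hr.ne') (Complex.exp_ne_zero _)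
      generalize (r * Complex.exp (2 * Real.pi * Complex.I * s) : ℂ) = y at hne
      generalize (2 * Real.pi * Complex.I : ℂ) = k
      rw [haθ y hne, clm_apply_eq (theta nabla e (0, y)) (0, k * y)]
      refine ContinuousLinearMap.ext fun v ↦ ?_
      simp
      ring
    have h1 := transport_eq hr hrR hC (hud i) hη (by rw [hη0, hu0])
    rw [← h1, hη1, hvμ, hu0]
  have hshift : ∀ w ∈ Ω, w + 2 * Real.pi * Complex.I ∈ Ω := by
    intro w hw
    simpa [Ω] using hw
  have hper : ∀ i, ∀ w ∈ Ω, u i (w + 2 * Real.pi * Complex.I) = μ i • u i w := by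
    intro i w hw
    have h1 := huniq (fun w ↦ u i (w + 2 * Real.pi * Complex.I) - μ i • u i w)
      (fun w hw ↦ by
        have h2 := hud i _ (hshift w hw)
        rw [Complex.exp_periodic w] at h2
        refine ((h2.comp_add_const w _).sub ((hud i w hw).const_smul (μ i))).congr_deriv ?_
        refine ContinuousLinearMap.ext fun v ↦ ?_
        simp) w₁ hw₁ (sub_eq_zero.2 (hmon i)) w hw
    exact sub_eq_zero.1 h1
  have hu1 : ∀ i, u i w₁ ≠ 0 := fun i ↦ by
    rw [hu0]
    exact hv.ne_zero i
  -- A zero eigenvalue would make a nonzero solution vanish after one turn.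
  have hμ : ∀ i, μ i ≠ 0 := by
    intro i hμ
    have h1 := hmon i
    rw [hμ, form_zero_smul] at h1
    exact hu1 i (huniq _ (hud i) _ (hshift w₁ hw₁) h1 w₁ hw₁)
  choose β g hg hg0 hug using fun i ↦ exists_isLogSolution hR hC (hud i) (hμ i) (hper i) hw₁ (hu1 i)
  obtain ⟨α, c, hc, hli⟩ := exists_independent_isLogSolution
    (ha 0 (mem_ball_self hR)).continuousAt (hg 0) (hg 1) (hg0 0) (hg0 1) (by
      -- Equal exponents and `g 1 = k g 0` would give `u 1 = k u 0`, against the independence of the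
      -- eigenvectors.
      intro k hβ hk
      have hev : ∀ᶠ y in 𝓝[≠] (0 : ℂ), y ≠ 0 ∧ y ∈ ball (0 : ℂ) R ∧ g 1 y - k • g 0 y = 0 ∧
          (∀ w : ℂ, Complex.exp w = y → u 0 w = Complex.exp (β 0 * w) • g 0 y) ∧
          ∀ w : ℂ, Complex.exp w = y → u 1 w = Complex.exp (β 1 * w) • g 1 y := by
        filter_upwards [self_mem_nhdsWithin, nhdsWithin_le_nhds (ball_mem_nhds (0 : ℂ) hR),
          nhdsWithin_le_nhds hk, hug 0, hug 1] with y h1 h2 h3 h4 h5 using ⟨h1, h2, h3, h4, h5⟩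
      obtain ⟨y, hy0, hyR, hky, hug0, hug1⟩ := hev.exists
      have hy : Complex.exp (Complex.log y) = y := Complex.exp_log hy0
      have hmem : Complex.log y ∈ Ω := by
        rw [mem_ball_zero_iff] at hyR
        simp only [Ω, mem_ofPred_eq, Complex.log_re]
        exact Real.log_lt_log (norm_pos_iff.2 hy0) hyR
      have h1 := huniq (fun w ↦ u 1 w - k • u 0 w) (fun w hw ↦ by
        refine ((hud 1 w hw).sub ((hud 0 w hw).const_smul k)).congr_deriv ?_
        refine ContinuousLinearMap.ext fun v ↦ ?_
        simp) _ hmem (by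
          rw [hug0 _ hy, hug1 _ hy, hβ, sub_eq_zero.1 hky, smul_comm, sub_self]) w₁ hw₁
      simp only [hu0] at h1
      have h2 := Fintype.linearIndependent_iff.1 hv ![-k, 1] (by
        refine ContinuousLinearMap.ext fun w ↦ ?_
        have h3 := DFunLike.congr_fun h1 w
        simp only [_root_.sub_apply, _root_.smul_apply, smul_eq_mul, _root_.zero_apply] at h3
        simp [Fin.sum_univ_two]
        linear_combination h3) 1
      simp at h2)
  obtain ⟨A, B, ρ, hAB, -⟩ := h.exists_isLogFormOn he (hre 0 (by simpa using hr.le))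
  refine hAB.isDiagonalAt (mem_ball_self hAB.pos) (α := α) (fun i ↦ (hc i).analyticAt) (fun i ↦ ?_) hli
    (mem_ball_self hAB.pos)
  filter_upwards [(hc i).deriv_eq, closedBall_mem_nhds (0 : ℂ) hAB.pos] with y hy hyρ hy0
  rw [hy hy0, haθ y hy0, ← hAB.eq_left (0, y) ⟨mem_closedBall_self hAB.pos.le, hyρ⟩ hy0]

theorem HasSemisimpleMonodromy.exists_isDiagonalNear {nabla : Connection S} {D D₀ : Set S}
    (h : IsLogarithmic nabla D) (hmon : HasSemisimpleMonodromy nabla D D₀) :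
    ∃ p ∈ D₀ ∩ regularLocus D, IsDiagonalNear nabla D p := by
  obtain ⟨p, hp, e, r, M, he, hr, hre, hM, hMs⟩ := hmon
  refine ⟨p, ⟨hp, e, he⟩, e, he.straightens, he.mem_source, ?_⟩
  rw [he.centred]
  exact h.isDiagonalAt_of_isMonodromy he.straightens hr hre hM hMs

end Monodromy

/-! ### The Euler equation and its resonances -/

section Euler

open Filter Metric MeasureTheory

/-- The solution is `w y = ∫₀¹ t ^ α k(t y) dt`; the equation results from integrating the
derivative of `t ^ (α + 1) k(t y)` over `[0, 1]`. Positivity of the real part makes `t ^ α`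
continuous at `0`. -/
theorem exists_euler_of_re_pos {α : ℂ} (hα : 0 < α.re) {k : ℂ → ℂ} (hk : AnalyticAt ℂ k 0) :
    ∃ w : ℂ → ℂ, AnalyticAt ℂ w 0 ∧ ∀ᶠ y in 𝓝 (0 : ℂ), (α + 1) * w y + y * deriv w y = k y := by
  obtain ⟨r, hr, hrU⟩ := Metric.nhds_basis_closedBall.mem_iff.1 hk.eventually_analyticAt
  have hkd : AnalyticOnNhd ℂ k (closedBall 0 r) := fun y hy ↦ hrU hy
  obtain ⟨C, hC⟩ := exists_bound_of_analyticOnNhd (isCompact_closedBall _ _) hkd.deriv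
  have hmem : ∀ t ∈ Icc (0 : ℝ) 1, ∀ y ∈ ball (0 : ℂ) r, (t : ℂ) * y ∈ ball (0 : ℂ) r := by
    intro t ht y hy
    rw [mem_ball_zero_iff] at hy ⊢
    rw [norm_mul, Complex.norm_real, Real.norm_of_nonneg ht.1]
    exact (mul_le_of_le_one_left (norm_nonneg _) ht.2).trans_lt hy
  have hsub : uIoc (0 : ℝ) 1 ⊆ Icc 0 1 := by
    rw [uIoc_of_le zero_le_one]
    exact Ioc_subset_Icc_self
  have hcont : ∀ (l : ℂ → ℂ), AnalyticOnNhd ℂ l (closedBall 0 r) → ∀ y ∈ ball (0 : ℂ) r,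
      ContinuousOn (fun t : ℝ ↦ l (t * y)) (uIcc 0 1) := by
    intro l hl y hy t ht
    rw [uIcc_of_le zero_le_one] at ht
    refine ContinuousAt.continuousWithinAt ?_
    exact ContinuousAt.comp (g := l) (hl _ (ball_subset_closedBall (hmem t ht y hy))).continuousAt
      (by fun_prop)
  have hcpow : ContinuousOn (fun t : ℝ ↦ (t : ℂ) ^ α) (uIcc 0 1) :=
    (Complex.continuous_ofReal_cpow_const hα).continuousOn
  have hint1 : ∀ y ∈ ball (0 : ℂ) r, IntervalIntegrable (fun t : ℝ ↦ (t : ℂ) ^ α * k (t * y))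
      volume 0 1 := fun y hy ↦ (hcpow.mul (hcont k hkd y hy)).intervalIntegrable
  have hint2 : ∀ y ∈ ball (0 : ℂ) r, IntervalIntegrable
      (fun t : ℝ ↦ (t : ℂ) ^ α * (deriv k (t * y) * t)) volume 0 1 := fun y hy ↦
    (hcpow.mul ((hcont _ hkd.deriv y hy).mul
      Complex.continuous_ofReal.continuousOn)).intervalIntegrable
  let w : ℂ → ℂ := fun y ↦ ∫ t in (0 : ℝ)..1, (t : ℂ) ^ α * k (t * y)
  have hw : ∀ y ∈ ball (0 : ℂ) r,
      HasDerivAt w (∫ t in (0 : ℝ)..1, (t : ℂ) ^ α * (deriv k (t * y) * t)) y := by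
    intro y hy
    refine (intervalIntegral.hasDerivAt_integral_of_dominated_loc_of_deriv_le
      (F := fun y (t : ℝ) ↦ (t : ℂ) ^ α * k (t * y))
      (F' := fun y (t : ℝ) ↦ (t : ℂ) ^ α * (deriv k (t * y) * t))
      (bound := fun _ ↦ C) (isOpen_ball.mem_nhds hy) ?_ (hint1 y hy) ?_ ?_ (by simp) ?_).2
    · filter_upwards [isOpen_ball.mem_nhds hy] with y hy
      exact (intervalIntegrable_iff.1 (hint1 y hy)).aestronglyMeasurable
    · exact (intervalIntegrable_iff.1 (hint2 y hy)).aestronglyMeasurable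
    · refine Eventually.of_forall fun t ht y hy ↦ ?_
      have ht' := hsub ht
      rw [uIoc_of_le zero_le_one] at ht
      rw [norm_mul, norm_mul, Complex.norm_cpow_eq_rpow_re_of_pos ht.1, Complex.norm_real,
        Real.norm_of_nonneg ht'.1]
      have h1 := hC _ (ball_subset_closedBall (hmem t ht' y hy))
      have h2 : t ^ α.re ≤ 1 := Real.rpow_le_one ht'.1 ht'.2 hα.le
      have h3 : ‖deriv k (t * y)‖ * t ≤ C * 1 :=
        mul_le_mul h1 ht'.2 ht'.1 ((norm_nonneg _).trans h1)
      calc t ^ α.re * (‖deriv k (t * y)‖ * t) ≤ 1 * (‖deriv k (t * y)‖ * t) :=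
            mul_le_mul_of_nonneg_right h2 (mul_nonneg (norm_nonneg _) ht'.1)
        _ ≤ C := by linarith
    · refine Eventually.of_forall fun t ht y hy ↦ ?_
      have h1 : HasDerivAt (fun y : ℂ ↦ (t : ℂ) * y) t y := by
        simpa using (hasDerivAt_id y).const_mul (t : ℂ)
      exact (HasDerivAt.comp (h₂ := k) y
        (hkd _ (ball_subset_closedBall (hmem t (hsub ht) y hy))).differentiableAt.hasDerivAt
        h1).const_mul _
  refine ⟨w, ?_, ?_⟩
  · exact DifferentiableOn.analyticAt (s := ball 0 r)
      (fun y hy ↦ (hw y hy).differentiableAt.differentiableWithinAt) (ball_mem_nhds _ hr)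
  filter_upwards [ball_mem_nhds (0 : ℂ) hr] with y hy
  rw [(hw y hy).deriv]
  have hα1 : α + 1 ≠ 0 := by
    intro h
    have := congrArg Complex.re h
    simp at this
    linarith
  have hα0 : α ≠ 0 := by
    rintro rfl
    simp at hα
  have h1 : ∀ t ∈ Ioo (0 : ℝ) 1, HasDerivAt (fun t : ℝ ↦ (t : ℂ) ^ (α + 1) * k (t * y))
      ((α + 1) * ((t : ℂ) ^ α * k (t * y)) + y * ((t : ℂ) ^ α * (deriv k (t * y) * t))) t := by
    intro t ht₀
    have ht := Ioo_subset_Icc_self ht₀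
    have h2 : HasDerivAt (fun t : ℝ ↦ (t : ℂ) * y) y t := by
      simpa using (Complex.ofRealCLM.hasDerivAt (x := t)).mul_const y
    have h3 := HasDerivAt.comp (h₂ := k) t
      (hkd _ (ball_subset_closedBall (hmem t ht y hy))).differentiableAt.hasDerivAt h2
    have h4 : HasDerivAt (fun t : ℝ ↦ (t : ℂ) ^ (α + 1)) ((α + 1) * (t : ℂ) ^ α) t := by
      simpa using hasDerivAt_ofReal_cpow_const ht₀.1.ne' hα1
    refine (h4.mul h3).congr_deriv ?_
    have h5 : (t : ℂ) ^ (α + 1) = (t : ℂ) ^ α * t := by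
      by_cases ht0 : (t : ℂ) = 0
      · simp [ht0, hα1]
      · rw [Complex.cpow_add _ _ ht0, Complex.cpow_one]
    simp only [Function.comp_apply]
    rw [h5]
    ring
  have h6 := intervalIntegral.integral_eq_sub_of_hasDerivAt_of_le zero_le_one
    (((Complex.continuous_ofReal_cpow_const (by simp; linarith)).continuousOn.mul
      (by simpa using hcont k hkd y hy))) h1
    (((hint1 y hy).const_mul _).add ((hint2 y hy).const_mul _))
  rw [intervalIntegral.integral_add ((hint1 y hy).const_mul _) ((hint2 y hy).const_mul _),
    intervalIntegral.integral_const_mul, intervalIntegral.integral_const_mul] at h6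
  simpa [hα1] using h6

/-- The Euler equation `(α + 1) w + y w' = k`, up to a resonant monomial. -/
theorem exists_euler (α : ℂ) {k : ℂ → ℂ} (hk : AnalyticAt ℂ k 0) :
    ∃ (w : ℂ → ℂ) (ρ : ℂ) (m : ℕ), AnalyticAt ℂ w 0 ∧ (ρ ≠ 0 → α + 1 + m = 0) ∧
      ∀ᶠ y in 𝓝 (0 : ℂ), (α + 1) * w y + y * deriv w y + ρ * y ^ m = k y := by
  obtain ⟨N, hN⟩ := exists_nat_gt (-α.re)
  have hN' : 0 < α.re + N := by linarith
  clear hN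
  -- Removing the constant term of `k` and dividing by `y` replaces `α` by `α + 1`, until the real
  -- part is positive.
  induction N generalizing α k with
  | zero =>
    obtain ⟨w, hw, hwk⟩ := exists_euler_of_re_pos (by simpa using hN') hk
    exact ⟨w, 0, 0, hw, by simp, by simpa using hwk⟩
  | succ N ih =>
    obtain ⟨l, hl, hlk⟩ : ∃ l : ℂ → ℂ, AnalyticAt ℂ l 0 ∧ ∀ᶠ y in 𝓝 0, k y = k 0 + y * l y := by
      have h1 : AnalyticAt ℂ (fun z : ℂ × ℂ ↦ k z.2 - k 0) (0, 0) :=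
        (AnalyticAt.comp (g := k) (f := Prod.snd) hk analyticAt_snd).sub analyticAt_const
      obtain ⟨g, hg, hgk⟩ := exists_analyticAt_snd_smul h1 (by simp)
      refine ⟨fun y ↦ g (0, y), AnalyticAt.comp (g := g) (f := fun y : ℂ ↦ ((0, y) : ℂ × ℂ)) hg
        (by fun_prop), ?_⟩
      have hc : ContinuousAt (fun y : ℂ ↦ ((0, y) : ℂ × ℂ)) 0 := by fun_prop
      filter_upwards [hc.eventually hgk] with y hy
      simp only [smul_eq_mul] at hy
      rw [← hy]
      ring
    obtain ⟨v, ρ, m, hv, hρ, hvl⟩ := ih (α + 1) hl (by push_cast at hN' ⊢; simp; linarith)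
    -- If `α + 1 = 0` the constant term cannot be reached and becomes the resonant monomial. No
    -- second resonance occurs, as its condition would read `1 + m = 0`.
    by_cases hα : α + 1 = 0
    · have hρ0 : ρ = 0 := by
        by_contra h
        have := hρ h
        rw [hα, zero_add] at this
        norm_cast at this
        omega
      refine ⟨fun y ↦ y * v y, k 0, 0, analyticAt_id.mul hv, by simp [hα], ?_⟩
      filter_upwards [hlk, hvl, hv.eventually_analyticAt] with y hy hy' hva
      have h1 : HasDerivAt (fun y ↦ y * v y) (1 * v y + y * deriv v y) y :=
        (hasDerivAt_id y).mul hva.differentiableAt.hasDerivAt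
      rw [h1.deriv, hy, ← hy', hρ0, hα]
      simp
      ring
    · refine ⟨fun y ↦ k 0 / (α + 1) + y * v y, ρ, m + 1,
        analyticAt_const.add (analyticAt_id.mul hv), fun h ↦ by
          push_cast
          rw [← hρ h]
          ring, ?_⟩
      filter_upwards [hlk, hvl, hv.eventually_analyticAt] with y hy hy' hva
      have h1 : HasDerivAt (fun y ↦ k 0 / (α + 1) + y * v y) (1 * v y + y * deriv v y) y :=
        ((hasDerivAt_id y).mul hva.differentiableAt.hasDerivAt).const_add _
      rw [h1.deriv, hy, ← hy']
      field_simp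
      ring

end Euler

/-! ### Primitives in the direction of `x`, and identities off `y = 0` -/

section Primitives

open Filter Metric

/-- A holomorphic function of two variables has a primitive in the direction of `x`, with given
restriction to `x = 0`. -/
theorem exists_primitive_fst {p : Plane → ℂ} (hp : AnalyticAt ℂ p (0, 0)) {w : ℂ → ℂ}
    (hw : AnalyticAt ℂ w 0) : ∃ W : Plane → ℂ, AnalyticAt ℂ W (0, 0) ∧
      (∀ᶠ y in 𝓝 (0 : ℂ), W (0, y) = w y) ∧ ∀ᶠ z in 𝓝 ((0, 0) : Plane), fderiv ℂ W z (1, 0) = p z := by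
  obtain ⟨r, hr, hrU⟩ := Metric.nhds_basis_closedBall.mem_iff.1 hp.eventually_analyticAt
  obtain ⟨δ₀, hδ₀, hδ₀U⟩ := Metric.nhds_basis_closedBall.mem_iff.1 hw.eventually_analyticAt
  rw [← closedBall_prod_same] at hrU
  set δ := min r δ₀
  have hδ : 0 < δ := lt_min hr hδ₀
  -- The inhomogeneous equation `∂x W = p` becomes the linear system `∂x (W, c) = (p c, 0)` with `c
  -- = 1` initially.
  let T : Plane →L[ℂ] Plane :=
    (ContinuousLinearMap.inl ℂ ℂ ℂ) ∘L (ContinuousLinearMap.snd ℂ ℂ ℂ)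
  have hB : AnalyticOnNhd ℂ (fun z ↦ p z • T) (closedBall (0 : ℂ) r ×ˢ closedBall (0 : ℂ) δ) :=
    fun z hz ↦ analyticAt_smul (hrU (Set.prod_mono subset_rfl
      (closedBall_subset_closedBall (min_le_left _ _)) hz)) analyticAt_const
  obtain ⟨C, hC⟩ := exists_bound_of_analyticOnNhd
    ((isCompact_closedBall (0 : ℂ) r).prod (isCompact_closedBall (0 : ℂ) δ)) hB
  obtain ⟨u, hu, hu0, hud⟩ := exists_solution_parametric (V := Plane) (convex_ball (0 : ℂ) r)
    isOpen_ball (y₀ := 0) (δ := δ) (hB.mono (Set.prod_mono ball_subset_closedBall subset_rfl))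
    (fun z hz ↦ hC z (Set.prod_mono ball_subset_closedBall subset_rfl hz)) (mem_ball_self hr)
    (c := fun y ↦ (w y, 1)) (fun y hy ↦ (hδ₀U (closedBall_subset_closedBall (min_le_right _ _)
      hy)).prod analyticAt_const)
  have hopen : IsOpen (ball (0 : ℂ) r ×ˢ ball (0 : ℂ) δ) := isOpen_ball.prod isOpen_ball
  have h0 : ((0, 0) : Plane) ∈ ball (0 : ℂ) r ×ˢ ball (0 : ℂ) δ :=
    ⟨mem_ball_self hr, mem_ball_self hδ⟩
  have hu2 : ∀ z ∈ ball (0 : ℂ) r ×ˢ ball (0 : ℂ) δ, (u z).2 = 1 := by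
    rintro ⟨x, y⟩ ⟨hx, hy⟩
    have h1 := eq_zero_of_hasDerivAt (convex_ball (0 : ℂ) r) (C := 0)
      (u := fun x ↦ (u (x, y)).2 - 1) (u' := fun _ ↦ 0) (fun x hx ↦ by
        have h2 := hud (x, y) ⟨hx, hy⟩
        have h3 := (ContinuousLinearMap.snd ℂ ℂ ℂ).hasFDerivAt.comp_hasDerivAt x h2
        simpa [T] using h3.sub_const 1) (by simp) (mem_ball_self hr)
        (by rw [hu0 y hy, sub_self]) hx
    exact sub_eq_zero.1 h1
  refine ⟨fun z ↦ (u z).1, AnalyticAt.comp (g := Prod.fst) (f := u) analyticAt_fst (hu _ h0), ?_, ?_⟩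
  · filter_upwards [ball_mem_nhds (0 : ℂ) hδ] with y hy
    rw [hu0 y hy]
  · filter_upwards [hopen.mem_nhds h0] with z hz
    have h1 : HasDerivAt (fun x : ℂ ↦ ((x, z.2) : Plane)) (1, 0) z.1 :=
      (hasDerivAt_id z.1).prodMk (hasDerivAt_const _ _)
    have h2 : HasFDerivAt (fun z ↦ (u z).1) _ z :=
      (hasFDerivAt_fst (𝕜 := ℂ)).comp z (hu z hz).differentiableAt.hasFDerivAt
    have h3 := HasFDerivAt.comp_hasDerivAt (l := fun z ↦ (u z).1) z.1 h2 h1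
    have h4 := (ContinuousLinearMap.fst ℂ ℂ ℂ).hasFDerivAt.comp_hasDerivAt z.1 (hud z hz)
    rw [h2.fderiv]
    refine (h3.unique h4).trans ?_
    simp [T, hu2 z hz]

theorem eventually_eq_zero_of_fderiv_fst {E : Plane → ℂ} (hE : AnalyticAt ℂ E (0, 0))
    (h1 : ∀ᶠ z in 𝓝 ((0, 0) : Plane), fderiv ℂ E z (1, 0) = 0)
    (h2 : ∀ᶠ y in 𝓝 (0 : ℂ), E (0, y) = 0) : ∀ᶠ z in 𝓝 ((0, 0) : Plane), E z = 0 := by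
  obtain ⟨r, hr, hrU⟩ := Metric.nhds_basis_ball.mem_iff.1 (hE.eventually_analyticAt.and h1)
  rw [← ball_prod_same] at hrU
  filter_upwards [prod_mem_nhds (ball_mem_nhds (0 : ℂ) hr) (inter_mem (ball_mem_nhds (0 : ℂ) hr) h2)]
    with ⟨x, y⟩ ⟨hx, hy, hy0⟩
  refine eq_zero_of_hasDerivAt (convex_ball (0 : ℂ) r) (C := 0)
      (u := fun x ↦ E (x, y)) (u' := fun _ ↦ 0) (fun x hx ↦ ?_) (by simp) (mem_ball_self hr) hy0 hx
  have h3 : HasDerivAt (fun x : ℂ ↦ ((x, y) : Plane)) (1, 0) x :=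
    (hasDerivAt_id x).prodMk (hasDerivAt_const _ _)
  have h4 := hrU (show ((x, y) : Plane) ∈ _ from ⟨hx, hy⟩)
  have h5 := HasFDerivAt.comp_hasDerivAt (l := E) x h4.1.differentiableAt.hasFDerivAt h3
  rw [h4.2] at h5
  exact h5

/-- An identity between analytic functions that holds outside `y = 0` holds everywhere. -/
theorem eventually_eq_zero_of_snd_ne_zero {F : Type*} [NormedAddCommGroup F] [NormedSpace ℂ F]
    [CompleteSpace F] {f : Plane → F} {z₀ : Plane} (hf : AnalyticAt ℂ f z₀)
    (h : ∀ᶠ z in 𝓝 z₀, z.2 ≠ 0 → f z = 0) :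
    ∀ᶠ z in 𝓝 z₀, f z = 0 := by
  filter_upwards [hf.eventually_analyticAt, h.eventually_nhds] with z hz hev
  by_contra hne
  have h1 : ∀ᶠ w in 𝓝 z, w.2 = 0 := by
    filter_upwards [hz.continuousAt.eventually_ne hne, hev] with w hw hw'
    by_contra h2
    exact hw (hw' h2)
  have hc : ContinuousAt (fun t : ℂ ↦ ((z.1, t) : Plane)) z.2 := by fun_prop
  have h2 : ∀ᶠ t in 𝓝 z.2, t = 0 := hc.eventually (p := fun w : Plane ↦ w.2 = 0) h1
  have h3 : ∀ᶠ t in 𝓝[≠] z.2, t ≠ 0 := by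
    by_cases hz2 : z.2 = 0
    · rw [hz2]
      exact self_mem_nhdsWithin
    · exact nhdsWithin_le_nhds (continuousAt_id.eventually_ne hz2)
  obtain ⟨t, ht, ht'⟩ := ((h2.filter_mono nhdsWithin_le_nhds).and h3).exists
  exact ht' ht

end Primitives

/-! ### Potentials of closed and logarithmically closed forms -/

section Potentials

open Filter Metric

theorem fderiv_clm_apply_const {X F G : Type*} [NormedAddCommGroup X] [NormedSpace ℂ X]
    [NormedAddCommGroup F] [NormedSpace ℂ F] [NormedAddCommGroup G] [NormedSpace ℂ G]
    {η : X → F →L[ℂ] G} {z : X} (hη : DifferentiableAt ℂ η z) (u : X) (v : F) :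
    fderiv ℂ (fun z ↦ η z v) z u = fderiv ℂ η z u v := by
  rw [(hη.hasFDerivAt.clm_apply (hasFDerivAt_const v z)).fderiv]
  simp

theorem eventually_fderiv_mixed {X p : Plane → ℂ} {z₀ : Plane} (hX : AnalyticAt ℂ X z₀)
    (hp : ∀ᶠ z in 𝓝 z₀, fderiv ℂ X z (1, 0) = p z) :
    ∀ᶠ z in 𝓝 z₀, fderiv ℂ (fun z ↦ fderiv ℂ X z (0, 1)) z (1, 0) = fderiv ℂ p z (0, 1) := by
  filter_upwards [hX.eventually_analyticAt, hp.eventually_nhds] with z hz hpz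
  have h1 : p =ᶠ[𝓝 z] fun z ↦ fderiv ℂ X z (1, 0) := by
    filter_upwards [hpz] with w hw using hw.symm
  rw [h1.fderiv_eq, fderiv_clm_apply_const hz.fderiv.differentiableAt,
    fderiv_clm_apply_const hz.fderiv.differentiableAt,
    ((hz.contDiffAt (n := ω)).isSymmSndFDerivAt (by simp))]

theorem eventually_fderiv_slice {X : Plane → ℂ} {w : ℂ → ℂ} (hX : AnalyticAt ℂ X (0, 0))
    (hw : ∀ᶠ y in 𝓝 (0 : ℂ), X (0, y) = w y) :
    ∀ᶠ y in 𝓝 (0 : ℂ), fderiv ℂ X (0, y) (0, 1) = deriv w y := by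
  have hc : ContinuousAt (fun y : ℂ ↦ ((0, y) : Plane)) 0 := by fun_prop
  filter_upwards [hc.eventually hX.eventually_analyticAt, hw.eventually_nhds] with y hy hwy
  have h1 : w =ᶠ[𝓝 y] X ∘ fun y ↦ (0, y) := by
    filter_upwards [hwy] with t ht using ht.symm
  have h2 : HasDerivAt (fun y : ℂ ↦ ((0, y) : Plane)) (0, 1) y :=
    (hasDerivAt_const _ _).prodMk (hasDerivAt_id y)
  rw [h1.deriv_eq]
  exact (HasFDerivAt.comp_hasDerivAt (l := X) y hy.differentiableAt.hasFDerivAt h2).deriv.symm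

theorem analyticAt_slice {F : Type*} [NormedAddCommGroup F] [NormedSpace ℂ F] {f : Plane → F}
    (hf : AnalyticAt ℂ f (0, 0)) : AnalyticAt ℂ (fun y : ℂ ↦ f (0, y)) 0 :=
  AnalyticAt.comp (g := f) (f := fun y : ℂ ↦ ((0, y) : Plane)) hf (by fun_prop)

/-- By symmetry of `Θ`, antisymmetrizing the equation leaves only the contribution of `y ^ α`. The
conclusion is the closedness of `y ^ α η`, written without multivalued functions so that it makes
sense on `y = 0` too. -/
theorem IsLogHorizontalAt.eventually_closed {Θ : Plane → Plane →L[ℂ] Plane →L[ℂ] Plane} {α : ℂ}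
    {η : Plane → Plane →L[ℂ] ℂ} {z₀ : Plane} (hη : IsLogHorizontalAt Θ α η z₀)
    (hΘ : ∀ᶠ z in 𝓝 z₀, z.2 ≠ 0 → ∀ u v : Plane, Θ z u v = Θ z v u) :
    ∀ᶠ z in 𝓝 z₀, z.2 * (fderiv ℂ η z (1, 0) (0, 1) - fderiv ℂ η z (0, 1) (1, 0)) =
      α * η z (1, 0) := by
  have han : AnalyticAt ℂ (fun z ↦ z.2 * (fderiv ℂ η z (1, 0) (0, 1) -
      fderiv ℂ η z (0, 1) (1, 0)) - α * η z (1, 0)) z₀ := by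
    have h1 := analyticAt_clm_apply (analyticAt_clm_apply hη.analyticAt.fderiv
      (analyticAt_const (v := ((1, 0) : Plane)))) (analyticAt_const (v := ((0, 1) : Plane)))
    have h2 := analyticAt_clm_apply (analyticAt_clm_apply hη.analyticAt.fderiv
      (analyticAt_const (v := ((0, 1) : Plane)))) (analyticAt_const (v := ((1, 0) : Plane)))
    have h3 := analyticAt_clm_apply hη.analyticAt (analyticAt_const (v := ((1, 0) : Plane)))
    exact (analyticAt_snd.mul (h1.sub h2)).sub (analyticAt_const.mul h3)
  have h := eventually_eq_zero_of_snd_ne_zero han (by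
    filter_upwards [hη.fderiv_eq, hΘ] with z hz hzs hz2
    rw [hz hz2, hz hz2]
    simp only [_root_.sub_apply, _root_.smul_apply, ContinuousLinearMap.comp_apply, smul_eq_mul]
    rw [hzs hz2 (1, 0) (0, 1)]
    field_simp
    ring)
  filter_upwards [h] with z hz using sub_eq_zero.1 hz

/-- A closed holomorphic `1`-form is locally exact. -/
theorem exists_potential {η : Plane → Plane →L[ℂ] ℂ} (hη : AnalyticAt ℂ η (0, 0))
    (hcl : ∀ᶠ z in 𝓝 ((0, 0) : Plane), fderiv ℂ η z (1, 0) (0, 1) = fderiv ℂ η z (0, 1) (1, 0)) :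
    ∃ X : Plane → ℂ, AnalyticAt ℂ X (0, 0) ∧ X (0, 0) = 0 ∧
      ∀ᶠ z in 𝓝 ((0, 0) : Plane), fderiv ℂ X z = η z := by
  have hp := analyticAt_clm_apply hη (analyticAt_const (v := ((1, 0) : Plane)))
  have hq := analyticAt_clm_apply hη (analyticAt_const (v := ((0, 1) : Plane)))
  obtain ⟨r, hr, hrU⟩ := Metric.nhds_basis_ball.mem_iff.1 (analyticAt_slice hq).eventually_analyticAt
  obtain ⟨w, hw0, hw⟩ := exists_primitive_eq_zero (convex_ball (0 : ℂ) r) isOpen_ball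
    (fun y hy ↦ (AnalyticAt.differentiableAt (hrU hy)).differentiableWithinAt) 0
  have hwa : AnalyticAt ℂ w 0 := DifferentiableOn.analyticAt (s := ball 0 r)
    (fun y hy ↦ (hw y hy).differentiableAt.differentiableWithinAt) (ball_mem_nhds _ hr)
  obtain ⟨X, hX, hXw, hXp⟩ := exists_primitive_fst hp hwa
  refine ⟨X, hX, by rw [hXw.self_of_nhds, hw0], ?_⟩
  have hXd := analyticAt_clm_apply hX.fderiv (analyticAt_const (v := ((0, 1) : Plane)))
  -- `∂y X` and `η(∂y)` agree on `x = 0` and, `η` being closed, have the same derivative in `x`.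
  have hE := eventually_eq_zero_of_fderiv_fst (hXd.sub hq) (by
    filter_upwards [hXd.eventually_analyticAt, hη.eventually_analyticAt, hq.eventually_analyticAt,
      eventually_fderiv_mixed hX hXp, hcl] with z h1 h2 h3 h4 h5
    have h6 : HasFDerivAt (fun z ↦ fderiv ℂ X z (0, 1) - η z (0, 1)) _ z :=
      h1.differentiableAt.hasFDerivAt.sub h3.differentiableAt.hasFDerivAt
    have h7 : fderiv ℂ ((fun z ↦ fderiv ℂ X z (0, 1)) - fun z ↦ η z (0, 1)) z = _ := h6.fderiv
    rw [h7, _root_.sub_apply, h4, fderiv_clm_apply_const h2.differentiableAt,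
      fderiv_clm_apply_const h2.differentiableAt, h5, sub_self]) (by
    filter_upwards [eventually_fderiv_slice hX hXw, ball_mem_nhds (0 : ℂ) hr] with y h1 hy
    simp only [Pi.sub_apply]
    rw [h1, (hw y hy).deriv, sub_self])
  filter_upwards [hE, hXp] with z h1 h2
  refine ContinuousLinearMap.ext fun v ↦ ?_
  have h3 : fderiv ℂ X z (0, 1) = η z (0, 1) := sub_eq_zero.1 h1
  rw [clm_apply_eq (fderiv ℂ X z), clm_apply_eq (η z), h2, h3]

/-- A form `η` such that `y ^ α η` is closed and `η = 0` in the direction of `y = 0` is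
`(α + 1) W dy + y dW`, up to a resonant term. -/
theorem exists_log_potential {η : Plane → Plane →L[ℂ] ℂ} (hη : AnalyticAt ℂ η (0, 0)) {α : ℂ}
    (hα : α ≠ 0) (hcl : ∀ᶠ z in 𝓝 ((0, 0) : Plane),
      z.2 * (fderiv ℂ η z (1, 0) (0, 1) - fderiv ℂ η z (0, 1) (1, 0)) = α * η z (1, 0)) :
    ∃ (W : Plane → ℂ) (ρ : ℂ) (m : ℕ), AnalyticAt ℂ W (0, 0) ∧ (ρ ≠ 0 → α + 1 + m = 0) ∧
      ∀ᶠ z in 𝓝 ((0, 0) : Plane), ∀ v : Plane,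
        η z v = ((α + 1) * W z + ρ * z.2 ^ m) * v.2 + z.2 * fderiv ℂ W z v := by
  have hp := analyticAt_clm_apply hη (analyticAt_const (v := ((1, 0) : Plane)))
  have hq := analyticAt_clm_apply hη (analyticAt_const (v := ((0, 1) : Plane)))
  -- On `y = 0` the closedness condition reads `α η(∂x) = 0`, so `η(∂x) = y p`.
  obtain ⟨p, hpa, hpη⟩ := exists_analyticAt_snd_smul hp (by
    have hc : ContinuousAt (fun x : ℂ ↦ ((x, 0) : Plane)) 0 := by fun_prop
    filter_upwards [hc.eventually hcl] with x hx
    rw [zero_mul] at hx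
    exact (mul_eq_zero.1 hx.symm).resolve_left hα)
  -- The Euler equation determines `W` on the slice `x = 0`; the condition `∂x W = p`, which matches
  -- the `dx` components, continues it.
  obtain ⟨w, ρ, m, hw, hρ, hwq⟩ := exists_euler α (analyticAt_slice hq)
  obtain ⟨W, hW, hWw, hWp⟩ := exists_primitive_fst hpa hw
  have hWd := analyticAt_clm_apply hW.fderiv (analyticAt_const (v := ((0, 1) : Plane)))
  have hkey : ∀ᶠ z in 𝓝 ((0, 0) : Plane),
      fderiv ℂ η z (1, 0) (0, 1) - ((α + 1) * p z + z.2 * fderiv ℂ p z (0, 1)) = 0 := by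
    refine eventually_eq_zero_of_snd_ne_zero ?_ ?_
    · have h1 := analyticAt_clm_apply (analyticAt_clm_apply hη.fderiv
        (analyticAt_const (v := ((1, 0) : Plane)))) (analyticAt_const (v := ((0, 1) : Plane)))
      have h2 := analyticAt_clm_apply hpa.fderiv (analyticAt_const (v := ((0, 1) : Plane)))
      exact h1.sub ((analyticAt_const.mul hpa).add (analyticAt_snd.mul h2))
    · filter_upwards [hcl, hpη.eventually_nhds, hpa.eventually_analyticAt,
        hη.eventually_analyticAt] with z h1 h2 h3 h4 hz2
      have h5 : HasFDerivAt (fun z : Plane ↦ z.2 • p z) _ z :=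
        hasFDerivAt_smul hasFDerivAt_snd h3.differentiableAt.hasFDerivAt
      have h6 : fderiv ℂ η z (0, 1) (1, 0) = z.2 * fderiv ℂ p z (0, 1) + p z := by
        rw [← fderiv_clm_apply_const h4.differentiableAt, Filter.EventuallyEq.fderiv_eq h2,
          h5.fderiv]
        simp
      rw [h6, h2.self_of_nhds, smul_eq_mul] at h1
      have h7 : z.2 * (fderiv ℂ η z (1, 0) (0, 1) -
          ((α + 1) * p z + z.2 * fderiv ℂ p z (0, 1))) = 0 := by linear_combination h1
      exact (mul_eq_zero.1 h7).resolve_left hz2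
  have hpow : ∀ z : Plane, HasFDerivAt (fun z : Plane ↦ ρ * z.2 ^ m)
      (ρ • ((m * z.2 ^ (m - 1)) • ContinuousLinearMap.snd ℂ ℂ ℂ)) z := fun z ↦
    ((hasDerivAt_pow m z.2).comp_hasFDerivAt z hasFDerivAt_snd).const_mul ρ
  -- The defect in the `dy` component: zero on the slice by the Euler equation, with zero derivative
  -- in `x` by `hkey`.
  have hE : AnalyticAt ℂ (fun z : Plane ↦ (α + 1) * W z + z.2 * fderiv ℂ W z (0, 1) +
      ρ * z.2 ^ m - η z (0, 1)) (0, 0) :=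
    (((analyticAt_const.mul hW).add (analyticAt_snd.mul hWd)).add
      (analyticAt_const.mul (analyticAt_snd.pow m))).sub hq
  have hE0 := eventually_eq_zero_of_fderiv_fst hE (by
    filter_upwards [hW.eventually_analyticAt, hWd.eventually_analyticAt, hη.eventually_analyticAt,
      hq.eventually_analyticAt, eventually_fderiv_mixed hW hWp, hkey, hWp] with z h1 h2 h3 h4 h5 h6 h7
    have h8 : HasFDerivAt (fun z : Plane ↦ (α + 1) * W z + z.2 * fderiv ℂ W z (0, 1) +
      ρ * z.2 ^ m - η z (0, 1)) _ z :=
      (((h1.differentiableAt.hasFDerivAt.const_mul (α + 1)).add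
        (hasFDerivAt_snd.mul h2.differentiableAt.hasFDerivAt)).add (hpow z)).sub
          h4.differentiableAt.hasFDerivAt
    rw [h8.fderiv]
    simp only [_root_.add_apply, _root_.sub_apply, _root_.smul_apply, smul_eq_mul,
      ContinuousLinearMap.coe_snd']
    rw [h5, h7, fderiv_clm_apply_const h3.differentiableAt]
    linear_combination -h6) (by
    filter_upwards [eventually_fderiv_slice hW hWw, hWw, hwq] with y h1 h2 h3
    rw [h1, h2, h3, sub_self])
  refine ⟨W, ρ, m, hW, hρ, ?_⟩
  filter_upwards [hE0, hWp, hpη] with z h1 h2 h3 v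
  rw [clm_apply_eq (η z) v, clm_apply_eq (fderiv ℂ W z) v, h2, h3]
  simp only [smul_eq_mul]
  linear_combination (-v.2) * h1

end Potentials

/-! ### The coordinate `Y` bringing the logarithmic form to a model -/

section ModelCoordinates

open Filter Metric

/-- The logarithmic derivatives `h' / h` of the functions `h(y) = y ^ ν` and
`h(y) = y ^ (-n) + y ^ (-1)`. -/
def IsModelLogDeriv (κ : ℂ → ℂ) : Prop :=
  (∃ ν : ℂ, ν ≠ 0 ∧ ∀ y, κ y = ν / y) ∨
    ∃ n : ℕ, 1 < n ∧ ∀ y, κ y = -(n + y ^ (n - 1)) / (y * (1 + y ^ (n - 1)))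

theorem hasFDerivAt_snd_pow (m : ℕ) (z : Plane) : HasFDerivAt (fun z : Plane ↦ z.2 ^ m)
    ((m * z.2 ^ (m - 1)) • ContinuousLinearMap.snd ℂ ℂ ℂ) z :=
  (hasDerivAt_pow m z.2).comp_hasFDerivAt z hasFDerivAt_snd

theorem hasFDerivAt_snd_mul_exp {s : Plane → ℂ} {z : Plane} (hs : DifferentiableAt ℂ s z) :
    HasFDerivAt (fun z ↦ z.2 * Complex.exp (s z))
      (Complex.exp (s z) • (ContinuousLinearMap.snd ℂ ℂ ℂ + z.2 • fderiv ℂ s z)) z := by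
  refine (hasFDerivAt_snd.mul hs.hasFDerivAt.cexp).congr_fderiv ?_
  refine ContinuousLinearMap.ext fun v ↦ ?_
  simp
  ring

/-- An analytic function `s` such that `Y = y exp (s)` satisfies `ψ η = dY`, where `η` is the form
`(α + 1) W dy + y dW + ρ y ^ m dy`, and `y ^ α / ψ` is, up to a constant, a function `h(Y)` of
logarithmic derivative `κ`. -/
structure IsModelCoordinate (η : Plane → Plane →L[ℂ] ℂ) (α : ℂ) (s ψ : Plane → ℂ) (κ : ℂ → ℂ) :
    Prop where
  analyticAt_exponent : AnalyticAt ℂ s (0, 0)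
  analyticAt_factor : AnalyticAt ℂ ψ (0, 0)
  fderiv_eq : ∀ᶠ z in 𝓝 ((0, 0) : Plane), ∀ v : Plane,
    fderiv ℂ (fun z ↦ z.2 * Complex.exp (s z)) z v = ψ z * η z v
  fderiv_factor : ∀ᶠ z in 𝓝 ((0, 0) : Plane), z.2 ≠ 0 → ∀ v : Plane, fderiv ℂ ψ z v =
    ψ z * (α * (v.2 / z.2) - κ (z.2 * Complex.exp (s z)) *
      fderiv ℂ (fun z ↦ z.2 * Complex.exp (s z)) z v)

/-- For `Y = y exp s` one has `Y ^ α dY = y ^ α exp ((α + 1) s) (dy + y ds)`, so the hypothesis says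
`y ^ α η = c Y ^ α dY`. The factor is `(y / Y) ^ α / c`. -/
theorem isModelCoordinate_power {η : Plane → Plane →L[ℂ] ℂ} {α c : ℂ} (hc : c ≠ 0) {s : Plane → ℂ}
    (hs : AnalyticAt ℂ s (0, 0)) (h : ∀ᶠ z in 𝓝 ((0, 0) : Plane), ∀ v : Plane,
      c * Complex.exp ((α + 1) * s z) * (v.2 + z.2 * fderiv ℂ s z v) = η z v) :
    IsModelCoordinate η α s (fun z ↦ c⁻¹ * Complex.exp (-(α * s z))) (fun y ↦ α / y) := by
  refine ⟨hs, analyticAt_const.mul (analyticAt_const.mul hs).neg.cexp, ?_, ?_⟩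
  · filter_upwards [h, hs.eventually_analyticAt] with z hz hsz v
    rw [(hasFDerivAt_snd_mul_exp hsz.differentiableAt).fderiv, ← hz v]
    simp only [_root_.add_apply, _root_.smul_apply, smul_eq_mul, ContinuousLinearMap.coe_snd']
    have h1 : Complex.exp (s z) = Complex.exp (-(α * s z)) * Complex.exp ((α + 1) * s z) := by
      rw [← Complex.exp_add]
      ring_nf
    rw [h1]
    field_simp
  · filter_upwards [hs.eventually_analyticAt] with z hsz hz2 v
    have h1 : HasFDerivAt (fun z ↦ c⁻¹ * Complex.exp (-(α * s z))) _ z :=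
      ((hsz.differentiableAt.hasFDerivAt.const_mul α).neg.cexp).const_mul c⁻¹
    rw [h1.fderiv, (hasFDerivAt_snd_mul_exp hsz.differentiableAt).fderiv]
    have h2 := Complex.exp_ne_zero (s z)
    simp only [_root_.add_apply, _root_.smul_apply, _root_.neg_apply, smul_eq_mul,
      ContinuousLinearMap.coe_snd', Pi.neg_apply]
    field_simp
    ring

/-- Solution of `exp ((1 - n) s) / (1 - n) + y ^ (n - 1) s = w`. -/
theorem exists_implicit_exponent {m : ℕ} (hm : m ≠ 0) {w : Plane → ℂ} (hw : AnalyticAt ℂ w (0, 0))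
    (hw0 : w (0, 0) ≠ 0) : ∃ s : Plane → ℂ, AnalyticAt ℂ s (0, 0) ∧
      ∀ᶠ z in 𝓝 ((0, 0) : Plane),
        Complex.exp (-(m * s z)) / (-m : ℂ) + z.2 ^ m * s z = w z := by
  have hm' : (m : ℂ) ≠ 0 := Nat.cast_ne_zero.2 hm
  -- The solution at the origin, where the second term vanishes because `m ≠ 0`. For the same reason
  -- the derivative in `s` is `exp (-m s₀)`, which is invertible.
  let s₀ : ℂ := -(Complex.log (-m * w (0, 0)) / m)
  have hs₀ : Complex.exp (-(m * s₀)) = -m * w (0, 0) := by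
    simp only [s₀]
    rw [mul_neg, neg_neg, mul_div_cancel₀ _ hm', Complex.exp_log]
    exact mul_ne_zero (neg_ne_zero.2 hm') hw0
  let F : Plane × ℂ → ℂ := fun t ↦ Complex.exp (-(m * t.2)) / (-m : ℂ) + t.1.2 ^ m * t.2 - w t.1
  have hF : AnalyticAt ℂ F ((0, 0), s₀) := by
    have h1 : AnalyticAt ℂ (fun t : Plane × ℂ ↦ Complex.exp (-(m * t.2)) / (-m : ℂ)) ((0, 0), s₀) :=
      ((analyticAt_const.mul analyticAt_snd).neg.cexp).div analyticAt_const (neg_ne_zero.2 hm')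
    have h2 : AnalyticAt ℂ (fun t : Plane × ℂ ↦ t.1.2 ^ m * t.2) ((0, 0), s₀) :=
      ((AnalyticAt.comp (g := Prod.snd) (f := Prod.fst) analyticAt_snd analyticAt_fst).pow m).mul
        analyticAt_snd
    have h3 : AnalyticAt ℂ (fun t : Plane × ℂ ↦ w t.1) ((0, 0), s₀) :=
      AnalyticAt.comp (g := w) (f := Prod.fst) hw analyticAt_fst
    exact (h1.add h2).sub h3
  have hFc : ContDiffAt ℂ ω F ((0, 0), s₀) := hF.contDiffAt
  have hF0 : F ((0, 0), s₀) = 0 := by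
    simp only [F, hs₀]
    field_simp
    simp [hm]
  have hinv : (fderiv ℂ F ((0, 0), s₀) ∘L ContinuousLinearMap.inr ℂ Plane ℂ).IsInvertible := by
    have h1 : HasDerivAt (fun t : ℂ ↦ F ((0, 0), t)) (Complex.exp (-(m * s₀))) s₀ := by
      have h2 : HasDerivAt (fun t : ℂ ↦ Complex.exp (-(m * t)) / (-m : ℂ))
          (Complex.exp (-(m * s₀)) * (-m) / (-m)) s₀ := by
        have := (((hasDerivAt_id s₀).const_mul (m : ℂ)).neg.cexp).div_const (-m : ℂ)
        simpa using this
      rw [mul_div_cancel_right₀ _ (neg_ne_zero.2 hm')] at h2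
      simpa [F, hm] using h2.sub_const (w (0, 0))
    have h3 : HasDerivAt (fun t : ℂ ↦ (((0, 0), t) : Plane × ℂ)) (0, 1) s₀ :=
      (hasDerivAt_const _ _).prodMk (hasDerivAt_id s₀)
    have h4 := HasFDerivAt.comp_hasDerivAt (l := F) s₀ hF.differentiableAt.hasFDerivAt h3
    have h5 : fderiv ℂ F ((0, 0), s₀) (0, 1) = Complex.exp (-(m * s₀)) := h4.unique h1
    refine ⟨ContinuousLinearEquiv.unitsEquivAut ℂ (Units.mk0 _ (Complex.exp_ne_zero (-(m * s₀)))), ?_⟩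
    ext
    simp [h5]
  refine ⟨hFc.implicitFunction (by simp) hinv,
    ContDiffAt.analyticAt (hFc.contDiffAt_implicitFunction (by simp) hinv), ?_⟩
  filter_upwards [hFc.eventually_apply_implicitFunction (by simp) hinv] with z hz
  rw [hF0] at hz
  exact sub_eq_zero.1 hz

/-- Three cases, according to the primitive of `y ^ α η`. If `α = -1`, it is `W + ρ log y = ρ log Y`
with `s = W / ρ`. If `ρ = 0`, it is `y ^ (α + 1) W`, a constant times `Y ^ (α + 1)` when `exp ((α +
1) s) = W / W (0, 0)`. Otherwise `α = -(m + 1)` with `m > 0`, and `y ^ (-m) W + ρ log y = ρ (Y ^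
(-m) / (-m) + log Y)` is solved by the implicit function theorem, giving the second model with `n =
m + 1`. -/
theorem exists_isModelCoordinate {η : Plane → Plane →L[ℂ] ℂ} {α : ℂ} (hα : α ≠ 0) {W : Plane → ℂ}
    (hW : AnalyticAt ℂ W (0, 0)) {ρ : ℂ} {m : ℕ} (hρ : ρ ≠ 0 → α + 1 + m = 0)
    (hη : ∀ᶠ z in 𝓝 ((0, 0) : Plane), ∀ v : Plane,
        η z v = ((α + 1) * W z + ρ * z.2 ^ m) * v.2 + z.2 * fderiv ℂ W z v)
    (hη0 : η (0, 0) (0, 1) ≠ 0) :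
    ∃ s ψ κ, IsModelLogDeriv κ ∧ IsModelCoordinate η α s ψ κ := by
  have h0 := hη.self_of_nhds (0, 1)
  simp only [zero_mul, add_zero, mul_one] at h0
  rw [h0] at hη0
  by_cases hα1 : α + 1 = 0
  · have hρ0 : ρ ≠ 0 := by
      rintro rfl
      simp [hα1] at hη0
    have hm : m = 0 := by
      have := hρ hρ0
      rw [hα1, zero_add] at this
      exact_mod_cast this
    refine ⟨_, _, _, Or.inl ⟨α, hα, fun _ ↦ rfl⟩, isModelCoordinate_power hρ0
      (s := fun z ↦ W z / ρ) (hW.div analyticAt_const hρ0) ?_⟩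
    filter_upwards [hη, hW.eventually_analyticAt] with z hz hWz v
    have h1 : HasFDerivAt (fun z ↦ W z / ρ) (ρ⁻¹ • fderiv ℂ W z) z := by
      simp only [div_eq_mul_inv]
      exact hWz.differentiableAt.hasFDerivAt.mul_const ρ⁻¹
    rw [hz v, h1.fderiv, hα1, hm]
    simp
    field_simp
  by_cases hρ0 : ρ = 0
  · have hW0 : W (0, 0) ≠ 0 := by
      intro h
      simp [h, hρ0] at hη0
    have hsl : W (0, 0) / W (0, 0) ∈ Complex.slitPlane := by
      rw [div_self hW0]
      exact Complex.one_mem_slitPlane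
    have hWW : AnalyticAt ℂ (fun z ↦ W z / W (0, 0)) (0, 0) := hW.div analyticAt_const hW0
    refine ⟨_, _, _, Or.inl ⟨α, hα, fun _ ↦ rfl⟩, isModelCoordinate_power (c := (α + 1) * W (0, 0))
      (mul_ne_zero hα1 hW0) (s := fun z ↦ Complex.log (W z / W (0, 0)) / (α + 1))
      ((hWW.clog hsl).div analyticAt_const hα1) ?_⟩
    filter_upwards [hη, hW.eventually_analyticAt, hW.continuousAt.eventually_ne hW0,
      hWW.continuousAt.eventually (Complex.isOpen_slitPlane.mem_nhds hsl)] with z hz hWz hWz0 hzs v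
    have h1 : HasFDerivAt (fun z ↦ W z / W (0, 0)) ((W (0, 0))⁻¹ • fderiv ℂ W z) z := by
      simp only [div_eq_mul_inv]
      exact hWz.differentiableAt.hasFDerivAt.mul_const (W (0, 0))⁻¹
    have h2 : HasFDerivAt (fun z : Plane ↦ Complex.log (W z / W (0, 0)) / (α + 1))
        ((α + 1)⁻¹ • ((W z / W (0, 0))⁻¹ • ((W (0, 0))⁻¹ • fderiv ℂ W z))) z := by
      simp only [div_eq_mul_inv _ (α + 1)]
      exact (h1.clog hzs).mul_const (α + 1)⁻¹
    rw [hz v, h2.fderiv, mul_div_cancel₀ _ hα1, Complex.exp_log (div_ne_zero hWz0 hW0), hρ0]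
    simp only [_root_.smul_apply, smul_eq_mul]
    field_simp
    ring
  · have hαm : α = -(m + 1 : ℂ) := by linear_combination hρ hρ0
    have hm : m ≠ 0 := by
      rintro rfl
      apply hα1
      rw [hαm]
      simp
    have hm' : (m : ℂ) ≠ 0 := Nat.cast_ne_zero.2 hm
    have hW0 : W (0, 0) ≠ 0 := by
      intro h
      simp [h, hm] at hη0
    obtain ⟨s, hs, hsW⟩ := exists_implicit_exponent hm (w := fun z ↦ W z / ρ)
      (hW.div analyticAt_const hρ0) (div_ne_zero hW0 hρ0)
    -- For `h(Y) = Y ^ (-(m + 1)) + Y ^ (-1)` one has `h(Y) = y ^ α g`, whence the factor `1 / (ρ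
    -- g)`.
    let g : Plane → ℂ := fun z ↦ Complex.exp (-((m + 1) * s z)) + z.2 ^ m * Complex.exp (-s z)
    have hg : AnalyticAt ℂ g (0, 0) :=
      (analyticAt_const.mul hs).neg.cexp.add ((analyticAt_snd.pow m).mul hs.neg.cexp)
    have hg0 : g (0, 0) ≠ 0 := by
      simp [g, hm]
    refine ⟨s, fun z ↦ (ρ * g z)⁻¹, fun y ↦ -((m + 1 : ℕ) + y ^ (m + 1 - 1)) /
      (y * (1 + y ^ (m + 1 - 1))), Or.inr ⟨m + 1, by omega, fun _ ↦ rfl⟩, hs,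
      (analyticAt_const.mul hg).inv (mul_ne_zero hρ0 hg0), ?_, ?_⟩
    · filter_upwards [hη, hsW.eventually_nhds, hs.eventually_analyticAt, hW.eventually_analyticAt,
        hg.continuousAt.eventually_ne hg0] with z hz hsz hsa hWz hgz v
      have h1 : HasFDerivAt (fun z ↦ W z / ρ) (ρ⁻¹ • fderiv ℂ W z) z := by
        simp only [div_eq_mul_inv]
        exact hWz.differentiableAt.hasFDerivAt.mul_const ρ⁻¹
      have h2 : HasFDerivAt (fun z : Plane ↦ Complex.exp (-(m * s z)) * (-m : ℂ)⁻¹ + z.2 ^ m * s z)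
          ((-m : ℂ)⁻¹ • (Complex.exp (-(m * s z)) • -((m : ℂ) • fderiv ℂ s z)) +
            (z.2 ^ m • fderiv ℂ s z +
              s z • ((m * z.2 ^ (m - 1)) • ContinuousLinearMap.snd ℂ ℂ ℂ))) z :=
        (((hsa.differentiableAt.hasFDerivAt.const_mul (m : ℂ)).neg.cexp).mul_const
          (-m : ℂ)⁻¹).add ((hasFDerivAt_snd_pow m z).mul hsa.differentiableAt.hasFDerivAt)
      have h2' := h2.congr_of_eventuallyEq (f₁ := fun z : Plane ↦ W z / ρ) (by
        filter_upwards [hsz] with w hw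
        rw [← hw, div_eq_mul_inv])
      have h3 := DFunLike.congr_fun (h1.unique h2') v
      have h4 := hsz.self_of_nhds
      rw [(hasFDerivAt_snd_mul_exp hsa.differentiableAt).fderiv, hz v, hαm]
      simp only [_root_.add_apply, _root_.smul_apply, _root_.neg_apply, smul_eq_mul,
        ContinuousLinearMap.coe_snd'] at h3 ⊢
      have h5 : g z =
          Complex.exp (-(m * s z)) / Complex.exp (s z) + z.2 ^ m / Complex.exp (s z) := by
        simp only [g]
        rw [← Complex.exp_sub, div_eq_mul_inv (z.2 ^ m), ← Complex.exp_neg]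
        ring_nf
      have h6 : z.2 * z.2 ^ (m - 1) = z.2 ^ m := mul_pow_sub_one hm _
      have h7 := Complex.exp_ne_zero (s z)
      have h8 : ρ * g z * Complex.exp (s z) = ρ * (Complex.exp (-(m * s z)) + z.2 ^ m) := by
        rw [h5]
        field_simp
      rw [eq_inv_mul_iff_mul_eq₀ (mul_ne_zero hρ0 hgz), ← mul_assoc, h8]
      have h9 : W z = ρ * (Complex.exp (-(m * s z)) / (-m : ℂ) + z.2 ^ m * s z) := by
        rw [h4]
        field_simp
      have h10 : fderiv ℂ W z v = ρ * (ρ⁻¹ * fderiv ℂ W z v) := by field_simp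
      rw [h10, h3, h9]
      rw [← h6]
      field_simp
      ring
    · filter_upwards [hs.eventually_analyticAt, hg.continuousAt.eventually_ne hg0] with
        z hsa hgz hz2 v
      have h0 : HasFDerivAt (fun z : Plane ↦ ρ * g z) _ z :=
        ((((hsa.differentiableAt.hasFDerivAt.const_mul (m + 1 : ℂ)).neg.cexp).add
            ((hasFDerivAt_snd_pow m z).mul
              hsa.differentiableAt.hasFDerivAt.neg.cexp)).const_mul ρ)
      have h1 := (hasDerivAt_inv (mul_ne_zero hρ0 hgz)).comp_hasFDerivAt z h0
      change HasFDerivAt (fun z : Plane ↦ (ρ * g z)⁻¹) _ z at h1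
      rw [h1.fderiv, (hasFDerivAt_snd_mul_exp hsa.differentiableAt).fderiv, hαm]
      simp only [_root_.add_apply, _root_.smul_apply, _root_.neg_apply, smul_eq_mul,
        ContinuousLinearMap.coe_snd', Pi.neg_apply]
      have h2 := Complex.exp_ne_zero (s z)
      have h3 : Complex.exp (-((m + 1) * s z)) = (Complex.exp (s z) ^ (m + 1))⁻¹ := by
        rw [← Complex.exp_nat_mul, ← Complex.exp_neg]
        push_cast
        rfl
      have h4 : g z = (1 + (z.2 * Complex.exp (s z)) ^ m) / Complex.exp (s z) ^ (m + 1) := by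
        simp only [g]
        rw [h3, Complex.exp_neg]
        field_simp
        ring
      have h5 : 1 + (z.2 * Complex.exp (s z)) ^ m ≠ 0 := by
        intro h
        exact hgz (by rw [h4, h, zero_div])
      have h6 : z.2 ^ (m - 1) = z.2 ^ m / z.2 := by
        rw [eq_div_iff hz2, mul_comm, mul_pow_sub_one hm]
      rw [h3, Complex.exp_neg, h4, h6]
      simp only [Nat.add_sub_cancel]
      rw [mul_pow] at h5
      rw [mul_pow z.2, pow_succ _ m]
      generalize Complex.exp (s z) = X at h2 h5 ⊢
      generalize z.2 ^ m = P at h5 ⊢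
      have h7 : X ^ m ≠ 0 := pow_ne_zero _ h2
      generalize X ^ m = T at h5 h7 ⊢
      push_cast
      field_simp
      ring

end ModelCoordinates

/-! ### The exponents and the functions `X`, `Y` -/

section AffineCoordinates

/-- The determinant of two linear forms on the plane. -/
def formDet (l₀ l₁ : Plane →L[ℂ] ℂ) : ℂ := l₀ (1, 0) * l₁ (0, 1) - l₀ (0, 1) * l₁ (1, 0)

theorem formDet_ne_zero {l : Fin 2 → Plane →L[ℂ] ℂ} (hl : LinearIndependent ℂ l) :
    formDet (l 0) (l 1) ≠ 0 := by
  intro h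
  have key : ∀ s t : ℂ, s * l 0 (1, 0) + t * l 1 (1, 0) = 0 →
      s * l 0 (0, 1) + t * l 1 (0, 1) = 0 → s = 0 ∧ t = 0 := by
    intro s t h1 h2
    have hst := Fintype.linearIndependent_iff.1 hl ![s, t] (by
      refine ContinuousLinearMap.ext fun v ↦ ?_
      rw [clm_apply_eq, Fin.sum_univ_two]
      change v.1 * (s * l 0 (1, 0) + t * l 1 (1, 0)) + v.2 * (s * l 0 (0, 1) + t * l 1 (0, 1)) = 0
      rw [h1, h2, mul_zero, mul_zero, add_zero])
    exact ⟨hst 0, hst 1⟩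
  unfold formDet at h
  have h1 := key (l 1 (1, 0)) (-l 0 (1, 0)) (by ring) (by linear_combination -h)
  have h2 := key (l 1 (0, 1)) (-l 0 (0, 1)) (by linear_combination h) (by ring)
  have h3 := key 1 0 (by linear_combination -h1.2) (by linear_combination -h2.2)
  exact one_ne_zero h3.1

/-- The linear coordinates on the plane given by two independent linear forms. -/
def formEquiv (l₀ l₁ : Plane →L[ℂ] ℂ) (h : formDet l₀ l₁ ≠ 0) : Plane ≃L[ℂ] Plane :=
  ContinuousLinearEquiv.equivOfInverse (l₀.prod l₁)
    (((formDet l₀ l₁)⁻¹ • (l₁ (0, 1) • ContinuousLinearMap.fst ℂ ℂ ℂ -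
      l₀ (0, 1) • ContinuousLinearMap.snd ℂ ℂ ℂ)).prod
      ((formDet l₀ l₁)⁻¹ • (l₀ (1, 0) • ContinuousLinearMap.snd ℂ ℂ ℂ -
        l₁ (1, 0) • ContinuousLinearMap.fst ℂ ℂ ℂ)))
    (fun v ↦ by
      have h0 := clm_apply_eq l₀ v
      have h1 := clm_apply_eq l₁ v
      simp only [smul_eq_mul] at h0 h1
      refine Prod.ext ?_ ?_
      · simp [h0, h1, inv_mul_eq_iff_eq_mul₀ h]
        unfold formDet
        ring
      · simp [h0, h1, inv_mul_eq_iff_eq_mul₀ h]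
        unfold formDet
        ring)
    (fun v ↦ by
      have key : ∀ l : Plane →L[ℂ] ℂ, ∀ a b : ℂ, l (a, b) = a * l (1, 0) + b * l (0, 1) :=
        fun l a b ↦ clm_apply_eq l (a, b)
      unfold formDet at *
      refine Prod.ext ?_ ?_
      · simp [key l₀ (_ * _)]
        field_simp
        ring
      · simp [key l₁ (_ * _)]
        field_simp
        ring)

theorem formEquiv_coe (l₀ l₁ : Plane →L[ℂ] ℂ) (h : formDet l₀ l₁ ≠ 0) :
    (formEquiv l₀ l₁ h : Plane →L[ℂ] Plane) = l₀.prod l₁ := rfl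

/-- A connection with two independent holomorphic horizontal forms is holomorphic. -/
theorem IsLogHorizontalAt.exists_extension {Θ : Plane → Plane →L[ℂ] Plane →L[ℂ] Plane}
    {η₀ η₁ : Plane → Plane →L[ℂ] ℂ} {z₀ : Plane} (h₀ : IsLogHorizontalAt Θ 0 η₀ z₀)
    (h₁ : IsLogHorizontalAt Θ 0 η₁ z₀) (hdet : formDet (η₀ z₀) (η₁ z₀) ≠ 0) :
    ∃ G : Plane → Plane →L[ℂ] Plane →L[ℂ] Plane, AnalyticAt ℂ G z₀ ∧
      ∀ᶠ z in 𝓝 z₀, z.2 ≠ 0 → G z = Θ z := by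
  -- The frame as a matrix with rows `η₀` and `η₁`. Horizontality reads `dP = P Θ`, so `P⁻¹ dP` is a
  -- holomorphic extension of `Θ`.
  let P : Plane → Plane →L[ℂ] Plane := fun z ↦
    ContinuousLinearMap.compL ℂ Plane ℂ Plane (ContinuousLinearMap.inl ℂ ℂ ℂ) (η₀ z) +
    ContinuousLinearMap.compL ℂ Plane ℂ Plane (ContinuousLinearMap.inr ℂ ℂ ℂ) (η₁ z)
  have hPapp : ∀ z v, P z v = (η₀ z v, η₁ z v) := fun z v ↦ by simp [P]
  have hP : AnalyticAt ℂ P z₀ :=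
    (analyticAt_clm_map _ h₀.analyticAt).add (analyticAt_clm_map _ h₁.analyticAt)
  have hP0 : P z₀ = (formEquiv _ _ hdet : Plane →L[ℂ] Plane) :=
    ContinuousLinearMap.ext fun v ↦ by rw [hPapp]; rfl
  have hunit : IsUnit (P z₀) := by
    rw [hP0]
    exact ⟨ContinuousLinearEquiv.toUnit (formEquiv _ _ hdet), rfl⟩
  obtain ⟨unit, hu⟩ := hunit
  have hinv : AnalyticAt ℂ (fun z ↦ Ring.inverse (P z)) z₀ := by
    have : AnalyticAt ℂ (Ring.inverse : (Plane →L[ℂ] Plane) → _) (P z₀) := by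
      rw [← hu]
      exact analyticAt_inverse unit
    exact this.comp hP
  refine ⟨fun z ↦ (ContinuousLinearMap.compL ℂ Plane Plane Plane (Ring.inverse (P z))) ∘L
    (fderiv ℂ P z), analyticAt_clm_comp (analyticAt_clm_map _ hinv) hP.fderiv, ?_⟩
  have hev : ∀ᶠ z in 𝓝 z₀, IsUnit (P z) := by
    have : ∀ᶠ Q in 𝓝 (P z₀), IsUnit Q := by
      rw [← hu]
      exact unit.nhds
    exact hP.continuousAt.eventually this
  filter_upwards [hev, h₀.fderiv_eq, h₁.fderiv_eq, h₀.analyticAt.eventually_analyticAt,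
    h₁.analyticAt.eventually_analyticAt] with z hz e₀ e₁ a₀ a₁ hz2
  have hder : HasFDerivAt P (ContinuousLinearMap.compL ℂ Plane ℂ Plane
      (ContinuousLinearMap.inl ℂ ℂ ℂ) ∘L (fderiv ℂ η₀ z) + ContinuousLinearMap.compL ℂ Plane ℂ Plane
      (ContinuousLinearMap.inr ℂ ℂ ℂ) ∘L (fderiv ℂ η₁ z)) z :=
    ((ContinuousLinearMap.hasFDerivAt _).comp z a₀.differentiableAt.hasFDerivAt).add
      ((ContinuousLinearMap.hasFDerivAt _).comp z a₁.differentiableAt.hasFDerivAt)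
  have hΘ : ∀ u, fderiv ℂ P z u = P z * Θ z u := by
    intro u
    rw [hder.fderiv]
    refine ContinuousLinearMap.ext fun v ↦ ?_
    have h0 := DFunLike.congr_fun (e₀ hz2 u) v
    have h1 := DFunLike.congr_fun (e₁ hz2 u) v
    simp only [_root_.sub_apply, _root_.smul_apply, smul_eq_mul, zero_mul, sub_zero,
      ContinuousLinearMap.comp_apply] at h0 h1
    rw [mul_apply_eq_comp, hPapp, ← h0, ← h1]
    simp
  refine ContinuousLinearMap.ext fun u ↦ ?_
  change Ring.inverse (P z) * fderiv ℂ P z u = Θ z u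
  rw [hΘ, ← mul_assoc, Ring.inverse_mul_cancel _ hz, one_mul]

/-- The affine coordinate `X` and the coordinate `Y = y exp s` adapted to the pencil. -/
structure IsPencilCoordinates (Θ : Plane → Plane →L[ℂ] Plane →L[ℂ] Plane) (X s : Plane → ℂ)
    (κ : ℂ → ℂ) : Prop where
  analyticAt_fst : AnalyticAt ℂ X (0, 0)
  apply_zero : X (0, 0) = 0
  fderiv_ne_zero : fderiv ℂ X (0, 0) (1, 0) ≠ 0
  analyticAt_exponent : AnalyticAt ℂ s (0, 0)
  eventually_eq : ∀ᶠ z in 𝓝 ((0, 0) : Plane), z.2 ≠ 0 → ∀ u v : Plane,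
    fderiv ℂ (fderiv ℂ X) z u v = fderiv ℂ X z (Θ z u v) ∧
    fderiv ℂ (fderiv ℂ (fun z ↦ z.2 * Complex.exp (s z))) z u v =
      fderiv ℂ (fun z ↦ z.2 * Complex.exp (s z)) z (Θ z u v) -
        κ (z.2 * Complex.exp (s z)) * fderiv ℂ (fun z ↦ z.2 * Complex.exp (s z)) z u *
          fderiv ℂ (fun z ↦ z.2 * Complex.exp (s z)) z v

/-- `X` is a potential of `η₀`. Closedness of `y ^ α η₁` kills `η₁(∂x)` at the origin, so
independence makes `η₀(∂x)` and `η₁(∂y)` nonzero there: the first lets `X` complete `Y` to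
coordinates, the second is what the construction of `Y` needs. The second-order equation for `Y` is
the derivative of `dY = ψ η₁`. -/
theorem IsLogHorizontalAt.exists_isPencilCoordinates
    {Θ : Plane → Plane →L[ℂ] Plane →L[ℂ] Plane} {η₀ η₁ : Plane → Plane →L[ℂ] ℂ} {α : ℂ}
    (h₀ : IsLogHorizontalAt Θ 0 η₀ (0, 0)) (h₁ : IsLogHorizontalAt Θ α η₁ (0, 0)) (hα : α ≠ 0)
    (hdet : formDet (η₀ (0, 0)) (η₁ (0, 0)) ≠ 0)
    (hΘ : ∀ᶠ z in 𝓝 ((0, 0) : Plane), z.2 ≠ 0 → ∀ u v : Plane, Θ z u v = Θ z v u) :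
    ∃ X s κ, IsModelLogDeriv κ ∧ IsPencilCoordinates Θ X s κ := by
  have hc₁ := h₁.eventually_closed hΘ
  have hη10 : η₁ (0, 0) (1, 0) = 0 := by
    have := hc₁.self_of_nhds
    simpa [hα] using this.symm
  unfold formDet at hdet
  rw [hη10, mul_zero, sub_zero] at hdet
  have hc₀ := h₀.eventually_closed hΘ
  have hc₀' : ∀ᶠ z in 𝓝 ((0, 0) : Plane),
      fderiv ℂ η₀ z (1, 0) (0, 1) = fderiv ℂ η₀ z (0, 1) (1, 0) := by
    have han : AnalyticAt ℂ (fun z ↦ fderiv ℂ η₀ z (1, 0) (0, 1) - fderiv ℂ η₀ z (0, 1) (1, 0))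
        (0, 0) :=
      (analyticAt_clm_apply (analyticAt_clm_apply h₀.analyticAt.fderiv analyticAt_const)
        analyticAt_const).sub (analyticAt_clm_apply
        (analyticAt_clm_apply h₀.analyticAt.fderiv analyticAt_const) analyticAt_const)
    filter_upwards [eventually_eq_zero_of_snd_ne_zero han (by
      filter_upwards [hc₀] with z hz hz2
      rw [zero_mul] at hz
      exact (mul_eq_zero.1 hz).resolve_left hz2)] with z hz using sub_eq_zero.1 hz
  obtain ⟨X, hX, hX0, hXη⟩ := exists_potential h₀.analyticAt hc₀'
  obtain ⟨W, ρ, m, hW, hρ, hη⟩ := exists_log_potential h₁.analyticAt hα hc₁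
  obtain ⟨s, ψ, κ, hκ, hs⟩ := exists_isModelCoordinate hα hW hρ hη (right_ne_zero_of_mul hdet)
  refine ⟨X, s, κ, hκ, hX, hX0, ?_, hs.analyticAt_exponent, ?_⟩
  · rw [hXη.self_of_nhds]
    exact left_ne_zero_of_mul hdet
  filter_upwards [hXη.eventually_nhds, h₀.fderiv_eq, h₁.fderiv_eq, hs.fderiv_eq.eventually_nhds,
    hs.fderiv_factor, h₁.analyticAt.eventually_analyticAt,
    hs.analyticAt_factor.eventually_analyticAt] with z hXz e₀ e₁ hYz hψ a₁ aψ hz2 u v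
  constructor
  · rw [Filter.EventuallyEq.fderiv_eq (f := η₀) hXz, hXz.self_of_nhds]
    have h := DFunLike.congr_fun (e₀ hz2 u) v
    simpa only [_root_.sub_apply, _root_.smul_apply, smul_eq_mul, zero_mul, sub_zero,
      ContinuousLinearMap.comp_apply] using h
  · have hY : ∀ᶠ w in 𝓝 z, fderiv ℂ (fun z ↦ z.2 * Complex.exp (s z)) w = ψ w • η₁ w := by
      filter_upwards [hYz] with w hw
      refine ContinuousLinearMap.ext fun v ↦ ?_
      rw [hw v]
      rfl
    rw [Filter.EventuallyEq.fderiv_eq (f := fun w ↦ ψ w • η₁ w) hY,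
      (hasFDerivAt_smul aψ.differentiableAt.hasFDerivAt a₁.differentiableAt.hasFDerivAt).fderiv]
    have h1 := DFunLike.congr_fun (e₁ hz2 u) v
    have h2 := hψ hz2 u
    have h3 := hYz.self_of_nhds
    simp only [_root_.sub_apply, _root_.smul_apply, smul_eq_mul,
      ContinuousLinearMap.comp_apply, _root_.add_apply, ContinuousLinearMap.smulRight_apply] at h1 ⊢
    rw [h1, h2, h3 u, h3 v, h3 (Θ z u v)]
    ring

/-- Exactly one exponent vanishes. If both did, `Θ` would extend holomorphically; if neither did,
both forms would vanish on `∂x` at the origin and be dependent. -/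
theorem IsDiagonalAt.exists_isPencilCoordinates {Θ : Plane → Plane →L[ℂ] Plane →L[ℂ] Plane}
    (h : IsDiagonalAt Θ (0, 0))
    (hΘ : ∀ᶠ z in 𝓝 ((0, 0) : Plane), z.2 ≠ 0 → ∀ u v : Plane, Θ z u v = Θ z v u)
    (hpole : ¬ ∃ G : Plane → Plane →L[ℂ] Plane →L[ℂ] Plane, AnalyticAt ℂ G (0, 0) ∧
      ∀ᶠ z in 𝓝 ((0, 0) : Plane), z.2 ≠ 0 → G z = Θ z) :
    ∃ X s κ, IsModelLogDeriv κ ∧ IsPencilCoordinates Θ X s κ := by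
  obtain ⟨α, η, hη, hli⟩ := h
  have hdet := formDet_ne_zero hli
  have hdet' : formDet (η 1 (0, 0)) (η 0 (0, 0)) ≠ 0 := by
    intro h
    apply hdet
    unfold formDet at h ⊢
    linear_combination -h
  have hc : ∀ i, α i * η i (0, 0) (1, 0) = 0 := fun i ↦ by
    simpa using ((hη i).eventually_closed hΘ).self_of_nhds.symm
  by_cases h0 : α 0 = 0
  · have hη0 := hη 0
    rw [h0] at hη0
    by_cases h1 : α 1 = 0
    · have hη1 := hη 1
      rw [h1] at hη1
      exact absurd (hη0.exists_extension hη1 hdet) hpole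
    · exact hη0.exists_isPencilCoordinates (hη 1) h1 hdet hΘ
  · by_cases h1 : α 1 = 0
    · have hη1 := hη 1
      rw [h1] at hη1
      exact hη1.exists_isPencilCoordinates (hη 0) h0 hdet' hΘ
    · refine absurd ?_ hdet
      have e0 := (mul_eq_zero.1 (hc 0)).resolve_left h0
      have e1 := (mul_eq_zero.1 (hc 1)).resolve_left h1
      unfold formDet
      rw [e0, e1]
      ring

end AffineCoordinates

/-! ### New charts from local biholomorphisms -/

section ChangeOfCoordinates

variable {S : Type*} [TopologicalSpace S] [ChartedSpace Plane S] [IsManifold 𝓘(ℂ, Plane) ω S]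

/-- A local biholomorphism of the coordinates gives new coordinates. -/
theorem IsCoordinates.exists_change {e : OpenPartialHomeomorph S Plane} (he : IsCoordinates e)
    {p : S} (hp : p ∈ e.source) {φ : Plane → Plane} (hφ : AnalyticAt ℂ φ (e p))
    {φ' : Plane ≃L[ℂ] Plane} (hφ' : HasFDerivAt φ (φ' : Plane →L[ℂ] Plane) (e p))
    {P : Plane → Prop} (hP : ∀ᶠ z in 𝓝 (e p), P z) :
    ∃ e' : OpenPartialHomeomorph S Plane, IsCoordinates e' ∧ p ∈ e'.source ∧
      e'.source ⊆ e.source ∧ ∀ q ∈ e'.source, e' q = φ (e q) ∧ P (e q) := by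
  have hinv : ∀ᶠ z in 𝓝 (e p),
      fderiv ℂ φ z ∈ range ((↑) : (Plane ≃L[ℂ] Plane) → Plane →L[ℂ] Plane) := by
    refine hφ.fderiv.continuousAt.eventually ?_
    rw [hφ'.fderiv]
    exact ContinuousLinearEquiv.nhds φ'
  obtain ⟨U, hU, hUo, hpU⟩ := eventually_nhds_iff.1 (hP.and (hinv.and hφ.eventually_analyticAt))
  let ψ := (hφ.contDiffAt (n := ω)).toOpenPartialHomeomorph φ hφ' (by simp)
  have hψ : (ψ : Plane → Plane) = φ := rfl
  have hpψ : e p ∈ ψ.source :=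
    (hφ.contDiffAt (n := ω)).mem_toOpenPartialHomeomorph_source hφ' (by simp)
  let e' := e.trans (ψ.restrOpen U hUo)
  have hsrc : ∀ q, q ∈ e'.source ↔ q ∈ e.source ∧ e q ∈ ψ.source ∧ e q ∈ U := fun q ↦ by
    simp [e']
  have hval : ∀ q, e' q = φ (e q) := fun q ↦ rfl
  refine ⟨e', ?_, (hsrc p).2 ⟨hp, hpψ, hpU⟩, fun q hq ↦ ((hsrc q).1 hq).1,
    fun q hq ↦ ⟨hval q, (hU _ ((hsrc q).1 hq).2.2).1⟩⟩
  refine e'.mem_maximalAtlas_of_contMDiffOn ?_ ?_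
  · intro q hq
    have h := (hsrc q).1 hq
    have h1 : ContMDiffAt 𝓘(ℂ, Plane) 𝓘(ℂ, Plane) ω φ (e q) :=
      (hU _ h.2.2).2.2.contDiffAt.contMDiffAt
    exact (h1.comp q (he.contMDiffAt h.1)).contMDiffWithinAt
  · intro w hw
    have h := (hsrc _).1 (e'.map_target hw)
    have hw' : w ∈ ψ.target ∧ ψ.symm w ∈ U ∧ ψ.symm w ∈ e.target := by
      have : w ∈ e'.target := hw
      simp [e'] at this
      grind
    obtain ⟨E, hE⟩ := (hU _ hw'.2.1).2.1
    have h1 : ContDiffAt ℂ ω ψ.symm w := by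
      refine ψ.contDiffAt_symm (f₀' := E) hw'.1 ?_ ?_
      · rw [hψ, hE]
        exact (hU _ hw'.2.1).2.2.differentiableAt.hasFDerivAt
      · rw [hψ]
        exact (hU _ hw'.2.1).2.2.contDiffAt
    have h2 : ContMDiffAt 𝓘(ℂ, Plane) 𝓘(ℂ, Plane) ω e.symm (ψ.symm w) :=
      contMDiffAt_symm_of_mem_maximalAtlas he hw'.2.2
    exact (h2.comp w h1.contMDiffAt).contMDiffWithinAt

end ChangeOfCoordinates

/-! ### Horizontal forms of the two models -/

section Models

variable {S : Type*} [TopologicalSpace S] [ChartedSpace Plane S]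

/-- If the only Christoffel symbol is the logarithmic derivative of `h`, a function of `y`, then the
structure is given by the pencil `dx + t h dy`. -/
theorem isGivenByPencilOn_of_theta_eq {nabla : Connection S} {e : OpenPartialHomeomorph S Plane}
    {W : Set Plane} (hW : IsOpen W) (hWc : IsPreconnected W) {κ : ℂ → ℂ} {h : Plane → ℂ}
    (hΘ : ∀ z ∈ W, ∀ u c : Plane, theta nabla e z u c = (0, κ z.2 * u.2 * c.2))
    (h0 : ∀ z ∈ W, h z ≠ 0) (hh : ∀ z ∈ W, HasFDerivAt h ((κ z.2 * h z) • dy) z) :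
    IsGivenByPencilOn nabla e W h := by
  intro η
  constructor
  · intro hη
    have hd : ∀ z ∈ W, ∀ u c, fderiv ℂ η z u c = κ z.2 * u.2 * c.2 * η z (0, 1) := by
      intro z hz u c
      rw [(hη z hz).2 u, ContinuousLinearMap.comp_apply, hΘ z hz, clm_apply_eq]
      simp
    -- The system decouples: `η(∂x)` and `η(∂y) / h` have zero differential, hence are constant on
    -- the connected set `W`.
    have ha : ∀ z ∈ W, HasFDerivAt (fun z ↦ η z (1, 0)) (0 : Plane →L[ℂ] ℂ) z := by
      intro z hz
      refine ((hη z hz).1.hasFDerivAt.clm_apply (hasFDerivAt_const _ z)).congr_fderiv ?_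
      refine ContinuousLinearMap.ext fun u ↦ ?_
      simp [hd z hz]
    have hb : ∀ z ∈ W, HasFDerivAt (fun z ↦ η z (0, 1) / h z) (0 : Plane →L[ℂ] ℂ) z := by
      intro z hz
      have h1 : HasFDerivAt (fun z ↦ η z (0, 1)) ((κ z.2 * η z (0, 1)) • dy) z := by
        refine ((hη z hz).1.hasFDerivAt.clm_apply (hasFDerivAt_const _ z)).congr_fderiv ?_
        refine ContinuousLinearMap.ext fun u ↦ ?_
        simp [hd z hz, dy]
        ring
      simp only [div_eq_mul_inv]
      refine (h1.mul ((hasDerivAt_inv (h0 z hz)).comp_hasFDerivAt z (hh z hz))).congr_fderiv ?_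
      refine ContinuousLinearMap.ext fun u ↦ ?_
      have := h0 z hz
      simp [dy]
      field_simp
      ring
    obtain ⟨a, ha'⟩ := hW.exists_is_const_of_fderiv_eq_zero (𝕜 := ℂ) hWc
      (fun z hz ↦ (ha z hz).differentiableAt.differentiableWithinAt) (fun z hz ↦ (ha z hz).fderiv)
    obtain ⟨b, hb'⟩ := hW.exists_is_const_of_fderiv_eq_zero (𝕜 := ℂ) hWc
      (fun z hz ↦ (hb z hz).differentiableAt.differentiableWithinAt) (fun z hz ↦ (hb z hz).fderiv)
    refine ⟨a, b, fun z hz ↦ ContinuousLinearMap.ext fun v ↦ ?_⟩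
    have e1 := ha' z hz
    have e2 := (div_eq_iff (h0 z hz)).1 (hb' z hz)
    rw [clm_apply_eq, e1, e2]
    simp [dx, dy]
    ring
  · rintro ⟨a, b, hab⟩ z hz
    have h1 : HasFDerivAt (fun z ↦ a • dx + b • (h z • dy))
        (b • ((κ z.2 * h z) • dy).smulRight dy) z :=
      (((hh z hz).smul_const dy).const_smul b).const_add (a • dx)
    have h2 : HasFDerivAt η (b • ((κ z.2 * h z) • dy).smulRight dy) z :=
      h1.congr_of_eventuallyEq (Filter.eventuallyEq_of_mem (hW.mem_nhds hz) hab)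
    refine ⟨h2.differentiableAt, fun u ↦ ?_⟩
    rw [h2.fderiv, hab z hz]
    refine ContinuousLinearMap.ext fun c ↦ ?_
    rw [ContinuousLinearMap.comp_apply, hΘ z hz]
    simp only [_root_.smul_apply, _root_.add_apply, ContinuousLinearMap.smulRight_apply, smul_eq_mul,
      dx, dy, ContinuousLinearMap.coe_fst', ContinuousLinearMap.coe_snd']
    ring

/-- A continuous branch of the logarithm agrees locally with a local inverse of `exp`. -/
theorem hasFDerivAt_logBranch {W : Set Plane} (hW : IsOpen W) {l : Plane → ℂ}
    (hl : ContinuousOn l W) (hexp : ∀ z ∈ W, z.2 ≠ 0 ∧ Complex.exp (l z) = z.2) {z : Plane}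
    (hz : z ∈ W) : HasFDerivAt l (z.2⁻¹ • dy) z := by
  have h1 := Complex.hasStrictDerivAt_exp (l z)
  have h2 := h1.to_localInverse (Complex.exp_ne_zero _)
  have h3 : ∀ᶠ w in 𝓝 z, l w = h1.localInverse Complex.exp _ _ (Complex.exp_ne_zero _) w.2 := by
    filter_upwards [hW.mem_nhds hz, (hl.continuousAt (hW.mem_nhds hz)).eventually
      (h1.hasStrictFDerivAt_equiv (Complex.exp_ne_zero _)).eventually_left_inverse] with w hw hw'
    rw [← (hexp w hw).2]
    exact hw'.symm
  have h4 : HasDerivAt (h1.localInverse Complex.exp _ _ (Complex.exp_ne_zero _)) z.2⁻¹ z.2 := by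
    have := h2.hasDerivAt
    convert! this using 1 <;> rw [(hexp z hz).2]
  exact (h4.comp_hasFDerivAt z hasFDerivAt_snd).congr_of_eventuallyEq h3

theorem isPowerModel_of_theta_eq {nabla : Connection S} {e : OpenPartialHomeomorph S Plane} {ν : ℂ}
    (hΘ : ∀ z ∈ e.target, z.2 ≠ 0 → ∀ u c : Plane,
      theta nabla e z u c = (0, ν / z.2 * u.2 * c.2)) : IsPowerModel nabla e ν := by
  intro W l hW hWc hWe hl hexp
  refine isGivenByPencilOn_of_theta_eq (κ := fun y ↦ ν / y) hW hWc
    (fun z hz ↦ hΘ z (hWe hz) (hexp z hz).1) (fun z _ ↦ Complex.exp_ne_zero _) fun z hz ↦ ?_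
  refine ((hasFDerivAt_logBranch hW hl hexp hz).const_mul ν).cexp.congr_fderiv ?_
  refine ContinuousLinearMap.ext fun v ↦ ?_
  simp [dy]
  ring

/-- The coefficient is the logarithmic derivative of `(1 + y ^ (n - 1)) / y ^ n`; the bound on `y`
keeps this function from vanishing. -/
theorem isResidueModel_of_theta_eq {nabla : Connection S} {e : OpenPartialHomeomorph S Plane}
    {n : ℕ} (hn : 1 < n) (h1 : ∀ z ∈ e.target, ‖z.2‖ < 1)
    (hΘ : ∀ z ∈ e.target, z.2 ≠ 0 → ∀ u c : Plane, theta nabla e z u c =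
      (0, -(n + z.2 ^ (n - 1)) / (z.2 * (1 + z.2 ^ (n - 1))) * u.2 * c.2)) :
    IsResidueModel nabla e n := by
  intro W hW hWc hWe hW0
  have hne : ∀ z ∈ W, 1 + z.2 ^ (n - 1) ≠ 0 := by
    intro z hz h
    have h2 : ‖z.2 ^ (n - 1)‖ < 1 := by
      rw [norm_pow]
      exact pow_lt_one₀ (norm_nonneg _) (h1 z (hWe hz)) (by omega)
    rw [eq_neg_of_add_eq_zero_right h] at h2
    simp at h2
  have hpow : ∀ z : Plane, z.2 ^ n = z.2 * z.2 ^ (n - 1) := fun z ↦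
    (mul_pow_sub_one (by omega) z.2).symm
  have hval : ∀ z ∈ W, 1 / z.2 ^ n + 1 / z.2 = (1 + z.2 ^ (n - 1)) / (z.2 * z.2 ^ (n - 1)) := by
    intro z hz
    have := hW0 z hz
    have := pow_ne_zero (n - 1) this
    rw [hpow]
    field_simp
  refine isGivenByPencilOn_of_theta_eq
    (κ := fun y ↦ -(n + y ^ (n - 1)) / (y * (1 + y ^ (n - 1)))) hW hWc
    (fun z hz ↦ hΘ z (hWe hz) (hW0 z hz)) (fun z hz ↦ ?_) fun z hz ↦ ?_
  · rw [hval z hz]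
    have := hW0 z hz
    exact div_ne_zero (hne z hz) (mul_ne_zero this (pow_ne_zero _ this))
  · have hz0 := hW0 z hz
    have h2 := hne z hz
    simp only [one_div]
    have h3 : HasDerivAt (fun y : ℂ ↦ (y ^ n)⁻¹ + y⁻¹)
        (-(n * z.2 ^ (n - 1)) / (z.2 ^ n) ^ 2 + -(z.2 ^ 2)⁻¹) z.2 :=
      ((hasDerivAt_pow n z.2).fun_inv (pow_ne_zero _ hz0)).add (hasDerivAt_inv hz0)
    refine (h3.comp_hasFDerivAt z hasFDerivAt_snd).congr_fderiv ?_
    refine ContinuousLinearMap.ext fun v ↦ ?_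
    have h4 := pow_ne_zero (n - 1) hz0
    simp only [_root_.smul_apply, smul_eq_mul, ContinuousLinearMap.coe_snd', dy]
    rw [← one_div (z.2 ^ n), ← one_div z.2, hval z hz, hpow]
    generalize z.2 ^ (n - 1) = P at h2 h4 ⊢
    field_simp
    ring

end Models

/-! ### Assembly of the normal form -/

section NormalForm

variable {S : Type*} [TopologicalSpace S] [ChartedSpace Plane S] [IsManifold 𝓘(ℂ, Plane) ω S]

theorem IsLogarithmic.not_exists_extension {nabla : Connection S} {D : Set S}
    (h : IsLogarithmic nabla D) {p : S} (hp : p ∈ D) {e : OpenPartialHomeomorph S Plane}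
    (he : Straightens D e) (hpe : p ∈ e.source) :
    ¬ ∃ G : Plane → Plane →L[ℂ] Plane →L[ℂ] Plane, AnalyticAt ℂ G (e p) ∧
      ∀ᶠ z in 𝓝 (e p), z.2 ≠ 0 → G z = theta nabla e z := by
  rintro ⟨G, hG, hev⟩
  obtain ⟨U, hU, hUo, hpU⟩ := eventually_nhds_iff.1
    (hG.eventually_analyticAt.and (hev.and (e.open_target.mem_nhds (e.map_source hpe))))
  refine h.polar p hp e he.isCoordinates hpe ⟨U, G, hUo, hpU, fun z hz ↦ (hU z hz).2.2,
    fun z hz ↦ (hU z hz).1, fun z hz ↦ (hU z hz.1).2.1 fun h0 ↦ hz.2 ⟨(hU z hz.1).2.2, ?_⟩⟩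
  exact (he.symm_mem_iff (hU z hz.1).2.2).2 h0

/-- The coordinate forms of `e'` pull back to `dX` and `dY`. The defect of horizontality is
tensorial, so the equations for the second derivatives of `X` and `Y` give the Christoffel symbols
of `e'` directly. -/
theorem IsPencilCoordinates.theta_eq {nabla : Connection S} {D : Set S} (h : IsLogarithmic nabla D)
    {e e' : OpenPartialHomeomorph S Plane} (he : Straightens D e) (he' : IsCoordinates e')
    (hs : e'.source ⊆ e.source) {X Y : Plane → ℂ} {κ : ℂ → ℂ}
    (hφ : ∀ q ∈ e'.source, e' q = (X (e q), Y (e q))) {q : S} (hq : q ∈ e'.source) (hqD : q ∉ D)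
    (hX : AnalyticAt ℂ X (e q)) (hY : AnalyticAt ℂ Y (e q))
    (hXX : ∀ u v : Plane, fderiv ℂ (fderiv ℂ X) (e q) u v =
      fderiv ℂ X (e q) (theta nabla e (e q) u v))
    (hYY : ∀ u v : Plane, fderiv ℂ (fderiv ℂ Y) (e q) u v =
      fderiv ℂ Y (e q) (theta nabla e (e q) u v) -
        κ (Y (e q)) * fderiv ℂ Y (e q) u * fderiv ℂ Y (e q) v) (u c : Plane) :
    theta nabla e' (e' q) u c = (0, κ (e' q).2 * u.2 * c.2) := by
  have hev : ∀ᶠ z in 𝓝 (e q), (e' ∘ e.symm) z = (X z, Y z) := by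
    filter_upwards [eventually_mem_target (hs hq) hq] with z hz
    rw [Function.comp_apply, hφ _ hz.2, e.right_inv hz.1]
  have hder : ∀ᶠ z in 𝓝 (e q), fderiv ℂ (e' ∘ e.symm) z = (fderiv ℂ X z).prod (fderiv ℂ Y z) := by
    filter_upwards [hev.eventually_nhds, hX.eventually_analyticAt, hY.eventually_analyticAt]
      with z hz hXz hYz
    rw [Filter.EventuallyEq.fderiv_eq (f := fun z ↦ (X z, Y z)) hz]
    exact (hXz.differentiableAt.hasFDerivAt.prodMk hYz.differentiableAt.hasFDerivAt).fderiv
  obtain ⟨u', rfl⟩ : ∃ u', fderiv ℂ (e' ∘ e.symm) (e q) u' = u :=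
    ⟨_, he'.fderiv_transition_comp he.isCoordinates hq (hs hq) u⟩
  obtain ⟨c', rfl⟩ : ∃ c', fderiv ℂ (e' ∘ e.symm) (e q) c' = c :=
    ⟨_, he'.fderiv_transition_comp he.isCoordinates hq (hs hq) c⟩
  have key : ∀ l : Plane →L[ℂ] ℂ, fderiv ℂ (fun z ↦ l ∘L (fderiv ℂ (e' ∘ e.symm) z)) (e q) u' c' -
      l (fderiv ℂ (e' ∘ e.symm) (e q) (theta nabla e (e q) u' c')) =
      - l (theta nabla e' (e' q) (fderiv ℂ (e' ∘ e.symm) (e q) u')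
        (fderiv ℂ (e' ∘ e.symm) (e q) c')) := by
    intro l
    have := (h.pullback_defect he.isCoordinates he' (hs hq) hq hqD (η' := fun _ ↦ l)
      (differentiableAt_const _)).2 u' c'
    rw [this]
    simp
  have kx := key (ContinuousLinearMap.fst ℂ ℂ ℂ)
  have ky := key (ContinuousLinearMap.snd ℂ ℂ ℂ)
  have ex : fderiv ℂ (fun z ↦ (ContinuousLinearMap.fst ℂ ℂ ℂ) ∘L (fderiv ℂ (e' ∘ e.symm) z)) (e q) =
      fderiv ℂ (fderiv ℂ X) (e q) := Filter.EventuallyEq.fderiv_eq (by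
    filter_upwards [hder] with z hz
    rw [hz, ContinuousLinearMap.fst_comp_prod])
  have ey : fderiv ℂ (fun z ↦ (ContinuousLinearMap.snd ℂ ℂ ℂ) ∘L (fderiv ℂ (e' ∘ e.symm) z)) (e q) =
      fderiv ℂ (fderiv ℂ Y) (e q) := Filter.EventuallyEq.fderiv_eq (by
    filter_upwards [hder] with z hz
    rw [hz, ContinuousLinearMap.snd_comp_prod])
  rw [ex, hXX, hder.self_of_nhds] at kx
  rw [ey, hYY, hder.self_of_nhds] at ky
  rw [hder.self_of_nhds, hφ q hq]
  rw [hφ q hq] at kx ky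
  simp only [ContinuousLinearMap.prod_apply, ContinuousLinearMap.coe_fst',
    ContinuousLinearMap.coe_snd'] at kx ky ⊢
  refine Prod.ext ?_ ?_
  · linear_combination kx
  · linear_combination ky

/-- The normal form of a diagonalizable logarithmic affine structure. -/
theorem IsLogarithmic.exists_model {nabla : Connection S} {D : Set S} (h : IsLogarithmic nabla D)
    {p : S} (hp : p ∈ D) {e : OpenPartialHomeomorph S Plane} (he : IsAdapted D p e)
    (hd : IsDiagonalAt (theta nabla e) (e p)) :
    ∃ e' : OpenPartialHomeomorph S Plane, IsAdapted D p e' ∧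
      ((∃ ν : ℂ, ν ≠ 0 ∧ IsPowerModel nabla e' ν) ∨
        ∃ n : ℕ, 1 < n ∧ IsResidueModel nabla e' n) := by
  have hs := he.straightens
  have hpole := h.not_exists_extension hp hs he.mem_source
  have htar := e.open_target.mem_nhds (e.map_source he.mem_source)
  have h00 : e p = (0, 0) := he.centred
  rw [h00] at hd hpole htar
  obtain ⟨X, s, κ, hκ, hX⟩ := hd.exists_isPencilCoordinates (by
    filter_upwards [htar] with z hz hz2 u v
    have := h.theta_symm he.isCoordinates (e.map_target hz)
      (fun hD ↦ hz2 ((hs.symm_mem_iff hz).1 hD)) u v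
    rwa [e.right_inv hz] at this) hpole
  let Y : Plane → ℂ := fun z ↦ z.2 * Complex.exp (s z)
  have hY : ∀ z, AnalyticAt ℂ s z → AnalyticAt ℂ Y z := fun z hz ↦ analyticAt_snd.mul hz.cexp
  have hφ : AnalyticAt ℂ (fun z ↦ (X z, Y z)) (0, 0) :=
    hX.analyticAt_fst.prod (hY _ hX.analyticAt_exponent)
  have hdet : formDet (fderiv ℂ X (0, 0)) (fderiv ℂ Y (0, 0)) ≠ 0 := by
    unfold formDet
    rw [(hasFDerivAt_snd_mul_exp hX.analyticAt_exponent.differentiableAt).fderiv]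
    simp [hX.fderiv_ne_zero]
  have hev : ∀ᶠ z in 𝓝 ((0, 0) : Plane), (z.2 ≠ 0 → ∀ u v : Plane,
      fderiv ℂ (fderiv ℂ X) z u v = fderiv ℂ X z (theta nabla e z u v) ∧
      fderiv ℂ (fderiv ℂ Y) z u v =
        fderiv ℂ Y z (theta nabla e z u v) - κ (Y z) * fderiv ℂ Y z u * fderiv ℂ Y z v) ∧
      AnalyticAt ℂ X z ∧ AnalyticAt ℂ s z ∧ ‖Y z‖ < 1 := by
    -- Shrinking to `‖Y‖ < 1` keeps `1 + Y ^ (n - 1)` nonzero in the second model.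
    have hY0 : ‖Y (0, 0)‖ < 1 := by simp [Y]
    filter_upwards [hX.eventually_eq, hX.analyticAt_fst.eventually_analyticAt,
      hX.analyticAt_exponent.eventually_analyticAt,
      (hY _ hX.analyticAt_exponent).continuousAt.norm.eventually_lt_const hY0] with z h1 h2 h3 h4
    exact ⟨h1, h2, h3, h4⟩
  rw [← h00] at hφ hdet hev
  have hφ' : HasFDerivAt (fun z ↦ (X z, Y z)) (formEquiv _ _ hdet : Plane →L[ℂ] Plane) (e p) := by
    rw [formEquiv_coe]
    exact hev.self_of_nhds.2.1.differentiableAt.hasFDerivAt.prodMk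
      (hY _ hev.self_of_nhds.2.2.1).differentiableAt.hasFDerivAt
  obtain ⟨e', he', hpe', hsub, heq⟩ :=
    he.isCoordinates.exists_change he.mem_source hφ hφ' hev
  have hiff : ∀ q ∈ e'.source, q ∈ D ↔ (e' q).2 = 0 := by
    intro q hq
    rw [he.mem_iff q (hsub hq), (heq q hq).1]
    simp [Y, Complex.exp_ne_zero]
  have hΘ : ∀ z ∈ e'.target, z.2 ≠ 0 → ∀ u c : Plane,
      theta nabla e' z u c = (0, κ z.2 * u.2 * c.2) := by
    intro z hz hz2 u c
    have hq := e'.map_target hz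
    have hqD : e'.symm z ∉ D := fun hD ↦ hz2 (by
      rw [hiff _ hq, e'.right_inv hz] at hD
      exact hD)
    have hq2 : (e (e'.symm z)).2 ≠ 0 := fun h0 ↦ hqD ((he.mem_iff _ (hsub hq)).2 h0)
    obtain ⟨h1, h2, h3, -⟩ := (heq _ hq).2
    have := IsPencilCoordinates.theta_eq h hs he' hsub (fun q hq ↦ (heq q hq).1) hq hqD h2
      (hY _ h3) (fun u v ↦ (h1 hq2 u v).1) (fun u v ↦ (h1 hq2 u v).2) u c
    rwa [e'.right_inv hz] at this
  refine ⟨e', ⟨he', hpe', ?_, hiff⟩, ?_⟩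
  · rw [(heq p hpe').1, h00]
    simp [hX.apply_zero, Y]
  · rcases hκ with ⟨ν, hν, hκ⟩ | ⟨n, hn, hκ⟩
    · refine Or.inl ⟨ν, hν, isPowerModel_of_theta_eq fun z hz hz2 u c ↦ ?_⟩
      rw [hΘ z hz hz2, hκ]
    · refine Or.inr ⟨n, hn, isResidueModel_of_theta_eq hn (fun z hz ↦ ?_) fun z hz hz2 u c ↦ ?_⟩
      · have := heq _ (e'.map_target hz)
        rw [e'.right_inv hz] at this
        rw [this.1]
        exact this.2.2.2.2
      · rw [hΘ z hz hz2, hκ]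

end NormalForm

/-! ### The weighted logarithmic residue formula -/

section LogarithmicResidue

open Metric

variable {R : ℝ} {g : ℂ → ℂ}

/-- Nonzero on the circle, `g` is not identically zero, so its zeros do not accumulate in the
compact disc. -/
theorem finite_zeros (hg : AnalyticOnNhd ℂ g (closedBall 0 R)) (hR : 0 < R)
    (h0 : ∀ ζ ∈ sphere (0 : ℂ) R, g ζ ≠ 0) : {ζ | ζ ∈ closedBall 0 R ∧ g ζ = 0}.Finite ∧
      ∀ ζ ∈ closedBall (0 : ℂ) R, ∃ᶠ w in 𝓝 ζ, g w ≠ 0 := by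
  have hsph : (R : ℂ) ∈ sphere (0 : ℂ) R := by simp [abs_of_pos hR]
  have key : ∀ ζ ∈ closedBall (0 : ℂ) R, ¬ ∃ᶠ w in 𝓝[≠] ζ, g w = 0 := fun ζ hζ hf ↦
    h0 R hsph (hg.eqOn_zero_of_preconnected_of_frequently_eq_zero
      (convex_closedBall 0 R).isPreconnected hζ hf (sphere_subset_closedBall hsph))
  constructor
  · by_contra hinf
    obtain ⟨ζ, hζ, hacc⟩ := Set.Infinite.exists_accPt_of_subset_isCompact hinf
      (isCompact_closedBall (0 : ℂ) R) (fun ζ hζ ↦ hζ.1)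
    exact key ζ hζ ((accPt_iff_frequently_nhdsNE.1 hacc).mono fun w hw ↦ hw.2)
  · intro ζ hζ
    have h1 := key ζ hζ
    rw [Filter.not_frequently] at h1
    exact h1.frequently.filter_mono nhdsWithin_le_nhds

theorem exists_factor {K : Set ℂ} (hg : AnalyticOnNhd ℂ g K) {z : ℂ} (hz : z ∈ K)
    (hgz : g z = 0) (hne : ∃ᶠ w in 𝓝 z, g w ≠ 0) :
    ∃ (n : ℕ) (u : ℂ → ℂ), n ≠ 0 ∧ AnalyticOnNhd ℂ u K ∧ u z ≠ 0 ∧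
      ∀ ζ, g ζ = (ζ - z) ^ n * u ζ := by
  obtain ⟨n, u₀, hu₀, hu₀z, hev⟩ := (hg z hz).exists_eventuallyEq_pow_smul_nonzero_iff.2
    (Filter.not_eventually.2 hne)
  have hn : n ≠ 0 := by
    rintro rfl
    have := hev.self_of_nhds
    simp [hgz, hu₀z.symm] at this
  let u : ℂ → ℂ := Function.update (fun ζ ↦ g ζ / (ζ - z) ^ n) z (u₀ z)
  have huz : u =ᶠ[𝓝 z] u₀ := by
    filter_upwards [hev] with ζ hζ
    rcases eq_or_ne ζ z with rfl | hne
    · simp [u]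
    · have h1 := pow_ne_zero n (sub_ne_zero.2 hne)
      simp only [u, Function.update_of_ne hne, hζ, smul_eq_mul]
      field_simp
  refine ⟨n, u, hn, fun ζ hζ ↦ ?_, by simpa [u] using hu₀z, fun ζ ↦ ?_⟩
  · rcases eq_or_ne ζ z with rfl | hne
    · exact hu₀.congr huz.symm
    · have h1 : AnalyticAt ℂ (fun ζ ↦ g ζ / (ζ - z) ^ n) ζ :=
        (hg ζ hζ).div ((analyticAt_id.sub analyticAt_const).pow n)
          (pow_ne_zero n (sub_ne_zero.2 hne))
      refine h1.congr ?_
      filter_upwards [isOpen_ne.mem_nhds hne] with w hw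
      simp only [u, Function.update_of_ne hw]
  · rcases eq_or_ne ζ z with rfl | hne
    · simp [hgz, hn]
    · have h1 := pow_ne_zero n (sub_ne_zero.2 hne)
      simp only [u, Function.update_of_ne hne]
      field_simp

/-- Induction on the zeros: `g = (ζ - z) ^ n u` splits `g' / g` into `n / (ζ - z) + u' / u`, and
Cauchy's formula evaluates the first term. -/
theorem exists_logarithmic_residue (hR : 0 < R) (T : Finset ℂ)
    (hg : AnalyticOnNhd ℂ g (closedBall 0 R)) (h0 : ∀ ζ ∈ sphere (0 : ℂ) R, g ζ ≠ 0) (hT : ∀ ζ, ζ ∈ T ↔ ζ ∈ closedBall 0 R ∧ g ζ = 0) :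
    ∃ m : ℂ → ℕ, (∀ z ∈ T, m z ≠ 0) ∧ ∀ h : ℂ → ℂ, Differentiable ℂ h →
      (∮ ζ in C(0, R), h ζ * (deriv g ζ / g ζ)) = 2 * Real.pi * Complex.I * ∑ z ∈ T, m z * h z := by
  induction T using Finset.induction_on generalizing g with
  | empty =>
    refine ⟨fun _ ↦ 0, by simp, fun h hh ↦ ?_⟩
    have hd : DifferentiableOn ℂ (fun ζ ↦ h ζ * (deriv g ζ / g ζ)) (closedBall 0 R) := by
      intro ζ hζ
      have h1 : g ζ ≠ 0 := fun h ↦ by simpa using (hT ζ).2 ⟨hζ, h⟩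
      exact ((hh ζ).mul ((hg ζ hζ).deriv.differentiableAt.div
        (hg ζ hζ).differentiableAt h1)).differentiableWithinAt
    rw [(hd.mono closure_ball_subset_closedBall).diffContOnCl.circleIntegral_eq_zero hR.le]
    simp
  | insert z T hzT ih =>
    have hz := (hT z).1 (Finset.mem_insert_self z T)
    obtain ⟨n, u, hn, hu, huz, hgu⟩ := exists_factor hg hz.1 hz.2 ((finite_zeros hg hR h0).2 z hz.1)
    have hzs : ∀ ζ ∈ sphere (0 : ℂ) R, ζ - z ≠ 0 := fun ζ hζ h ↦ by
      rw [sub_eq_zero] at h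
      exact h0 ζ hζ (h ▸ hz.2)
    have hus : ∀ ζ ∈ sphere (0 : ℂ) R, u ζ ≠ 0 := fun ζ hζ h ↦ h0 ζ hζ (by rw [hgu, h, mul_zero])
    obtain ⟨m, hm, hint⟩ := ih hu hus (by
      intro ζ
      rcases eq_or_ne ζ z with rfl | hne
      · simp [hzT, huz]
      · have h1 := hT ζ
        rw [Finset.mem_insert, hgu, mul_eq_zero] at h1
        have h2 := pow_ne_zero n (sub_ne_zero.2 hne)
        simpa [hne, h2] using h1)
    refine ⟨Function.update m z n, fun w hw ↦ ?_, fun h hh ↦ ?_⟩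
    · rcases eq_or_ne w z with rfl | hne
      · simpa using hn
      · rw [Function.update_of_ne hne]
        exact hm w ((Finset.mem_insert.1 hw).resolve_left hne)
    · have heq : EqOn (fun ζ ↦ h ζ * (deriv g ζ / g ζ))
          (fun ζ ↦ (ζ - z)⁻¹ • (n * h ζ) + h ζ * (deriv u ζ / u ζ)) (sphere 0 R) := by
        intro ζ hζ
        have hd : HasDerivAt g (n * (ζ - z) ^ (n - 1) * u ζ + (ζ - z) ^ n * deriv u ζ) ζ := by
          have h1 : HasDerivAt (fun ζ ↦ (ζ - z) ^ n) (n * (ζ - z) ^ (n - 1) * 1) ζ :=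
            ((hasDerivAt_id ζ).sub_const z).fun_pow n
          have h2 := h1.mul (hu ζ (sphere_subset_closedBall hζ)).differentiableAt.hasDerivAt
          rw [mul_one] at h2
          exact h2.congr_of_eventuallyEq (Filter.Eventually.of_forall hgu)
        have h1 := hzs ζ hζ
        have h2 := hus ζ hζ
        have h3 : (ζ - z) ^ n = (ζ - z) * (ζ - z) ^ (n - 1) := (mul_pow_sub_one hn _).symm
        have h4 := pow_ne_zero (n - 1) h1
        simp only
        rw [hd.deriv, hgu, h3, smul_eq_mul]
        field_simp
      have hzb : z ∈ ball (0 : ℂ) R := by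
        rcases (mem_closedBall.1 hz.1).lt_or_eq with h | h
        · exact h
        · exact absurd hz.2 (h0 z h)
      have hd1 : DifferentiableOn ℂ (fun ζ ↦ n * h ζ) (closedBall 0 R) :=
        ((differentiable_const _).mul hh).differentiableOn
      rw [circleIntegral.integral_congr hR.le heq, circleIntegral.integral_add, hint h hh,
        hd1.circleIntegral_sub_inv_smul hzb, Finset.sum_insert hzT, Function.update_self]
      · have : ∑ w ∈ T, (Function.update m z n w : ℂ) * h w = ∑ w ∈ T, (m w : ℂ) * h w :=
          Finset.sum_congr rfl fun w hw ↦ by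
            rw [Function.update_of_ne (ne_of_mem_of_not_mem hw hzT)]
        rw [this, smul_eq_mul]
        ring
      · refine ContinuousOn.circleIntegrable hR.le (ContinuousOn.mul ?_ ?_)
        · exact ContinuousOn.inv₀ (by fun_prop) hzs
        · exact hd1.continuousOn.mono sphere_subset_closedBall
      · refine ContinuousOn.circleIntegrable hR.le (hh.continuous.continuousOn.mul ?_)
        exact ContinuousOn.div (fun ζ hζ ↦ (hu ζ (sphere_subset_closedBall
          hζ)).deriv.continuousAt.continuousWithinAt) (fun ζ hζ ↦ (hu ζ (sphere_subset_closedBall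
          hζ)).continuousAt.continuousWithinAt) hus

end LogarithmicResidue

/-! ### Hankel determinants count distinct points -/

section Hankel

/-- The Hankel matrix of the power sums with weights `m` of the points of `T`. -/
def hankel (k : ℕ) (T : Finset ℂ) (m : ℂ → ℂ) : Matrix (Fin k) (Fin k) ℂ :=
  Matrix.of fun i j ↦ ∑ z ∈ T, m z * z ^ (i + j : ℕ)

/-- The matrix is `Vᵀ diag(m) V` with `V` the Vandermonde matrix of the points, and `c` is the
square of the determinant of `V`. -/
theorem det_hankel {k : ℕ} {T : Finset ℂ} (hT : T.card = k) :
    ∃ c : ℂ, c ≠ 0 ∧ ∀ m : ℂ → ℂ, (hankel k T m).det = c * ∏ z ∈ T, m z := by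
  subst hT
  let v : Fin T.card → ℂ := fun l ↦ (T.equivFin.symm l : ℂ)
  have hv : Function.Injective v := Subtype.val_injective.comp T.equivFin.symm.injective
  have hsum : ∀ F : ℂ → ℂ, ∑ z ∈ T, F z = ∑ l, F (v l) := fun F ↦ by
    rw [← Finset.sum_coe_sort, ← T.equivFin.symm.sum_comp]
  have hprod : ∀ F : ℂ → ℂ, ∏ z ∈ T, F z = ∏ l, F (v l) := fun F ↦ by
    rw [← Finset.prod_coe_sort, ← T.equivFin.symm.prod_comp]
  refine ⟨(Matrix.vandermonde v).det ^ 2, pow_ne_zero 2 (Matrix.det_vandermonde_ne_zero_iff.2 hv),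
    fun m ↦ ?_⟩
  have : hankel T.card T m = (Matrix.vandermonde v).transpose *
      (Matrix.diagonal (fun l ↦ m (v l)) * Matrix.vandermonde v) := by
    ext i j
    rw [Matrix.mul_apply]
    simp only [hankel, Matrix.of_apply, hsum, Matrix.transpose_apply, Matrix.diagonal_mul,
      Matrix.vandermonde_apply]
    exact Finset.sum_congr rfl fun l _ ↦ by ring
  rw [this, Matrix.det_mul, Matrix.det_mul, Matrix.det_transpose, Matrix.det_diagonal, hprod]
  ring

/-- The matrix factors through a space of dimension `T.card`, so its rank is less than `k`. -/
theorem det_hankel_eq_zero {k : ℕ} {T : Finset ℂ} (hT : T.card < k) (m : ℂ → ℂ) :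
    (hankel k T m).det = 0 := by
  by_contra hne
  let A : Matrix (Fin k) T ℂ := Matrix.of fun i z ↦ (z : ℂ) ^ (i : ℕ)
  let B : Matrix T (Fin k) ℂ := Matrix.of fun z j ↦ m z * (z : ℂ) ^ (j : ℕ)
  have hAB : hankel k T m = A * B := by
    ext i j
    simp only [hankel, Matrix.of_apply, Matrix.mul_apply, A, B]
    rw [← Finset.sum_coe_sort]
    exact Finset.sum_congr rfl fun l _ ↦ by ring
  have h1 := Matrix.rank_of_isUnit (hankel k T m)
    ((Matrix.isUnit_iff_isUnit_det _).2 (isUnit_iff_ne_zero.2 hne))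
  have h2 := (Matrix.rank_mul_le_left A B).trans A.rank_le_card_width
  rw [← hAB, h1, Fintype.card_fin, Fintype.card_coe] at h2
  omega

end Hankel

/-! ### Singular zeros of a function of two variables are isolated -/

section PowerSums

open Metric

/-- The power sums of the zeros of `f (x, ·)` are holomorphic functions of `x`. -/
theorem exists_powerSums {f : Plane → ℂ} {ρ R : ℝ} (hR : 0 < R)
    (hf : AnalyticOnNhd ℂ f (ball 0 ρ ×ˢ closedBall 0 R))
    (h0 : ∀ x ∈ ball (0 : ℂ) ρ, ∀ ζ ∈ sphere (0 : ℂ) R, f (x, ζ) ≠ 0) :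
    ∃ (T : ℂ → Finset ℂ) (m : ℂ → ℂ → ℕ) (s : ℕ → ℂ → ℂ),
      (∀ j, AnalyticOnNhd ℂ (s j) (ball 0 ρ)) ∧ ∀ x ∈ ball (0 : ℂ) ρ,
        (∀ ζ, ζ ∈ T x ↔ ζ ∈ closedBall 0 R ∧ f (x, ζ) = 0) ∧ (∀ ζ ∈ T x, m x ζ ≠ 0) ∧
        ∀ j, s j x = ∑ ζ ∈ T x, (m x ζ : ℂ) * ζ ^ j := by
  have hg : ∀ x ∈ ball (0 : ℂ) ρ, AnalyticOnNhd ℂ (fun ζ ↦ f (x, ζ)) (closedBall 0 R) :=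
    fun x hx ζ hζ ↦ (hf (x, ζ) ⟨hx, hζ⟩).comp (analyticAt_const.prod analyticAt_id)
  have hex : ∀ x : ℂ, ∃ (T : Finset ℂ) (m : ℂ → ℕ), x ∈ ball (0 : ℂ) ρ →
      (∀ ζ, ζ ∈ T ↔ ζ ∈ closedBall 0 R ∧ f (x, ζ) = 0) ∧ (∀ ζ ∈ T, m ζ ≠ 0) ∧
      ∀ h : ℂ → ℂ, Differentiable ℂ h →
        (∮ ζ in C(0, R), h ζ * (deriv (fun ζ ↦ f (x, ζ)) ζ / f (x, ζ))) =
          2 * Real.pi * Complex.I * ∑ z ∈ T, m z * h z := by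
    intro x
    by_cases hx : x ∈ ball (0 : ℂ) ρ
    · have hfin := (finite_zeros (hg x hx) hR (h0 x hx)).1
      have hT : ∀ ζ, ζ ∈ hfin.toFinset ↔ ζ ∈ closedBall 0 R ∧ f (x, ζ) = 0 := fun ζ ↦ by simp
      obtain ⟨m, hm, hint⟩ := exists_logarithmic_residue hR hfin.toFinset (hg x hx) (h0 x hx) hT
      exact ⟨hfin.toFinset, m, fun _ ↦ ⟨hT, hm, hint⟩⟩
    · exact ⟨∅, fun _ ↦ 0, fun h ↦ absurd h hx⟩
  choose T m hTm using hex
  have hpi : (2 * Real.pi * Complex.I : ℂ) ≠ 0 := Complex.two_pi_I_ne_zero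
  -- The extra factor `ζ` is cancelled by the Cauchy kernel at `y = 0`, which lets
  -- `analyticOnNhd_circleIntegral` give holomorphy in `x`.
  let F : ℕ → ℂ → ℂ → ℂ := fun j x ζ ↦ ζ ^ (j + 1) * (fderiv ℂ f (x, ζ) (0, 1) / f (x, ζ))
  have hF : ∀ j, ∀ z ∈ ball (0 : ℂ) ρ ×ˢ sphere (0 : ℂ) R,
      AnalyticAt ℂ (fun z : Plane ↦ F j z.1 z.2) z := by
    intro j z hz
    have hfz := hf z ⟨hz.1, sphere_subset_closedBall hz.2⟩
    exact (analyticAt_snd.pow _).mul ((analyticAt_clm_apply hfz.fderiv analyticAt_const).div hfz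
      (h0 _ hz.1 _ hz.2))
  refine ⟨T, m, fun j x ↦ (2 * Real.pi * Complex.I)⁻¹ *
    ∮ ζ in C(0, R), (ζ - (x, (0 : ℂ)).2)⁻¹ • F j (x, (0 : ℂ)).1 ζ, fun j x hx ↦ ?_, fun x hx ↦ ?_⟩
  · have h1 := analyticOnNhd_circleIntegral isOpen_ball hR (F j)
      (fun z hz ↦ (hF j z hz).continuousAt.continuousWithinAt) (fun ζ hζ x hx ↦ by
        have : AnalyticAt ℂ (fun x ↦ F j x ζ) x :=
          (hF j (x, ζ) ⟨hx, hζ⟩).comp (f := fun x : ℂ ↦ (x, ζ)) (analyticAt_id.prod analyticAt_const)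
        exact this.differentiableAt.differentiableWithinAt)
    have h2 := (h1 (x, 0) ⟨hx, mem_ball_self hR⟩).comp (f := fun x : ℂ ↦ (x, (0 : ℂ)))
      (analyticAt_id.prod analyticAt_const)
    exact analyticAt_const.mul h2
  · obtain ⟨hT, hm, hint⟩ := hTm x hx
    refine ⟨hT, hm, fun j ↦ ?_⟩
    rw [inv_mul_eq_iff_eq_mul₀ hpi, ← hint (fun ζ ↦ ζ ^ j) (by fun_prop)]
    refine circleIntegral.integral_congr hR.le fun ζ hζ ↦ ?_
    have hζ0 : ζ ≠ 0 := ne_of_mem_sphere hζ hR.ne'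
    have hd : HasDerivAt (fun ζ ↦ f (x, ζ)) (fderiv ℂ f (x, ζ) (0, 1)) ζ :=
      (hf (x, ζ) ⟨hx, sphere_subset_closedBall hζ⟩).differentiableAt.hasFDerivAt.comp_hasDerivAt ζ
        ((hasDerivAt_const ζ x).prodMk (hasDerivAt_id ζ))
    simp only [F, hd.deriv, smul_eq_mul, sub_zero]
    field_simp
    ring

/-- The zero set of `f` is a smooth curve near its point `z`. -/
def IsSmoothZeroAt (f : Plane → ℂ) (z : Plane) : Prop :=
  ∃ Q : Plane → ℂ, AnalyticAt ℂ Q z ∧ Q z = 0 ∧ fderiv ℂ Q z ≠ 0 ∧ ∀ᶠ w in 𝓝 z, f w = 0 ↔ Q w = 0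

theorem analyticAt_det {k : ℕ} {A : Plane → Matrix (Fin k) (Fin k) ℂ} {z : Plane}
    (hA : ∀ i j, AnalyticAt ℂ (fun z ↦ A z i j) z) : AnalyticAt ℂ (fun z ↦ (A z).det) z := by
  simp only [Matrix.det_apply']
  exact Finset.analyticAt_fun_sum _ fun σ _ ↦ analyticAt_const.mul
    (Finset.analyticAt_fun_prod _ fun i _ ↦ hA _ _)

/-- `R` is chosen so that `f (0, ·)` has no zero other than possibly `0` in the closed disc; by
compactness of the circle no zero meets it for small `x`. -/
theorem exists_polydisc {f : Plane → ℂ} (hf : AnalyticAt ℂ f (0, 0))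
    (hne : ∃ᶠ y in 𝓝 (0 : ℂ), f (0, y) ≠ 0) : ∃ ρ > 0, ∃ R > 0,
      AnalyticOnNhd ℂ f (ball 0 ρ ×ˢ closedBall 0 R) ∧
      (∀ x ∈ ball (0 : ℂ) ρ, ∀ ζ ∈ sphere (0 : ℂ) R, f (x, ζ) ≠ 0) ∧
      ∀ y ∈ closedBall (0 : ℂ) R, y ≠ 0 → f (0, y) ≠ 0 := by
  obtain ⟨ε, hε, hfε⟩ := Metric.eventually_nhds_iff_ball.1 hf.eventually_analyticAt
  have h1 : ∀ᶠ y in 𝓝[≠] (0 : ℂ), f (0, y) ≠ 0 :=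
    (analyticAt_slice hf).eventually_eq_zero_or_eventually_ne_zero.resolve_left
      (Filter.not_eventually.2 hne)
  obtain ⟨ε', hε', hfε'⟩ := Metric.eventually_nhds_iff_ball.1 (eventually_nhdsWithin_iff.1 h1)
  obtain ⟨R, hR, hRε⟩ := exists_between (lt_min hε hε')
  have hball : ∀ z : Plane, z.1 ∈ ball (0 : ℂ) ε → z.2 ∈ closedBall (0 : ℂ) R →
      AnalyticAt ℂ f z := by
    intro z hz1 hz2
    refine hfε z ?_
    rw [← ball_prod_same]
    exact ⟨hz1, closedBall_subset_ball (hRε.trans_le (min_le_left _ _)) hz2⟩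
  have h0 : ∀ y ∈ closedBall (0 : ℂ) R, y ≠ 0 → f (0, y) ≠ 0 := fun y hy hy0 ↦
    hfε' y (closedBall_subset_ball (hRε.trans_le (min_le_right _ _)) hy) hy0
  have h2 : ∀ᶠ x in 𝓝 (0 : ℂ), ∀ ζ ∈ sphere (0 : ℂ) R, f (x, ζ) ≠ 0 := by
    refine (isCompact_sphere (0 : ℂ) R).eventually_forall_of_forall_eventually fun ζ hζ ↦ ?_
    exact (hball (0, ζ) (mem_ball_self hε) (sphere_subset_closedBall hζ)).continuousAt.eventually_ne
      (h0 ζ (sphere_subset_closedBall hζ) (ne_of_mem_sphere hζ hR.ne'))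
  obtain ⟨ρ, hρ, hfρ⟩ := Metric.eventually_nhds_iff_ball.1 (h2.and (ball_mem_nhds (0 : ℂ) hε))
  exact ⟨ρ, hρ, R, hR, fun z hz ↦ hball z (hfρ z.1 hz.1).2 hz.2, fun x hx ↦ (hfρ x hx).1, h0⟩

/-- The number of distinct roots of `f (x, ·)` takes its maximal value `k` exactly where the Hankel
determinant `H` of the power sums is nonzero, which holds for all small `x ≠ 0`. There `Q (x, y) =
det (s_{i+j+1} - y s_{i+j})` is a nonzero factor depending on `x` times the product of the `ζ - y`
over the roots: it has the zeros of `f`, now simple. On `x = 0` only the origin can be a zero. -/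
theorem eventually_isSmoothZeroAt_of_slice {f : Plane → ℂ} (hf : AnalyticAt ℂ f (0, 0))
    (hne : ∃ᶠ y in 𝓝 (0 : ℂ), f (0, y) ≠ 0) :
    ∀ᶠ z in 𝓝[≠] ((0, 0) : Plane), f z = 0 → IsSmoothZeroAt f z := by
  obtain ⟨ρ, hρ, R, hR, hfa, hf0, hfy⟩ := exists_polydisc hf hne
  obtain ⟨T, m, s, hs, hTm⟩ := exists_powerSums hR hfa hf0
  obtain ⟨r, hr, hrρ⟩ := exists_between hρ
  have hrsub : closedBall (0 : ℂ) r ⊆ ball 0 ρ := closedBall_subset_ball hrρ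
  -- The number of distinct roots is at most `s 0`, the number of roots with multiplicity, which is
  -- bounded.
  obtain ⟨C, hC⟩ := (isCompact_closedBall (0 : ℂ) r).exists_bound_of_continuousOn
    (fun x hx ↦ (hs 0 x (hrsub hx)).continuousAt.continuousWithinAt)
  have hbdd : ∀ x ∈ closedBall (0 : ℂ) r, ((T x).card : ℝ) ≤ C := by
    intro x hx
    obtain ⟨-, hm, hsx⟩ := hTm x (hrsub hx)
    refine le_trans ?_ (hC x hx)
    rw [hsx 0]
    have : ∑ ζ ∈ T x, (m x ζ : ℂ) * ζ ^ 0 = ((∑ ζ ∈ T x, m x ζ : ℕ) : ℂ) := by simp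
    rw [this, Complex.norm_natCast, Finset.card_eq_sum_ones]
    exact_mod_cast Finset.sum_le_sum fun ζ hζ ↦ Nat.one_le_iff_ne_zero.2 (hm ζ hζ)
  obtain ⟨x', hx', hmax⟩ : ∃ x' ∈ ball (0 : ℂ) r,
      ∀ x ∈ ball (0 : ℂ) r, (T x).card ≤ (T x').card := by
    have hne : ((fun x ↦ (T x).card) '' ball (0 : ℂ) r).Nonempty := ⟨_, 0, mem_ball_self hr, rfl⟩
    have hb : BddAbove ((fun x ↦ (T x).card) '' ball (0 : ℂ) r) := by
      refine ⟨⌊C⌋₊, ?_⟩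
      rintro _ ⟨x, hx, rfl⟩
      exact Nat.le_floor (hbdd x (ball_subset_closedBall hx))
    obtain ⟨x', hx', hx'e⟩ := Nat.sSup_mem hne hb
    refine ⟨x', hx', fun x hx ↦ ?_⟩
    rw [show (T x').card = _ from hx'e]
    exact le_csSup hb ⟨x, hx, rfl⟩
  obtain ⟨k, hk⟩ : ∃ k, (T x').card = k := ⟨_, rfl⟩
  rw [hk] at hmax
  have hball : ball (0 : ℂ) r ⊆ ball 0 ρ := ball_subset_ball hrρ.le
  let H : ℂ → ℂ := fun x ↦ (Matrix.of fun i j : Fin k ↦ s (i + j) x).det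
  have hH : ∀ x ∈ ball (0 : ℂ) r, H x = (hankel k (T x) (fun ζ ↦ m x ζ)).det := by
    intro x hx
    refine congrArg Matrix.det (Matrix.ext fun i j ↦ ?_)
    exact (hTm x (hball hx)).2.2 _
  have hHa : AnalyticOnNhd ℂ (fun z : Plane ↦ H z.1) (ball 0 r ×ˢ univ) := fun z hz ↦
    analyticAt_det (A := fun z ↦ Matrix.of fun i j : Fin k ↦ s (i + j) z.1) fun i j ↦
      (hs _ z.1 (hball hz.1)).comp analyticAt_fst
  have hHa' : AnalyticOnNhd ℂ H (ball 0 r) := fun x hx ↦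
    (hHa (x, 0) ⟨hx, mem_univ _⟩).comp (f := fun x : ℂ ↦ (x, (0 : ℂ)))
      (analyticAt_id.prod analyticAt_const)
  have hHx' : H x' ≠ 0 := by
    obtain ⟨c, hc, hdet⟩ := det_hankel hk
    rw [hH x' hx', hdet]
    exact mul_ne_zero hc (Finset.prod_ne_zero_iff.2 fun ζ hζ ↦
      Nat.cast_ne_zero.2 ((hTm x' (hball hx')).2.1 ζ hζ))
  have hcard : ∀ x ∈ ball (0 : ℂ) r, H x ≠ 0 → (T x).card = k := by
    intro x hx hHx
    refine le_antisymm (hmax x hx) (not_lt.1 fun hlt ↦ hHx ?_)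
    rw [hH x hx, det_hankel_eq_zero hlt]
  have hHev : ∀ᶠ x in 𝓝[≠] (0 : ℂ), H x ≠ 0 :=
    (hHa' 0 (mem_ball_self hr)).eventually_eq_zero_or_eventually_ne_zero.resolve_left fun h ↦
      hHx' (hHa'.eqOn_zero_of_preconnected_of_eventuallyEq_zero
        (convex_ball 0 r).isPreconnected (mem_ball_self hr) h hx')
  let Q : Plane → ℂ := fun z ↦
    (Matrix.of fun i j : Fin k ↦ s (i + j + 1) z.1 - z.2 * s (i + j) z.1).det
  have hQ : ∀ x ∈ ball (0 : ℂ) r, H x ≠ 0 → ∃ c : ℂ, c ≠ 0 ∧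
      ∀ y, Q (x, y) = c * ∏ ζ ∈ T x, m x ζ * (ζ - y) := by
    intro x hx hHx
    obtain ⟨c, hc, hdet⟩ := det_hankel (hcard x hx hHx)
    refine ⟨c, hc, fun y ↦ ?_⟩
    rw [← hdet]
    refine congrArg Matrix.det (Matrix.ext fun i j ↦ ?_)
    simp only [Matrix.of_apply, hankel, (hTm x (hball hx)).2.2]
    rw [Finset.mul_sum, ← Finset.sum_sub_distrib]
    exact Finset.sum_congr rfl fun ζ _ ↦ by ring
  have hQ0 : ∀ z : Plane, z.1 ∈ ball (0 : ℂ) r → H z.1 ≠ 0 → (Q z = 0 ↔ z.2 ∈ T z.1) := by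
    intro z hz hHz
    obtain ⟨c, hc, hQz⟩ := hQ z.1 hz hHz
    have hm := (hTm z.1 (hball hz)).2.1
    rw [show Q z = _ from hQz z.2, mul_eq_zero, or_iff_right hc, Finset.prod_eq_zero_iff]
    constructor
    · rintro ⟨ζ, hζ, h⟩
      rwa [← sub_eq_zero.1 ((mul_eq_zero.1 h).resolve_left (Nat.cast_ne_zero.2 (hm ζ hζ)))]
    · exact fun h ↦ ⟨z.2, h, by simp⟩
  rw [eventually_nhdsWithin_iff] at hHev ⊢
  have hfst : Filter.Tendsto (fun z : Plane ↦ z.1) (𝓝 (0, 0)) (𝓝 0) := continuous_fst.tendsto _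
  have hsnd : Filter.Tendsto (fun z : Plane ↦ z.2) (𝓝 (0, 0)) (𝓝 0) := continuous_snd.tendsto _
  filter_upwards [hfst.eventually hHev, hfst.eventually (ball_mem_nhds (0 : ℂ) hr),
    hsnd.eventually (ball_mem_nhds (0 : ℂ) hR)] with z hHz hz1 hz2 hz0 hfz
  have hz10 : z.1 ≠ 0 := by
    intro h
    refine hfy z.2 (ball_subset_closedBall hz2) (fun h2 ↦ hz0 (Prod.ext h h2)) ?_
    have : ((0 : ℂ), z.2) = z := Prod.ext h.symm rfl
    rwa [this]
  replace hHz := hHz hz10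
  have hmem : z.2 ∈ T z.1 := ((hTm z.1 (hball hz1)).1 z.2).2 ⟨ball_subset_closedBall hz2, hfz⟩
  have hQa : AnalyticAt ℂ Q z := analyticAt_det
    (A := fun z ↦ Matrix.of fun i j : Fin k ↦ s (i + j + 1) z.1 - z.2 * s (i + j) z.1) fun i j ↦
      ((hs _ z.1 (hball hz1)).comp analyticAt_fst).sub
        (analyticAt_snd.mul ((hs _ z.1 (hball hz1)).comp analyticAt_fst))
  refine ⟨Q, hQa, (hQ0 z hz1 hHz).2 hmem, fun hzero ↦ ?_, ?_⟩
  -- `∂y Q ≠ 0` because `z.2` is a simple root of `Q (z.1, ·)`.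
  · obtain ⟨c, hc, hQz⟩ := hQ z.1 hz1 hHz
    have hm := (hTm z.1 (hball hz1)).2.1
    let P : ℂ → ℂ := fun y ↦ ∏ ζ ∈ (T z.1).erase z.2, m z.1 ζ * (ζ - y)
    have hP : HasDerivAt P (deriv P z.2) z.2 := by
      refine DifferentiableAt.hasDerivAt (AnalyticAt.differentiableAt ?_)
      exact Finset.analyticAt_fun_prod _ fun ζ _ ↦
        analyticAt_const.mul (analyticAt_const.sub analyticAt_id)
    have h1 : HasDerivAt (fun y ↦ Q (z.1, y)) 0 z.2 := by
      have := hQa.differentiableAt.hasFDerivAt.comp_hasDerivAt z.2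
        ((hasDerivAt_const z.2 z.1).prodMk (hasDerivAt_id z.2))
      rw [hzero] at this
      exact this
    have h2 : HasDerivAt (fun y ↦ c * (m z.1 z.2 * (z.2 - y) * P y))
        (c * (m z.1 z.2 * (-1) * P z.2 + m z.1 z.2 * (z.2 - z.2) * deriv P z.2)) z.2 :=
      (((((hasDerivAt_id z.2).const_sub z.2).const_mul _).mul hP).const_mul c)
    have h3 : (fun y ↦ Q (z.1, y)) = fun y ↦ c * (m z.1 z.2 * (z.2 - y) * P y) := by
      funext y
      rw [hQz, ← Finset.mul_prod_erase _ _ hmem]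
    rw [h3] at h1
    have h4 := h2.unique h1
    have h5 : P z.2 ≠ 0 := Finset.prod_ne_zero_iff.2 fun ζ hζ ↦
      mul_ne_zero (Nat.cast_ne_zero.2 (hm ζ (Finset.mem_of_mem_erase hζ)))
        (sub_ne_zero.2 (Finset.ne_of_mem_erase hζ))
    have h6 : (m z.1 z.2 : ℂ) ≠ 0 := Nat.cast_ne_zero.2 (hm _ hmem)
    simp [hc, h5, h6] at h4
  · filter_upwards [(continuous_fst.tendsto z).eventually (isOpen_ball.mem_nhds hz1),
      (continuous_snd.tendsto z).eventually (isOpen_ball.mem_nhds hz2),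
      ((hHa' z.1 hz1).continuousAt.comp continuous_fst.continuousAt).eventually_ne hHz]
      with w hw1 hw2 hHw
    rw [hQ0 w hw1 hHw, (hTm w.1 (hball hw1)).1 w.2, and_iff_right (ball_subset_closedBall hw2)]

theorem exists_equiv_apply_snd {v : Plane} (hv : v ≠ 0) :
    ∃ L : Plane ≃L[ℂ] Plane, L (0, 1) = v := by
  by_cases h2 : v.2 = 0
  · have h1 : v.1 ≠ 0 := fun h1 ↦ hv (Prod.ext h1 h2)
    refine ⟨formEquiv (v.1 • ContinuousLinearMap.snd ℂ ℂ ℂ) (ContinuousLinearMap.fst ℂ ℂ ℂ)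
      (by simp [formDet, h1]), ?_⟩
    change (_, _) = v
    refine Prod.ext ?_ ?_ <;> simp [h2]
  · refine ⟨formEquiv (ContinuousLinearMap.fst ℂ ℂ ℂ + v.1 • ContinuousLinearMap.snd ℂ ℂ ℂ)
      (v.2 • ContinuousLinearMap.snd ℂ ℂ ℂ) (by simp [formDet, h2]), ?_⟩
    change (_, _) = v
    refine Prod.ext ?_ ?_ <;> simp

/-- The singular zeros of a holomorphic function of two variables are isolated. -/
theorem eventually_isSmoothZeroAt {f : Plane → ℂ} {z₀ : Plane} (hf : AnalyticAt ℂ f z₀)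
    (hne : ∃ᶠ z in 𝓝 z₀, f z ≠ 0) : ∀ᶠ z in 𝓝[≠] z₀, f z = 0 → IsSmoothZeroAt f z := by
  by_cases hfz₀ : f z₀ ≠ 0
  · filter_upwards [nhdsWithin_le_nhds (hf.continuousAt.eventually_ne hfz₀)] with z hz h0
    exact absurd h0 hz
  rw [not_not] at hfz₀
  obtain ⟨ε, hε, hfε⟩ := Metric.eventually_nhds_iff_ball.1 hf.eventually_analyticAt
  obtain ⟨z₁, hz₁, hfz₁⟩ := (hne.and_eventually (ball_mem_nhds z₀ hε)).exists.imp
    fun z h ↦ And.intro h.2 h.1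
  obtain ⟨v, hv⟩ : ∃ v, v = z₁ - z₀ := ⟨_, rfl⟩
  -- The line joining `z₀` to a point where `f ≠ 0` will be the new `y`-axis; by the identity
  -- theorem `f` is not locally zero on it.
  have hline : ∃ᶠ t in 𝓝 (0 : ℂ), f (z₀ + t • v) ≠ 0 := by
    have hlin : Continuous fun t : ℂ ↦ z₀ + t • v := by fun_prop
    have hconv : Convex ℝ ((fun t : ℂ ↦ z₀ + t • v) ⁻¹' ball z₀ ε) := by
      have : (fun t : ℂ ↦ z₀ + t • v) ⁻¹' ball z₀ ε = (fun t : ℂ ↦ t • v) ⁻¹' ball 0 ε := by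
        ext t
        simp [dist_eq_norm]
      rw [this]
      exact (convex_ball 0 ε).is_linear_preimage
        ⟨fun a b ↦ add_smul a b v, fun a b ↦ smul_assoc a b v⟩
    have han : AnalyticOnNhd ℂ (fun t : ℂ ↦ f (z₀ + t • v))
        ((fun t : ℂ ↦ z₀ + t • v) ⁻¹' ball z₀ ε) :=
      fun t ht ↦ (hfε _ ht).comp (f := fun t : ℂ ↦ z₀ + t • v)
        (analyticAt_const.add (analyticAt_smul analyticAt_id analyticAt_const))
    intro h
    have h1 : z₀ + (1 : ℂ) • v = z₁ := by simp [hv]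
    refine hfz₁ ?_
    rw [← h1]
    refine han.eqOn_zero_of_preconnected_of_eventuallyEq_zero hconv.isPreconnected (z₀ := 0)
      (by simpa using hε) ?_ (by rw [mem_preimage, h1]; exact hz₁)
    filter_upwards [h] with t ht using not_not.1 ht
  have hv0 : v ≠ 0 := by
    rintro rfl
    rw [eq_comm, sub_eq_zero] at hv
    exact hfz₁ (hv ▸ hfz₀)
  obtain ⟨L, hL⟩ := exists_equiv_apply_snd hv0
  have hLv : ∀ y : ℂ, L (0, y) = y • v := fun y ↦ by
    rw [← hL, ← map_smul]
    simp
  let τ : Plane → Plane := fun w ↦ z₀ + L w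
  let ψ : Plane → Plane := fun z ↦ L.symm (z - z₀)
  have hτψ : ∀ z, τ (ψ z) = z := fun z ↦ by simp [τ, ψ]
  have hψz₀ : ψ z₀ = 0 := by simp [ψ]
  have hτ : AnalyticAt ℂ τ (0, 0) := analyticAt_const.add (L.toContinuousLinearMap.analyticAt _)
  have hψ : ∀ z, HasFDerivAt ψ (L.symm : Plane →L[ℂ] Plane) z := fun z ↦
    (L.symm : Plane →L[ℂ] Plane).hasFDerivAt.comp z ((hasFDerivAt_id z).sub_const z₀)
  have hψa : ∀ z, AnalyticAt ℂ ψ z := fun z ↦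
    ((L.symm : Plane →L[ℂ] Plane).analyticAt _).comp (analyticAt_id.sub analyticAt_const)
  have hτ0 : τ (0, 0) = z₀ := by
    change τ 0 = z₀
    rw [← hψz₀, hτψ]
  have hslice : ∃ᶠ y in 𝓝 (0 : ℂ), f (τ (0, y)) ≠ 0 := by
    simpa only [τ, hLv] using hline
  have hev := eventually_isSmoothZeroAt_of_slice (f := fun w ↦ f (τ w))
    (AnalyticAt.comp (by rwa [hτ0]) hτ) hslice
  have htend : Filter.Tendsto ψ (𝓝[≠] z₀) (𝓝[≠] (0, 0)) := by
    refine tendsto_nhdsWithin_of_tendsto_nhds_of_eventually_within _ ?_ ?_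
    · change Filter.Tendsto ψ _ (𝓝 0)
      rw [← hψz₀]
      exact (hψa z₀).continuousAt.tendsto.mono_left nhdsWithin_le_nhds
    · filter_upwards [self_mem_nhdsWithin] with z hz h0
      have h0' : ψ z = (0, 0) := h0
      exact hz (by rw [mem_singleton_iff, ← hτψ z, h0', hτ0])
  filter_upwards [htend.eventually hev] with z hz hfz
  obtain ⟨Q, hQ, hQ0, hdQ, hiff⟩ := hz (by rwa [hτψ])
  refine ⟨fun z ↦ Q (ψ z), hQ.comp (hψa z), hQ0, fun h0 ↦ hdQ ?_, ?_⟩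
  · have h1 : HasFDerivAt (fun z ↦ Q (ψ z))
        ((fderiv ℂ Q (ψ z)) ∘L (L.symm : Plane →L[ℂ] Plane)) z :=
      hQ.differentiableAt.hasFDerivAt.comp z (hψ z)
    rw [h1.fderiv] at h0
    refine ContinuousLinearMap.ext fun u ↦ ?_
    have := DFunLike.congr_fun h0 (L u)
    simpa using this
  · filter_upwards [(hψa z).continuousAt.eventually hiff] with w hw
    rwa [hτψ] at hw

end PowerSums

/-! ### Singular points of the polar divisor -/

section Surface

variable {S : Type*} [TopologicalSpace S] [ChartedSpace Plane S] [IsManifold 𝓘(ℂ, Plane) ω S]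

/-- A point near which `D` is a smooth zero set is regular. -/
theorem IsSmoothZeroAt.mem_regularLocus {D : Set S} {e : OpenPartialHomeomorph S Plane}
    (he : IsCoordinates e) {q : S} (hq : q ∈ e.source) {f : Plane → ℂ}
    (hf : IsSmoothZeroAt f (e q)) (hD : ∀ᶠ z in 𝓝 (e q), f z = 0 ↔ e.symm z ∈ D) :
    q ∈ regularLocus D := by
  obtain ⟨Q, hQ, hQ0, hdQ, hiff⟩ := hf
  -- A linear form completing `Q` to local coordinates in which `D` is `Q = 0`.
  obtain ⟨l, hl⟩ : ∃ l : Plane →L[ℂ] ℂ, formDet l (fderiv ℂ Q (e q)) ≠ 0 := by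
    by_contra! hall
    have h1 := hall (ContinuousLinearMap.fst ℂ ℂ ℂ)
    have h2 := hall (ContinuousLinearMap.snd ℂ ℂ ℂ)
    simp only [formDet, ContinuousLinearMap.coe_fst', ContinuousLinearMap.coe_snd'] at h1 h2
    refine hdQ (ContinuousLinearMap.ext fun u ↦ ?_)
    have h3 : fderiv ℂ Q (e q) (0, 1) = 0 := by linear_combination h1
    have h4 : fderiv ℂ Q (e q) (1, 0) = 0 := by linear_combination -h2
    rw [clm_apply_eq, h3, h4]
    simp
  have hφ : AnalyticAt ℂ (fun z ↦ (l (z - e q), Q z)) (e q) :=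
    ((l.analyticAt _).comp (analyticAt_id.sub analyticAt_const)).prod hQ
  have hφ' : HasFDerivAt (fun z ↦ (l (z - e q), Q z))
      (formEquiv _ _ hl : Plane →L[ℂ] Plane) (e q) := by
    rw [formEquiv_coe]
    exact (l.hasFDerivAt.comp (e q) ((hasFDerivAt_id (e q)).sub_const (e q))).prodMk
      hQ.differentiableAt.hasFDerivAt
  obtain ⟨e', he', hqe', hsub, heq⟩ := he.exists_change hq hφ hφ' (hiff.and hD)
  refine ⟨e', he', hqe', ?_, fun x hx ↦ ?_⟩
  · rw [(heq q hqe').1]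
    simp [hQ0]
  · obtain ⟨h1, h2, h3⟩ := heq x hx
    rw [h1, ← h2, h3, e.left_inv (hsub hx)]

/-- The singular points of the polar divisor are isolated. -/
theorem IsLogarithmic.eventually_mem_regularLocus {nabla : Connection S} {D : Set S}
    (h : IsLogarithmic nabla D) (p : S) : ∀ᶠ q in 𝓝[≠] p, q ∈ D → q ∈ regularLocus D := by
  by_cases hp : p ∈ D
  swap
  · filter_upwards [nhdsWithin_le_nhds (h.isClosed.isOpen_compl.mem_nhds hp)] with q hq hqD
    exact absurd hqD hq
  let e := chartAt Plane p
  have he : IsCoordinates e := IsManifold.chart_mem_maximalAtlas p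
  have hpe : p ∈ e.source := mem_chart_source Plane p
  obtain ⟨U, hU, hpU, hUe, f, hf, -⟩ := h.exists_equation he (e.map_source hpe)
  -- Reducedness excludes `f = 0` near the point, since the differential would vanish too.
  have hne : ∃ᶠ z in 𝓝 (e p), f z ≠ 0 := by
    intro hev
    obtain ⟨V, hV, hVo, hpV⟩ := eventually_nhds_iff.1 hev
    have hmem : e p ∈ imageIn D e ∩ U :=
      ⟨⟨e.map_source hpe, by rw [mem_preimage, e.left_inv hpe]; exact hp⟩, hpU⟩
    obtain ⟨z, hzV, -, -, hz⟩ := mem_closure_iff.1 (hf.reduced hmem) V hVo hpV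
    refine hz ?_
    have : f =ᶠ[𝓝 z] fun _ ↦ 0 := by
      filter_upwards [hVo.mem_nhds hzV] with w hw using not_not.1 (hV w hw)
    rw [this.fderiv_eq, fderiv_const_apply]
  have hev := eventually_isSmoothZeroAt (hf.analytic _ hpU) hne
  have htend : Filter.Tendsto e (𝓝[≠] p) (𝓝[≠] (e p)) := by
    refine tendsto_nhdsWithin_of_tendsto_nhds_of_eventually_within _
      ((e.continuousAt hpe).tendsto.mono_left nhdsWithin_le_nhds) ?_
    filter_upwards [self_mem_nhdsWithin, nhdsWithin_le_nhds (e.open_source.mem_nhds hpe)]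
      with q hq hqe h0
    exact hq (e.injOn hqe hpe h0)
  filter_upwards [htend.eventually hev, nhdsWithin_le_nhds (e.open_source.mem_nhds hpe),
    nhdsWithin_le_nhds ((e.continuousAt hpe).eventually (hU.mem_nhds hpU))] with q hq hqe hqU hqD
  refine IsSmoothZeroAt.mem_regularLocus he hqe (hq ?_) ?_
  · rw [hf.eq_zero_iff hUe hqU, e.left_inv hqe]
    exact hqD
  · filter_upwards [hU.mem_nhds hqU] with z hz using hf.eq_zero_iff hUe hz

/-- Every point of the surface, on the branch or not, has a punctured neighbourhood free of singular
points; this gives closedness and discreteness together. -/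
theorem IsLogarithmic.isClosed_and_discrete {nabla : Connection S} {D D₀ : Set S}
    (h : IsLogarithmic nabla D) (hD₀ : IsBranch D D₀) :
    IsClosed (D₀ \ regularLocus D) ∧ DiscreteTopology ↥(D₀ \ regularLocus D) := by
  have hsub : D₀ ⊆ D := by
    obtain ⟨p, -, rfl⟩ := hD₀
    exact h.isClosed.closure_subset_iff.2
      ((connectedComponentIn_subset _ _).trans (regularLocus_subset D))
  have := (isClosed_and_discrete_iff (S := D₀ \ regularLocus D)).2 fun p ↦ by
    rw [Filter.disjoint_principal_right]
    filter_upwards [h.eventually_mem_regularLocus p] with q hq hmem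
    exact hmem.2 (hq (hsub hmem.1))
  exact ⟨this.1, this.2.to_subtype⟩

end Surface

end AffineStructure

end

theorem theorem3 {S : Type*} [TopologicalSpace S] [T2Space S]
    [ChartedSpace AffineStructure.Plane S] [IsManifold 𝓘(ℂ, AffineStructure.Plane) ω S]
    (nabla : AffineStructure.Connection S) (D D₀ : Set S)
    (hnabla : AffineStructure.IsLogarithmic nabla D)
    (hD₀ : AffineStructure.IsBranch D D₀)
    (hmon : AffineStructure.HasSemisimpleMonodromy nabla D D₀) :
    ∃ Z : Set S, Z ⊆ D₀ ∧ IsClosed Z ∧ DiscreteTopology Z ∧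
      ∀ p ∈ D₀ \ Z, ∃ e : OpenPartialHomeomorph S AffineStructure.Plane,
        AffineStructure.IsAdapted D p e ∧
          ((∃ ν : ℂ, ν ≠ 0 ∧ AffineStructure.IsPowerModel nabla e ν) ∨
            ∃ n : ℕ, 1 < n ∧ AffineStructure.IsResidueModel nabla e n) := by
  -- `Z` consists of the singular points of `D` on `D₀`; every other point of `D₀` inherits the
  -- diagonal form from the point at which the monodromy is semisimple.
  refine ⟨D₀ \ AffineStructure.regularLocus D, sdiff_subset,
    (hnabla.isClosed_and_discrete hD₀).1, (hnabla.isClosed_and_discrete hD₀).2, fun p hp ↦ ?_⟩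
  have hpr : p ∈ AffineStructure.regularLocus D := not_not.1 fun h ↦ hp.2 ⟨hp.1, h⟩
  have hpD := AffineStructure.regularLocus_subset D hpr
  obtain ⟨q, hq, hqd⟩ := hmon.exists_isDiagonalNear hnabla
  have hpd := hD₀.isDiagonalNear hnabla hq hqd ⟨hp.1, hpr⟩
  obtain ⟨e, he⟩ := hpr
  exact hnabla.exists_model hpD he (hpd.isDiagonalAt hnabla hpD he.straightens he.mem_source)
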